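/- **Setting.** Let $\mu$ be a probability measure on $[-1,1]$ with at least two points in its support, and set $\alpha(a,b)=\log\int e^{ax+bx^2/2}\,d\mu(x)$; $\alpha',\alpha''$ denote derivatives in the first argument. Let $\mathbb P_X$ be a probability measure on $[-1,1]^d$ with positive definite covariance matrix, $\tau_0\in\mathbb R$, $\theta_0,\gamma_0\in\mathbb R^d$. For each $n$ let $A_n,M_n$ be symmetric $n\times n$ matrices, deterministic or random (all defined on one probability space), with $\sup_n\|A_n\|<\infty$ and $\sup_n\|M_n\|<\infty$ almost surely (operator norms). Given $(A_n,M_n)$, the data $(X,T,Y)$ have the following law: the rows $X_1,\dots,X_n$ are i.i.d. from $\mathbb P_X$; $\mathbb P(T=t\mid X)\propto\exp\big(\tfrac12t^\top M_nt+\sum_i t_iX_i^\top\gamma_0\big)$ on $\{\pm1\}^n$; and $Y$ has density with respect to $\mu^{\otimes n}$ $$f(y\mid T,X)\propto\exp\big(\tfrac12 y^\top A_ny+y^\top(\tau_0T+X\theta_0)\big).$$ Let $\mathcal T\subseteq\mathbb R\times\mathbb R^d$ be a closed convex parameter set containing $(\tau_0,\theta_0)$ (for instance $[-B,B]\times[-L,L]^d$,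 or the whole space). The estimator $(\hat\tau,\hat\theta)$ is the maximizer over $\mathcal T$ of the pseudo-likelihood $\prod_{i=1}^n f(Y_i\mid Y_{-i},T,X)$ whenever this maximizer exists and is unique, and is arbitrary otherwise. Independently of $(A_n,M_n)$ and of the data, let $\bar T$ be uniform on $\{\pm1\}^n$ and $\bar X_1,\dots,\bar X_n$ i.i.d. from $\mathbb P_X$, independent of $\bar T$. **Estimates.** For a parameter $(\tau,\theta)$ put $h=\tau\bar T+\bar X\theta$ and $\tilde h=-\tau\mathbf 1+\bar X\theta$; from mean vectors $m,\tilde m\in\mathbb R^n$ form $$\widehat{\mathrm{DE}}=\frac2n\sum_i\bar T_im_i,\qquad \widehat{\mathrm{IE}}=\frac1n\Big(\sum_i m_i-\sum_i\tilde m_i\Big)-\frac12\widehat{\mathrm{DE}}.$$ *Algorithm 1.* $m=u^{(M)}$, where $u^{(0)}=0$, $u^{(\ell+1)}=\alpha'(A_nu^{(\ell)}+h,0)$; $\tilde m$ is obtained in the same way with $\tilde h$ in place of $h$. *Algorithm 2.* Let $\beta>0$, $G_n=A_n/\beta$. Let $(q,\sigma^2)$ solve $$q=\mathbb E\big[\alpha'(H+\beta\sqrt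 q\,Z,\beta^2\sigma^2)^2\big],\qquad \sigma^2=\mathbb E\big[\alpha''(H+\beta\sqrt q\,Z,\beta^2\sigma^2)\big],\tag{1}$$ where $H$ is distributed as $\tau T+X^\top\theta$ with $T$ uniform on $\{\pm1\}$, $X\sim\mathbb P_X$, $Z\sim N(0,1)$ independent. Put $u^{[0]}=u^{[1]}=0$, $u^{[2]}=\sqrt q\,G_n\mathbf 1$, and for $k\ge2$ $$u^{[k+1]}=G_n\alpha'(\beta u^{[k]}+h,\beta^2\sigma^2)-d_k\,\alpha'(\beta u^{[k-1]}+h,\beta^2\sigma^2),\qquad d_k=\frac\beta n\sum_j\alpha''(\beta u^{[k]}_j+h_j,\beta^2\sigma^2),$$ and $m=\alpha'(\beta u^{[M]}+h,\beta^2\sigma^2)$. The vector $\tilde m$ is obtained in the same way, with $\tilde h$ in place of $h$ and with $H$ distributed as $-\tau+X^\top\theta$ in (1). Write $\widehat{\mathrm{DE}}_M(\tau,\theta)$, $\widehat{\mathrm{IE}}_M(\tau,\theta)$ for the resulting estimates. **Claim.** There are universal constants $C_0,\beta_0>0$ such that for $0<\beta<\beta_0$ system (1) has, for all $(\tau,\theta)$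 and for both laws of $H$, exactly one solution, and such that the following holds. If $\limsup_n\|A_n\|\le C_0$ almost surely, then for every $M\ge1$ and every $\varepsilon>0$ $$\lim_{n\to\infty}\mathbb P\big(|\widehat{\mathrm{DE}}_M(\tau_0,\theta_0)-\widehat{\mathrm{DE}}_M(\hat\tau,\hat\theta)|>\varepsilon\big)=0,\qquad \lim_{n\to\infty}\mathbb P\big(|\widehat{\mathrm{IE}}_M(\tau_0,\theta_0)-\widehat{\mathrm{IE}}_M(\hat\tau,\hat\theta)|>\varepsilon\big)=0,$$ both for Algorithm 1 and for Algorithm 2; for Algorithm 2 under the assumption that $\beta<\beta_0$, or that for every $n$ the matrix $A_n$ has zero diagonal and independent $N(0,\beta^2/n)$ entries above the diagonal. Here $\mathbb P$ refers to all the randomness: $(A_n,M_n)$, the data, and $(\bar T,\bar X)$. -/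

import Mathlib

open MeasureTheory ProbabilityTheory Filter Topology Matrix

noncomputable section

namespace Interference

/-! ### Exponential tilts -/

/-- The log-partition function `α(a, b) = log ∫ exp (a x + b x² / 2) dμ(x)`. -/
def alpha (μ : Measure ℝ) (a b : ℝ) : ℝ :=
  Real.log (∫ x, Real.exp (a * x + b / 2 * x ^ 2) ∂μ)

/-- `α'`, the first derivative of `α` in its first argument. -/
def alpha' (μ : Measure ℝ) (a b : ℝ) : ℝ := deriv (fun s => alpha μ s b) a

/-- `α''`, the second derivative of `α` in its first argument. -/
def alpha'' (μ : Measure ℝ) (a b : ℝ) : ℝ := deriv (fun s => alpha' μ s b) a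

/-! ### Data -/

/-- The covariates of `n` units; row `i` holds the covariates of unit `i`. -/
abbrev Covariates (n d : ℕ) : Type := Fin n → Fin d → ℝ

/-- Binary treatment profiles; `true` encodes `+1` and `false` encodes `-1`. -/
abbrev Treatments (n : ℕ) : Type := Fin n → Bool

/-- The outcomes of `n` units. -/
abbrev Outcomes (n : ℕ) : Type := Fin n → ℝ

/-- Observed data `(X, T, Y)`. -/
abbrev Data (n d : ℕ) : Type := Covariates n d × Treatments n × Outcomes n

/-- The auxiliary pair `(T̄, X̄)` generated by the algorithms. -/
abbrev Auxiliary (n d : ℕ) : Type := Treatments n × Covariates n d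

/-- A parameter `(τ, θ)` of the outcome model. -/
abbrev Param (d : ℕ) : Type := ℝ × (Fin d → ℝ)

/-- The numerical value `±1` of a treatment. -/
def spin (b : Bool) : ℝ := if b then 1 else -1

/-- The external field `τ t + x θ`. -/
def field {n d : ℕ} (p : Param d) (t : Treatments n) (x : Covariates n d) : Fin n → ℝ :=
  fun i => p.1 * spin (t i) + x i ⬝ᵥ p.2

/-- The external field `-τ 1 + x θ` of the profile in which no unit is treated. -/
def controlField {n d : ℕ} (p : Param d) (x : Covariates n d) : Fin n → ℝ :=
  fun i => -p.1 + x i ⬝ᵥ p.2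

/-- The operator norm of a matrix acting on Euclidean space. -/
def opNorm {n : ℕ} (A : Matrix (Fin n) (Fin n) ℝ) : ℝ :=
  ‖Matrix.toEuclideanCLM (n := Fin n) (𝕜 := ℝ) A‖

/-! ### The outcome model and the propensity score model -/

/-- The unnormalised weight `exp (yᵀ A y / 2 + yᵀ (τ t + x θ))`. -/
def outcomeWeight {n d : ℕ} (A : Matrix (Fin n) (Fin n) ℝ) (p : Param d)
    (x : Covariates n d) (t : Treatments n) (y : Outcomes n) : ℝ :=
  Real.exp (1 / 2 * (y ⬝ᵥ A *ᵥ y) + y ⬝ᵥ field p t x)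

/-- The joint density `f(y | t, x)` of the outcomes with respect to `μ^{⊗ n}`. -/
def outcomeDensity {n d : ℕ} (μ : Measure ℝ) (A : Matrix (Fin n) (Fin n) ℝ) (p : Param d)
    (x : Covariates n d) (t : Treatments n) (y : Outcomes n) : ℝ :=
  outcomeWeight A p x t y / ∫ y', outcomeWeight A p x t y' ∂(Measure.pi fun _ : Fin n => μ)

/-- The unnormalised weight `exp (tᵀ W t / 2 + ∑ i, t_i x_iᵀ γ)`. -/
def propensityWeight {n d : ℕ} (W : Matrix (Fin n) (Fin n) ℝ) (γ : Fin d → ℝ)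
    (x : Covariates n d) (t : Treatments n) : ℝ :=
  Real.exp (1 / 2 * ((fun i => spin (t i)) ⬝ᵥ W *ᵥ (fun i => spin (t i)))
    + ∑ i, spin (t i) * (x i ⬝ᵥ γ))

/-- The propensity score `P(T = t | x)`. -/
def propensity {n d : ℕ} (W : Matrix (Fin n) (Fin n) ℝ) (γ : Fin d → ℝ)
    (x : Covariates n d) (t : Treatments n) : ℝ :=
  propensityWeight W γ x t / ∑ t' : Treatments n, propensityWeight W γ x t'

/-- The conditional density of the data given the interaction matrices, with respect to
`PX^{⊗ n} ⊗ counting measure ⊗ μ^{⊗ n}`. -/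
def dataDensity {n d : ℕ} (μ : Measure ℝ) (A W : Matrix (Fin n) (Fin n) ℝ) (p : Param d)
    (γ : Fin d → ℝ) (z : Data n d) : ℝ :=
  propensity W γ z.1 z.2.1 * outcomeDensity μ A p z.1 z.2.1 z.2.2

/-- The joint law of the sources of the interaction matrices, of the observed data and of the
auxiliary pair: given the matrices `A` and `W`, the covariates are i.i.d. from `PX`, the treatments
follow the propensity score model, the outcomes follow the outcome model; independently, `T̄` is
uniform on `{±1}ⁿ` and the rows of `X̄` are i.i.d. from `PX`. -/
def experimentLaw {Ω : Type*} [MeasurableSpace Ω] {n d : ℕ} (P : Measure Ω)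
    (μ : Measure ℝ) (PX : Measure (Fin d → ℝ)) (A W : Ω → Matrix (Fin n) (Fin n) ℝ)
    (p : Param d) (γ : Fin d → ℝ) : Measure (Ω × Data n d × Auxiliary n d) :=
  (P.prod
    (((Measure.pi fun _ : Fin n => PX).prod
        ((Measure.count : Measure (Treatments n)).prod (Measure.pi fun _ : Fin n => μ))).prod
      ((uniformOn (Set.univ : Set (Treatments n))).prod
        (Measure.pi fun _ : Fin n => PX)))).withDensity
    fun s => ENNReal.ofReal (dataDensity μ (A s.1) (W s.1) p γ s.2.1)

/-- The covariance matrix of the covariate distribution. -/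
def covMatrix {d : ℕ} (PX : Measure (Fin d → ℝ)) : Matrix (Fin d) (Fin d) ℝ :=
  Matrix.of fun k l => cov[fun x => x k, fun x => x l; PX]

/-- Symmetric Gaussian interactions: independent `N(0, β² / n)` entries above the diagonal and
zeros on the diagonal. -/
def IsGaussianInteraction {Ω : Type*} [MeasurableSpace Ω] (P : Measure Ω) (β : ℝ) {n : ℕ}
    (A : Ω → Matrix (Fin n) (Fin n) ℝ) : Prop :=
  (∀ ω, (A ω).IsSymm) ∧ (∀ ω i, A ω i i = 0) ∧
  (∀ i j, i < j → P.map (fun ω => A ω i j) = gaussianReal 0 (Real.toNNReal (β ^ 2 / n))) ∧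
  iIndepFun (fun (e : {e : Fin n × Fin n // e.1 < e.2}) ω => A ω e.1.1 e.1.2) P

/-! ### The maximum pseudo-likelihood estimator -/

/-- The conditional density `f(y_i | y_{-i}, t, x)` (with respect to `μ`) derived from the joint
density. -/
def condDensity {n d : ℕ} (μ : Measure ℝ) (A : Matrix (Fin n) (Fin n) ℝ) (p : Param d)
    (z : Data n d) (i : Fin n) : ℝ :=
  outcomeDensity μ A p z.1 z.2.1 z.2.2 /
    ∫ s, outcomeDensity μ A p z.1 z.2.1 (Function.update z.2.2 i s) ∂μ

/-- The pseudo-likelihood of the parameter `p`. -/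
def pseudoLikelihood {n d : ℕ} (μ : Measure ℝ) (A : Matrix (Fin n) (Fin n) ℝ) (z : Data n d)
    (p : Param d) : ℝ :=
  ∏ i, condDensity μ A p z i

/-- `p` is the unique maximiser of `l` over `Θ`. -/
def IsUniqueMaximizer {d : ℕ} (Θ : Set (Param d)) (l : Param d → ℝ) (p : Param d) : Prop :=
  p ∈ Θ ∧ ∀ q ∈ Θ, q ≠ p → l q < l p

/-- `est` is the maximum pseudo-likelihood estimator over the parameter set `Θ`: it returns the
maximiser of the pseudo-likelihood whenever there is exactly one; its value is arbitrary
otherwise. -/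
def IsMPLE {d : ℕ} (μ : Measure ℝ) (Θ : Set (Param d))
    (est : ∀ n : ℕ, Matrix (Fin n) (Fin n) ℝ → Data n d → Param d) : Prop :=
  ∀ (n : ℕ) (A : Matrix (Fin n) (Fin n) ℝ) (z : Data n d) (p : Param d),
    IsUniqueMaximizer Θ (pseudoLikelihood μ A z) p → est n A z = p

/-! ### Effect estimates from mean vectors -/

/-- `(2 / n) ∑ i, t_i m_i`. -/
def directEffect {n : ℕ} (t : Treatments n) (m : Fin n → ℝ) : ℝ :=
  2 / n * ∑ i, spin (t i) * m i

/-- `(1 / n) (∑ i, m_i - ∑ i, m'_i) - DE / 2`. -/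
def indirectEffect {n : ℕ} (t : Treatments n) (m m' : Fin n → ℝ) : ℝ :=
  1 / n * (∑ i, m i - ∑ i, m' i) - 1 / 2 * directEffect t m

/-! ### The mean-field algorithm -/

/-- The iterates `u⁽⁰⁾ = 0`, `u⁽ˡ⁺¹⁾ = α'(A u⁽ˡ⁾ + h, 0)`. -/
def meanField {n : ℕ} (μ : Measure ℝ) (A : Matrix (Fin n) (Fin n) ℝ) (h : Fin n → ℝ) :
    ℕ → Fin n → ℝ
  | 0 => 0
  | l + 1 => fun i => alpha' μ ((A *ᵥ meanField μ A h l) i + h i) 0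

/-- The direct effect estimate after `M` mean-field iterations run with parameter `p`. -/
def meanFieldDE {n d : ℕ} (μ : Measure ℝ) (A : Matrix (Fin n) (Fin n) ℝ) (M : ℕ)
    (a : Auxiliary n d) (p : Param d) : ℝ :=
  directEffect a.1 (meanField μ A (field p a.1 a.2) M)

/-- The indirect effect estimate after `M` mean-field iterations run with parameter `p`. -/
def meanFieldIE {n d : ℕ} (μ : Measure ℝ) (A : Matrix (Fin n) (Fin n) ℝ) (M : ℕ)
    (a : Auxiliary n d) (p : Param d) : ℝ :=
  indirectEffect a.1 (meanField μ A (field p a.1 a.2) M)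
    (meanField μ A (controlField p a.2) M)

/-! ### The AMP algorithm -/

/-- The law of `τ T + Xᵀ θ`, with `T` uniform on `{±1}` and `X ∼ PX` independent. -/
def fieldLaw {d : ℕ} (PX : Measure (Fin d → ℝ)) (p : Param d) : Measure ℝ :=
  ((uniformOn (Set.univ : Set Bool)).prod PX).map fun w => p.1 * spin w.1 + w.2 ⬝ᵥ p.2

/-- The law of `-τ + Xᵀ θ`, with `X ∼ PX`. -/
def controlFieldLaw {d : ℕ} (PX : Measure (Fin d → ℝ)) (p : Param d) : Measure ℝ :=
  PX.map fun x => -p.1 + x ⬝ᵥ p.2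

/-- `w = (q, σ²)` solves `q = E[α'(H + β √q G, β² σ²)²]`, `σ² = E[α''(H + β √q G, β² σ²)]`, where
`H ∼ ν` and `G ∼ N(0, 1)` are independent. -/
def IsFixedPoint (μ ν : Measure ℝ) (β : ℝ) (w : ℝ × ℝ) : Prop :=
  w.1 = ∫ s, alpha' μ (s.1 + β * √w.1 * s.2) (β ^ 2 * w.2) ^ 2 ∂(ν.prod (gaussianReal 0 1)) ∧
  w.2 = ∫ s, alpha'' μ (s.1 + β * √w.1 * s.2) (β ^ 2 * w.2) ∂(ν.prod (gaussianReal 0 1))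

open Classical in
/-- The solution `(q, σ²)` of the fixed point system (meaningful when there is exactly one). -/
def fixedPoint (μ ν : Measure ℝ) (β : ℝ) : ℝ × ℝ :=
  if h : ∃ w, IsFixedPoint μ ν β w then h.choose else 0

/-- The AMP iterates `u⁽ᵏ⁾` with external field `h` and state evolution constants `w = (q, σ²)`. -/
def amp {n : ℕ} (μ : Measure ℝ) (β : ℝ) (G : Matrix (Fin n) (Fin n) ℝ) (h : Fin n → ℝ)
    (w : ℝ × ℝ) : ℕ → Fin n → ℝ
  | 0 => 0
  | 1 => 0
  | 2 => fun i => ∑ j, G i j * √w.1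
  | k + 3 => fun i =>
      ∑ l, G i l * alpha' μ (β * amp μ β G h w (k + 2) l + h l) (β ^ 2 * w.2)
      - (β / n * ∑ j, alpha'' μ (β * amp μ β G h w (k + 2) j + h j) (β ^ 2 * w.2))
        * alpha' μ (β * amp μ β G h w (k + 1) i + h i) (β ^ 2 * w.2)

/-- The AMP mean estimate `α'(β u⁽ᴹ⁾ + h, β² σ²)`. -/
def ampMean {n : ℕ} (μ : Measure ℝ) (β : ℝ) (G : Matrix (Fin n) (Fin n) ℝ) (h : Fin n → ℝ)
    (w : ℝ × ℝ) (M : ℕ) : Fin n → ℝ :=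
  fun i => alpha' μ (β * amp μ β G h w M i + h i) (β ^ 2 * w.2)

/-- The direct effect estimate of the AMP algorithm run with parameter `p` on `A = β G`. -/
def ampDE {n d : ℕ} (μ : Measure ℝ) (PX : Measure (Fin d → ℝ)) (β : ℝ)
    (A : Matrix (Fin n) (Fin n) ℝ) (M : ℕ) (a : Auxiliary n d) (p : Param d) : ℝ :=
  directEffect a.1
    (ampMean μ β (β⁻¹ • A) (field p a.1 a.2) (fixedPoint μ (fieldLaw PX p) β) M)

/-- The indirect effect estimate of the AMP algorithm run with parameter `p` on `A = β G`. -/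
def ampIE {n d : ℕ} (μ : Measure ℝ) (PX : Measure (Fin d → ℝ)) (β : ℝ)
    (A : Matrix (Fin n) (Fin n) ℝ) (M : ℕ) (a : Auxiliary n d) (p : Param d) : ℝ :=
  indirectEffect a.1
    (ampMean μ β (β⁻¹ • A) (field p a.1 a.2) (fixedPoint μ (fieldLaw PX p) β) M)
    (ampMean μ β (β⁻¹ • A) (controlField p a.2) (fixedPoint μ (controlFieldLaw PX p) β) M)

/-- Stability under plug-in: the estimate computed with the true parameter `p` and the one computed
with the estimator `est` differ by `o_P(1)`. -/
def PlugInStable {Ω : Type*} [MeasurableSpace Ω] {d : ℕ} (P : Measure Ω) (μ : Measure ℝ)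
    (PX : Measure (Fin d → ℝ)) (A W : ∀ n : ℕ, Ω → Matrix (Fin n) (Fin n) ℝ)
    (p : Param d) (γ : Fin d → ℝ)
    (est : ∀ n : ℕ, Matrix (Fin n) (Fin n) ℝ → Data n d → Param d)
    (effect : ∀ n : ℕ, Matrix (Fin n) (Fin n) ℝ → Auxiliary n d → Param d → ℝ) : Prop :=
  ∀ ε : ℝ, 0 < ε →
    Tendsto
      (fun n : ℕ => experimentLaw P μ PX (A n) (W n) p γ
        {s | ε < |effect n (A n s.1) s.2.2 p
              - effect n (A n s.1) s.2.2 (est n (A n s.1) s.2.1)|})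
      atTop (𝓝 0)

end Interference

end

open Interference

/-! Two facts give the theorem: the estimator is consistent, and each effect estimate is continuous
in the parameter at the truth, uniformly in the dimension. Conditionally on a bound for the operator
norms, which holds outside an event of small probability, both facts are deterministic statements on
an event of probability tending to one.

Consistency. Given the other outcomes, `Y_i` has the exponential tilt of `μ` with field `localField`
and quadratic parameter `A i i`, so the log-pseudo-likelihood is a sum of terms linear in the local
fields minus `α` of them, hence concave in the parameter. Its score at the truth is a sum of
statistics each centred in its own coordinate. The second moment of such a sum is controlled by the
influence of single coordinates (`integral_sum_sq_mul_le`), which gives order `n ^ (3/2)` under an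
operator norm bound, so the score is `o(n)`. The curvature is of order `n`: because `‖A y‖² ≤ K² n`,
most local fields are bounded, and there `α''` is bounded below. It remains to see that the design
is nondegenerate (`exists_design_lower_bound`). The same second moment argument applied to the
propensity model shows that the treatments fluctuate around conditional means bounded away from `±1`
for most units, in directions asymptotically uncorrelated with the covariates; the covariates
themselves obey a law of large numbers. On every small sphere around the truth the
log-pseudo-likelihood is then below its central value, and concavity puts its unique maximiser over
any closed convex set containing the truth inside the ball
(`exists_isUniqueMaximizer_pseudoLikelihood`).

Stability. Both algorithms alternate matrices of bounded norm with bounded Lipschitz functions, so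
after a fixed number of steps the mean squared change of the iterates is controlled by the change of
the field, with constants free of `n` (`exists_meanField_stable`, `exists_amp_stable`). AMP also
uses `(q, σ²)`. For `β ≤ 1/10` the system (1) is a contraction, which yields existence, uniqueness
and Lipschitz dependence on the parameter. The delicate point is that `q` enters through `√q`; the
symmetry of the Gaussian variable makes the averages Lipschitz in `q` all the same.

Gaussian interactions. The squared operator norm dominates the squared length of the first row,
which is exponentially unlikely to fall below a fixed multiple of `β²`. A small enough `C₀`
therefore forces `β < 1/10`, and this case reduces to the previous one
(`lt_of_isGaussianInteraction`). -/

/-! ### Moments of exponential tilts -/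

namespace Interference

/-- The unnormalised moment `∫ x ^ k exp (a x + b x² / 2) dμ(x)`. -/
noncomputable def rawMoment (μ : Measure ℝ) (k : ℕ) (a b : ℝ) : ℝ :=
  ∫ x, x ^ k * Real.exp (a * x + b / 2 * x ^ 2) ∂μ

/-- The `k`-th moment of the exponential tilt of `μ` with parameters `a` and `b`. -/
noncomputable def tiltMoment (μ : Measure ℝ) (k : ℕ) (a b : ℝ) : ℝ :=
  rawMoment μ k a b / rawMoment μ 0 a b

/-- A finite nonzero measure carried by `[-1, 1]`. -/
structure UnitCarried (μ : Measure ℝ) : Prop where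
  finite : IsFiniteMeasure μ
  ne_zero : μ ≠ 0
  ae_mem : ∀ᵐ x ∂μ, x ∈ Set.Icc (-1 : ℝ) 1

lemma abs_tilt_exponent_le {x a b : ℝ} (hx : x ∈ Set.Icc (-1 : ℝ) 1) :
    a * x + b / 2 * x ^ 2 ≤ |a| + |b| := by
  have h1 : |x| ≤ 1 := abs_le.2 hx
  have h2 : a * x ≤ |a| := (le_abs_self _).trans (by
    rw [abs_mul]; exact mul_le_of_le_one_right (abs_nonneg _) h1)
  have h3 : b / 2 * x ^ 2 ≤ |b| := by
    have : |b / 2 * x ^ 2| ≤ |b| := by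
      rw [abs_mul, abs_div, abs_pow, abs_two]
      have := pow_le_one₀ (n := 2) (abs_nonneg x) h1
      nlinarith [abs_nonneg b]
    exact (le_abs_self _).trans this
  linarith

lemma norm_rawMoment_integrand_le {x a b : ℝ} (k : ℕ) (hx : x ∈ Set.Icc (-1 : ℝ) 1) :
    ‖x ^ k * Real.exp (a * x + b / 2 * x ^ 2)‖ ≤ Real.exp (|a| + |b|) := by
  rw [norm_mul, norm_pow, Real.norm_eq_abs, Real.norm_eq_abs, Real.abs_exp]
  have h1 : |x| ^ k ≤ 1 := pow_le_one₀ (abs_nonneg x) (abs_le.2 hx)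
  have h2 := Real.exp_le_exp.2 (abs_tilt_exponent_le (a := a) (b := b) hx)
  calc _ ≤ 1 * Real.exp (a * x + b / 2 * x ^ 2) := by gcongr
    _ ≤ _ := by simpa using h2

variable {μ : Measure ℝ}

lemma integrable_rawMoment (hμ : UnitCarried μ) (k : ℕ) (a b : ℝ) :
    Integrable (fun x => x ^ k * Real.exp (a * x + b / 2 * x ^ 2)) μ := by
  have := hμ.finite
  refine Integrable.of_bound (C := Real.exp (|a| + |b|)) (by fun_prop) ?_
  filter_upwards [hμ.ae_mem] with x hx using norm_rawMoment_integrand_le k hx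

lemma rawMoment_zero_pos (hμ : UnitCarried μ) (a b : ℝ) : 0 < rawMoment μ 0 a b := by
  have := hμ.finite
  have : NeZero μ := ⟨hμ.ne_zero⟩
  have hi := integrable_rawMoment hμ 0 a b
  have : 0 < ∫ x, x ^ 0 * Real.exp (a * x + b / 2 * x ^ 2) ∂μ := by
    simp only [pow_zero, one_mul] at hi ⊢
    exact integral_exp_pos hi
  exact this

lemma hasDerivAt_rawMoment_left (hμ : UnitCarried μ) (k : ℕ) (a b : ℝ) :
    HasDerivAt (fun s => rawMoment μ k s b) (rawMoment μ (k + 1) a b) a := by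
  have := hμ.finite
  refine (hasDerivAt_integral_of_dominated_loc_of_deriv_le
    (F' := fun s x => x ^ (k + 1) * Real.exp (s * x + b / 2 * x ^ 2))
    (bound := fun _ => Real.exp (|a| + 1 + |b|)) (Metric.ball_mem_nhds a one_pos)
    (.of_forall fun s => by fun_prop) (integrable_rawMoment hμ k a b) (by fun_prop) ?_
    (integrable_const _) ?_).2
  · filter_upwards [hμ.ae_mem] with x hx s hs
    refine (norm_rawMoment_integrand_le (k + 1) hx).trans (Real.exp_le_exp.2 ?_)
    have : |s - a| < 1 := by simpa [Real.dist_eq] using hs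
    have := abs_sub_abs_le_abs_sub s a
    linarith
  · refine .of_forall fun x s _ => ?_
    have h1 : HasDerivAt (fun s : ℝ => s * x + b / 2 * x ^ 2) x s := by
      simpa using ((hasDerivAt_id s).mul_const x).add_const (b / 2 * x ^ 2)
    exact (h1.exp.const_mul (x ^ k)).congr_deriv (by ring)

lemma hasDerivAt_rawMoment_right (hμ : UnitCarried μ) (k : ℕ) (a b : ℝ) :
    HasDerivAt (fun s => rawMoment μ k a s) (rawMoment μ (k + 2) a b / 2) b := by
  have := hμ.finite
  have key := (hasDerivAt_integral_of_dominated_loc_of_deriv_le (μ := μ)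
    (F := fun s x => x ^ k * Real.exp (a * x + s / 2 * x ^ 2))
    (F' := fun s x => x ^ (k + 2) * Real.exp (a * x + s / 2 * x ^ 2) / 2)
    (bound := fun _ => Real.exp (|a| + (|b| + 1))) (Metric.ball_mem_nhds b one_pos)
    (.of_forall fun s => by fun_prop) (integrable_rawMoment hμ k a b) (by fun_prop) ?_
    (integrable_const _) ?_).2
  · rwa [integral_div] at key
  · filter_upwards [hμ.ae_mem] with x hx s hs
    have h1 := norm_rawMoment_integrand_le (a := a) (b := s) (k + 2) hx
    have h2 : Real.exp (|a| + |s|) ≤ Real.exp (|a| + (|b| + 1)) := Real.exp_le_exp.2 (by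
      have : |s - b| < 1 := by simpa [Real.dist_eq] using hs
      have := abs_sub_abs_le_abs_sub s b
      linarith)
    rw [norm_div, Real.norm_ofNat]
    have := norm_nonneg (x ^ (k + 2) * Real.exp (a * x + s / 2 * x ^ 2))
    linarith
  · refine .of_forall fun x s _ => ?_
    have h1 : HasDerivAt (fun s : ℝ => a * x + s / 2 * x ^ 2) (1 / 2 * x ^ 2) s := by
      simpa using (((hasDerivAt_id s).div_const 2).mul_const (x ^ 2)).const_add (a * x)
    exact (h1.exp.const_mul (x ^ k)).congr_deriv (by ring)

lemma abs_tiltMoment_le_one (hμ : UnitCarried μ) (k : ℕ) (a b : ℝ) :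
    |tiltMoment μ k a b| ≤ 1 := by
  rw [tiltMoment, abs_div, abs_of_pos (rawMoment_zero_pos hμ a b),
    div_le_one (rawMoment_zero_pos hμ a b)]
  refine (abs_integral_le_integral_abs).trans (integral_mono_ae
    (integrable_rawMoment hμ k a b).abs (integrable_rawMoment hμ 0 a b) ?_)
  filter_upwards [hμ.ae_mem] with x hx
  simp only [abs_mul, Real.abs_exp, abs_pow, pow_zero, one_mul]
  exact mul_le_of_le_one_left (Real.exp_pos _).le (pow_le_one₀ (abs_nonneg x) (abs_le.2 hx))

/-- The derivative is the covariance of `x ^ k` and `x` under the tilt. All regularity of `α'` and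
`α''` below comes from this identity and its analogue in `b`, since tilted moments are bounded by
one. -/
lemma hasDerivAt_tiltMoment_left (hμ : UnitCarried μ) (k : ℕ) (a b : ℝ) :
    HasDerivAt (fun s => tiltMoment μ k s b)
      (tiltMoment μ (k + 1) a b - tiltMoment μ k a b * tiltMoment μ 1 a b) a := by
  have h0 := (rawMoment_zero_pos hμ a b).ne'
  refine ((hasDerivAt_rawMoment_left hμ k a b).fun_div
    (hasDerivAt_rawMoment_left hμ 0 a b) h0).congr_deriv ?_
  simp only [tiltMoment]
  field_simp

lemma hasDerivAt_tiltMoment_right (hμ : UnitCarried μ) (k : ℕ) (a b : ℝ) :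
    HasDerivAt (fun s => tiltMoment μ k a s)
      ((tiltMoment μ (k + 2) a b - tiltMoment μ k a b * tiltMoment μ 2 a b) / 2) b := by
  have h0 := (rawMoment_zero_pos hμ a b).ne'
  refine ((hasDerivAt_rawMoment_right hμ k a b).fun_div
    (hasDerivAt_rawMoment_right hμ 0 a b) h0).congr_deriv ?_
  simp only [tiltMoment]
  field_simp

lemma abs_sub_le_of_hasDerivAt {f f' : ℝ → ℝ} {C : ℝ} (hf : ∀ x, HasDerivAt f (f' x) x)
    (hC : ∀ x, |f' x| ≤ C) (x y : ℝ) : |f x - f y| ≤ C * |x - y| := by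
  simpa [Real.norm_eq_abs] using convex_univ.norm_image_sub_le_of_norm_hasDerivWithin_le
    (fun z _ => (hf z).hasDerivWithinAt) (fun z _ => hC z) (Set.mem_univ y) (Set.mem_univ x)

lemma abs_sub_mul_le_two {x y z : ℝ} (hx : |x| ≤ 1) (hy : |y| ≤ 1) (hz : |z| ≤ 1) :
    |x - y * z| ≤ 2 := by
  have := abs_sub x (y * z)
  have h := abs_mul y z
  have := mul_le_one₀ hy (abs_nonneg z) hz
  linarith

/-- Covariances of functions bounded by one are at most 2 in absolute value; the factor 1/2 in front
of `b` leaves the constant 1 there. The constants do not depend on `μ`, which is what makes the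
threshold for `β` universal. -/
lemma abs_tiltMoment_sub_le (hμ : UnitCarried μ) (k : ℕ) (a b a' b' : ℝ) :
    |tiltMoment μ k a b - tiltMoment μ k a' b'| ≤ 2 * |a - a'| + |b - b'| := by
  have h1 := abs_sub_le_of_hasDerivAt (C := 2) (fun s => hasDerivAt_tiltMoment_left hμ k s b)
    (fun s => abs_sub_mul_le_two (abs_tiltMoment_le_one hμ _ _ _) (abs_tiltMoment_le_one hμ _ _ _)
      (abs_tiltMoment_le_one hμ _ _ _)) a a'
  have h2 := abs_sub_le_of_hasDerivAt (C := 1) (fun s => hasDerivAt_tiltMoment_right hμ k a' s)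
    (fun s => by
      rw [abs_div, abs_two]
      have := abs_sub_mul_le_two (abs_tiltMoment_le_one hμ (k + 2) a' s)
        (abs_tiltMoment_le_one hμ k a' s) (abs_tiltMoment_le_one hμ 2 a' s)
      linarith) b b'
  have := abs_sub_le (tiltMoment μ k a b) (tiltMoment μ k a' b) (tiltMoment μ k a' b')
  linarith

lemma continuous_tiltMoment (hμ : UnitCarried μ) (k : ℕ) :
    Continuous fun s : ℝ × ℝ => tiltMoment μ k s.1 s.2 := by
  have : LipschitzWith 3 fun s : ℝ × ℝ => tiltMoment μ k s.1 s.2 := by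
    refine LipschitzWith.of_dist_le_mul fun s t => ?_
    have h := abs_tiltMoment_sub_le hμ k s.1 s.2 t.1 t.2
    rw [Real.dist_eq, Prod.dist_eq, Real.dist_eq, Real.dist_eq]
    have h1 := le_max_left |s.1 - t.1| |s.2 - t.2|
    have h2 := le_max_right |s.1 - t.1| |s.2 - t.2|
    push_cast
    linarith
  exact this.continuous

/-! ### The log-partition function and its derivatives -/

lemma exp_alpha (hμ : UnitCarried μ) (a b : ℝ) :
    Real.exp (alpha μ a b) = ∫ x, Real.exp (a * x + b / 2 * x ^ 2) ∂μ := by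
  have := rawMoment_zero_pos hμ a b
  simp only [rawMoment, pow_zero, one_mul] at this
  rw [alpha, Real.exp_log this]

lemma hasDerivAt_alpha (hμ : UnitCarried μ) (a b : ℝ) :
    HasDerivAt (fun s => alpha μ s b) (tiltMoment μ 1 a b) a := by
  have h := (hasDerivAt_rawMoment_left hμ 0 a b).log (rawMoment_zero_pos hμ a b).ne'
  simpa [rawMoment, alpha, tiltMoment] using h

lemma alpha'_eq (hμ : UnitCarried μ) : alpha' μ = tiltMoment μ 1 := by
  ext a b
  exact (hasDerivAt_alpha hμ a b).deriv

lemma alpha''_eq (hμ : UnitCarried μ) (a b : ℝ) :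
    alpha'' μ a b = tiltMoment μ 2 a b - tiltMoment μ 1 a b ^ 2 := by
  rw [alpha'', alpha'_eq hμ, (hasDerivAt_tiltMoment_left hμ 1 a b).deriv, sq]

lemma hasDerivAt_alpha' (hμ : UnitCarried μ) (a b : ℝ) :
    HasDerivAt (fun s => alpha' μ s b) (alpha'' μ a b) a := by
  rw [alpha''_eq hμ, alpha'_eq hμ, sq]
  exact hasDerivAt_tiltMoment_left hμ 1 a b

lemma abs_alpha'_le_one (hμ : UnitCarried μ) (a b : ℝ) : |alpha' μ a b| ≤ 1 := by
  rw [alpha'_eq hμ]; exact abs_tiltMoment_le_one hμ 1 a b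

lemma abs_alpha'_sub_le (hμ : UnitCarried μ) (a b a' b' : ℝ) :
    |alpha' μ a b - alpha' μ a' b'| ≤ 2 * |a - a'| + |b - b'| := by
  rw [alpha'_eq hμ]; exact abs_tiltMoment_sub_le hμ 1 a b a' b'

lemma continuous_alpha' (hμ : UnitCarried μ) : Continuous fun s : ℝ × ℝ => alpha' μ s.1 s.2 := by
  rw [alpha'_eq hμ]; exact continuous_tiltMoment hμ 1

lemma continuous_alpha'' (hμ : UnitCarried μ) :
    Continuous fun s : ℝ × ℝ => alpha'' μ s.1 s.2 := by
  simp_rw [alpha''_eq hμ]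
  exact (continuous_tiltMoment hμ 2).sub ((continuous_tiltMoment hμ 1).pow 2)

lemma abs_sq_sub_sq_le {x y D : ℝ} (hx : |x| ≤ 1) (hy : |y| ≤ 1) (h : |x - y| ≤ D) :
    |x ^ 2 - y ^ 2| ≤ 2 * D := by
  rw [sq_sub_sq, abs_mul]
  have h1 : |x + y| ≤ 2 := (abs_add_le x y).trans (by linarith)
  exact mul_le_mul h1 h (abs_nonneg _) two_pos.le

lemma abs_alpha''_sub_le (hμ : UnitCarried μ) (a b a' b' : ℝ) :
    |alpha'' μ a b - alpha'' μ a' b'| ≤ 6 * |a - a'| + 3 * |b - b'| := by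
  rw [alpha''_eq hμ, alpha''_eq hμ]
  have h2 := abs_tiltMoment_sub_le hμ 2 a b a' b'
  have h1 := abs_sq_sub_sq_le (abs_tiltMoment_le_one hμ 1 a b) (abs_tiltMoment_le_one hμ 1 a' b')
    (abs_tiltMoment_sub_le hμ 1 a b a' b')
  have := abs_sub (tiltMoment μ 2 a b - tiltMoment μ 2 a' b')
    (tiltMoment μ 1 a b ^ 2 - tiltMoment μ 1 a' b' ^ 2)
  rw [show tiltMoment μ 2 a b - tiltMoment μ 1 a b ^ 2 -
      (tiltMoment μ 2 a' b' - tiltMoment μ 1 a' b' ^ 2) =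
      tiltMoment μ 2 a b - tiltMoment μ 2 a' b' -
      (tiltMoment μ 1 a b ^ 2 - tiltMoment μ 1 a' b' ^ 2) by ring]
  linarith

lemma abs_alpha''_le_two (hμ : UnitCarried μ) (a b : ℝ) : |alpha'' μ a b| ≤ 2 := by
  rw [alpha''_eq hμ, sq]
  exact abs_sub_mul_le_two (abs_tiltMoment_le_one hμ 2 a b) (abs_tiltMoment_le_one hμ 1 a b)
    (abs_tiltMoment_le_one hμ 1 a b)

/-! ### Nondegeneracy of the tilted variance and strict convexity of `α` -/

/-- The tilted variance as an integral of squared deviations. -/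
lemma alpha''_mul_rawMoment (hμ : UnitCarried μ) (a b : ℝ) :
    alpha'' μ a b * rawMoment μ 0 a b =
      ∫ x, (x - tiltMoment μ 1 a b) ^ 2 * Real.exp (a * x + b / 2 * x ^ 2) ∂μ := by
  set c := tiltMoment μ 1 a b with hc
  have hexp : ∀ x : ℝ, (x - c) ^ 2 * Real.exp (a * x + b / 2 * x ^ 2) =
      x ^ 2 * Real.exp (a * x + b / 2 * x ^ 2) - (2 * c) * (x ^ 1 * Real.exp (a * x + b / 2 * x ^ 2))
        + c ^ 2 * (x ^ 0 * Real.exp (a * x + b / 2 * x ^ 2)) := fun x => by ring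
  simp_rw [hexp]
  have i0 := integrable_rawMoment hμ 0 a b
  have i1 := integrable_rawMoment hμ 1 a b
  have i2 := integrable_rawMoment hμ 2 a b
  rw [integral_add (f := fun x => x ^ 2 * Real.exp (a * x + b / 2 * x ^ 2) -
      (2 * c) * (x ^ 1 * Real.exp (a * x + b / 2 * x ^ 2))) (i2.sub (i1.const_mul _))
      (i0.const_mul _), integral_sub i2 (i1.const_mul _), integral_const_mul, integral_const_mul]
  change _ = rawMoment μ 2 a b - 2 * c * rawMoment μ 1 a b + c ^ 2 * rawMoment μ 0 a b
  have h0 := (rawMoment_zero_pos hμ a b).ne'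
  rw [alpha''_eq hμ, ← hc]
  have h1 : rawMoment μ 1 a b = c * rawMoment μ 0 a b := by
    rw [hc, tiltMoment]; field_simp
  have h2 : rawMoment μ 2 a b = tiltMoment μ 2 a b * rawMoment μ 0 a b := by
    rw [tiltMoment]; field_simp
  rw [h1, h2]; ring

lemma alpha''_nonneg (hμ : UnitCarried μ) (a b : ℝ) : 0 ≤ alpha'' μ a b := by
  have h := alpha''_mul_rawMoment hμ a b
  have h0 := rawMoment_zero_pos hμ a b
  have : 0 ≤ alpha'' μ a b * rawMoment μ 0 a b := by
    rw [h]; exact integral_nonneg fun x => by positivity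
  exact nonneg_of_mul_nonneg_left this h0

/-- A vanishing tilted variance would concentrate `μ` at the tilted mean, because the exponential
weight is positive. -/
lemma alpha''_pos (hμ : UnitCarried μ) (hc : ∀ c : ℝ, ¬ ∀ᵐ x ∂μ, x = c) (a b : ℝ) :
    0 < alpha'' μ a b := by
  refine lt_of_le_of_ne (alpha''_nonneg hμ a b) fun h0 => hc (tiltMoment μ 1 a b) ?_
  have h := alpha''_mul_rawMoment hμ a b
  rw [← h0, zero_mul] at h
  have := hμ.finite
  have hi : Integrable (fun x => (x - tiltMoment μ 1 a b) ^ 2 *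
      Real.exp (a * x + b / 2 * x ^ 2)) μ := by
    refine Integrable.of_bound (C := 4 * Real.exp (|a| + |b|)) (by fun_prop) ?_
    filter_upwards [hμ.ae_mem] with x hx
    rw [norm_mul, norm_pow, Real.norm_eq_abs, Real.norm_eq_abs, Real.abs_exp]
    have h1 : |x - tiltMoment μ 1 a b| ≤ 2 := (abs_sub _ _).trans (by
      have := abs_tiltMoment_le_one hμ 1 a b
      have := abs_le.2 hx
      linarith)
    have h2 : |x - tiltMoment μ 1 a b| ^ 2 ≤ 4 := by
      nlinarith [abs_nonneg (x - tiltMoment μ 1 a b)]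
    exact mul_le_mul h2 (Real.exp_le_exp.2 (abs_tilt_exponent_le hx)) (Real.exp_pos _).le
      (by norm_num)
  have h3 := (integral_eq_zero_iff_of_nonneg (fun x => by positivity) hi).1 h.symm
  filter_upwards [h3] with x hx
  have hx' : (x - tiltMoment μ 1 a b) ^ 2 * Real.exp (a * x + b / 2 * x ^ 2) = 0 := hx
  have := (mul_eq_zero.1 hx').resolve_right (Real.exp_pos _).ne'
  exact sub_eq_zero.1 (pow_eq_zero_iff two_ne_zero |>.1 this)

lemma exists_alpha''_lower_bound (hμ : UnitCarried μ) (hc : ∀ c : ℝ, ¬ ∀ᵐ x ∂μ, x = c) (R : ℝ) :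
    ∃ κ > 0, ∀ a b, |a| ≤ R → |b| ≤ R → κ ≤ alpha'' μ a b := by
  by_cases hR : 0 ≤ R
  · have hK : IsCompact (Set.Icc (-R) R ×ˢ Set.Icc (-R) R : Set (ℝ × ℝ)) :=
      isCompact_Icc.prod isCompact_Icc
    obtain ⟨s, -, hs⟩ := hK.exists_isMinOn ⟨(0, 0), by simp [hR]⟩
      (continuous_alpha'' hμ).continuousOn
    exact ⟨alpha'' μ s.1 s.2, alpha''_pos hμ hc _ _, fun a b ha hb =>
      hs (show (a, b) ∈ _ from ⟨abs_le.1 ha, abs_le.1 hb⟩)⟩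
  -- For negative `R` the condition `|a| ≤ R` is void, so any constant serves.
  · exact ⟨1, one_pos, fun a b ha _ => absurd ((abs_nonneg a).trans ha) hR⟩

lemma strictConvexOn_alpha (hμ : UnitCarried μ) (hc : ∀ c : ℝ, ¬ ∀ᵐ x ∂μ, x = c) (b : ℝ) :
    StrictConvexOn ℝ Set.univ fun s => alpha μ s b := by
  refine StrictMono.strictConvexOn_univ_of_deriv
    (continuous_iff_continuousAt.2 fun a => (hasDerivAt_alpha hμ a b).continuousAt) ?_
  exact strictMono_of_deriv_pos fun a => (alpha''_pos hμ hc a b : 0 < deriv (fun s => alpha' μ s b) a)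

/-- Second-order lower bound for `α` on a segment on which `α'' ≥ κ`. -/
lemma alpha_taylor_lower (hμ : UnitCarried μ) {κ b R : ℝ}
    (hκ : ∀ a, |a| ≤ R → κ ≤ alpha'' μ a b) {a a' : ℝ} (ha : |a| ≤ R) (ha' : |a'| ≤ R) :
    alpha' μ a b * (a' - a) + κ / 2 * (a' - a) ^ 2 ≤ alpha μ a' b - alpha μ a b := by
  have hd : ∀ s, HasDerivAt (fun s => alpha μ s b) (alpha' μ s b) s := fun s => by
    rw [alpha'_eq hμ]; exact hasDerivAt_alpha hμ s b
  -- Removing the parabola turns the bound on `α''` into convexity of `g` on `[-R, R]`; the claim is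
  -- the tangent line inequality for `g` at `a`.
  set g : ℝ → ℝ := fun s => alpha μ s b - κ / 2 * (s - a) ^ 2 with hg
  have hgd : ∀ s, HasDerivAt g (alpha' μ s b - κ * (s - a)) s := fun s => by
    refine ((hd s).fun_sub
      ((((hasDerivAt_id' s).sub_const a).fun_pow 2).const_mul (κ / 2))).congr_deriv ?_
    simp; ring
  have hgd' : ∀ s, HasDerivAt (fun s => alpha' μ s b - κ * (s - a)) (alpha'' μ s b - κ) s := fun s => by
    exact ((hasDerivAt_alpha' hμ s b).fun_sub
      (((hasDerivAt_id' s).sub_const a).const_mul κ)).congr_deriv (by simp)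
  have hder : deriv g = fun s => alpha' μ s b - κ * (s - a) := funext fun s => (hgd s).deriv
  have hconv : ConvexOn ℝ (Set.Icc (-R) R) g := by
    refine convexOn_of_deriv2_nonneg (convex_Icc _ _)
      (fun s _ => (hgd s).continuousAt.continuousWithinAt)
      (fun s _ => (hgd s).differentiableAt.differentiableWithinAt) ?_ fun s hs => ?_
    · rw [hder]; exact fun s _ => (hgd' s).differentiableAt.differentiableWithinAt
    · rw [interior_Icc] at hs
      have : deriv^[2] g s = alpha'' μ s b - κ := by
        simp only [Function.iterate_succ, Function.iterate_zero, Function.comp_apply, id, hder]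
        exact (hgd' s).deriv
      rw [this]
      exact sub_nonneg.2 (hκ s (abs_le.2 ⟨hs.1.le, hs.2.le⟩))
  have key : alpha' μ a b * (a' - a) ≤ g a' - g a := by
    have ham := abs_le.1 ha
    have ham' := abs_le.1 ha'
    have hda : HasDerivAt g (alpha' μ a b) a := by simpa using hgd a
    rcases lt_trichotomy a a' with h | h | h
    · have := hconv.le_slope_of_hasDerivAt ham ham' h hda
      rw [slope_def_field, le_div_iff₀ (sub_pos.2 h)] at this
      exact this
    · simp [h]
    · have := hconv.slope_le_of_hasDerivAt ham' ham h hda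
      rw [slope_def_field, div_le_iff₀ (sub_pos.2 h)] at this
      linarith
  simp only [hg, sub_self] at key
  nlinarith

end Interference

/-! ### A second moment bound for coordinatewise centred statistics -/

namespace Interference

lemma update_insertNth {n : ℕ} {S : Type*} (i : Fin (n + 1)) (s s' : S) (r : Fin n → S) :
    Function.update (i.insertNth (α := fun _ => S) s r) i s' =
      i.insertNth (α := fun _ => S) s' r := by
  ext j
  refine Fin.succAboveCases i ?_ (fun k => ?_) j
  · simp
  · simp [Fin.succAbove_ne]

/-- A function whose average over the `i`-th coordinate vanishes identically has integral zero. -/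
lemma integral_pi_eq_zero_of_update {S : Type*} [MeasurableSpace S] (ν : Measure S)
    [IsFiniteMeasure ν] {n : ℕ} (i : Fin n) {g : (Fin n → S) → ℝ}
    (hgi : Integrable g (Measure.pi fun _ : Fin n => ν))
    (h0 : ∀ y, ∫ s, g (Function.update y i s) ∂ν = 0) :
    ∫ y, g y ∂(Measure.pi fun _ : Fin n => ν) = 0 := by
  cases n with
  | zero => exact i.elim0
  | succ n =>
    have hp := measurePreserving_piFinSuccAbove (fun _ : Fin (n + 1) => ν) i
    set e := MeasurableEquiv.piFinSuccAbove (fun _ : Fin (n + 1) => S) i with he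
    have hs : MeasurePreserving e.symm (ν.prod (Measure.pi fun _ : Fin n => ν))
      (Measure.pi fun _ : Fin (n + 1) => ν) := hp.symm e
    have h1 : ∫ y, g y ∂(Measure.pi fun _ : Fin (n + 1) => ν) =
        ∫ z, g (e.symm z) ∂(ν.prod (Measure.pi fun _ : Fin n => ν)) :=
      (hs.integral_comp e.symm.measurableEmbedding g).symm
    have h2 : Integrable (fun z => g (e.symm z)) (ν.prod (Measure.pi fun _ : Fin n => ν)) :=
      (hs.integrable_comp_emb e.symm.measurableEmbedding).2 hgi
    rw [h1, integral_prod_symm _ h2]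
    have h3 : ∀ r : Fin n → S, ∫ s, g (e.symm (s, r)) ∂ν = 0 := fun r => by
      rcases isEmpty_or_nonempty S with hS | ⟨⟨s₀⟩⟩
      · have : (fun s => g (e.symm (s, r))) = fun _ => 0 := funext fun s => (hS.false s).elim
        simp [this]
      · rw [← h0 (i.insertNth (α := fun _ => S) s₀ r)]
        refine integral_congr_ae (.of_forall fun s => ?_)
        simp only [update_insertNth]
        rfl
    simp [h3]

/-- Let `F i` be bounded statistics, the `i`-th one centred in its `i`-th coordinate with respect to
the weight `w`. The weighted second moment of the sum is controlled by the influence of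
single coordinates on it. -/
lemma integral_sum_sq_mul_le {S : Type*} [MeasurableSpace S] (ν : Measure S) [IsFiniteMeasure ν]
    {n : ℕ} {w : (Fin n → S) → ℝ} (hw : ∀ y, 0 ≤ w y)
    (hwi : Integrable w (Measure.pi fun _ : Fin n => ν))
    {F : Fin n → (Fin n → S) → ℝ} (hFm : ∀ i, Measurable (F i)) (hF : ∀ i y, |F i y| ≤ 2)
    (hcent : ∀ i y, ∫ s, F i (Function.update y i s) * w (Function.update y i s) ∂ν = 0)
    (s₀ : S) {B : Fin n → ℝ}
    (hB : ∀ i y, |∑ j, F j y - ∑ j, F j (Function.update y i s₀)| ≤ B i) :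
    ∫ y, (∑ i, F i y) ^ 2 * w y ∂(Measure.pi fun _ : Fin n => ν) ≤
      2 * (∑ i, B i) * ∫ y, w y ∂(Measure.pi fun _ : Fin n => ν) := by
  set π := Measure.pi fun _ : Fin n => ν
  set D : (Fin n → S) → ℝ := fun y => ∑ j, F j y with hD
  have hDm : Measurable D := Finset.measurable_sum _ fun i _ => hFm i
  have hDb : ∀ y, |D y| ≤ 2 * n := fun y => by
    refine (Finset.abs_sum_le_sum_abs _ _).trans ((Finset.sum_le_sum fun i _ => hF i y).trans ?_)
    simp [mul_comm]
  have hup : ∀ i, Measurable fun y : Fin n → S => Function.update y i s₀ :=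
    fun i => measurable_update_left
  have hint : ∀ (G : (Fin n → S) → ℝ) (C : ℝ), Measurable G → (∀ y, |G y| ≤ C) →
      Integrable (fun y => G y * w y) π := fun G C hG hC =>
    hwi.bdd_mul (c := C) hG.aestronglyMeasurable (.of_forall fun y => by simpa using hC y)
  have hFDb : ∀ i y, |F i y * D y| ≤ 2 * (2 * n) := fun i y => by
    rw [abs_mul]; exact mul_le_mul (hF i y) (hDb y) (abs_nonneg _) two_pos.le
  have hFDb' : ∀ i y, |F i y * D (Function.update y i s₀)| ≤ 2 * (2 * n) := fun i y => by
    rw [abs_mul]; exact mul_le_mul (hF i y) (hDb _) (abs_nonneg _) two_pos.le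
  have hI1 : ∀ i, Integrable (fun y => F i y * D y * w y) π := fun i =>
    hint _ _ ((hFm i).mul hDm) (hFDb i)
  have hI2 : ∀ i, Integrable (fun y => F i y * D (Function.update y i s₀) * w y) π := fun i =>
    hint _ _ ((hFm i).mul (hDm.comp (hup i))) (hFDb' i)
  -- Once coordinate `i` is frozen at `s₀`, the factor `D` no longer depends on it, and the centring
  -- of `F i` annihilates the integral. Subtracting this zero replaces `D` by its change under one
  -- coordinate, of size `B i`; without it only a bound of order `n²` would result.
  have hzero : ∀ i, ∫ y, F i y * D (Function.update y i s₀) * w y ∂π = 0 := fun i => by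
    refine integral_pi_eq_zero_of_update ν i (hI2 i) fun y => ?_
    simp only [Function.update_idem]
    rw [← mul_zero (D (Function.update y i s₀)), ← hcent i y, ← integral_const_mul]
    exact integral_congr_ae (.of_forall fun s => by ring)
  have hterm : ∀ i, ∫ y, F i y * D y * w y ∂π ≤ 2 * B i * ∫ y, w y ∂π := fun i => by
    rw [← sub_zero (∫ y, F i y * D y * w y ∂π), ← hzero i, ← integral_sub (hI1 i) (hI2 i),
      ← integral_const_mul]
    refine integral_mono ((hI1 i).sub (hI2 i)) (hwi.const_mul _) fun y => ?_
    have h1 : F i y * (D y - D (Function.update y i s₀)) ≤ 2 * B i := by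
      refine (le_abs_self _).trans ?_
      rw [abs_mul]
      exact mul_le_mul (hF i y) (hB i y) (abs_nonneg _) two_pos.le
    calc F i y * D y * w y - F i y * D (Function.update y i s₀) * w y
        = F i y * (D y - D (Function.update y i s₀)) * w y := by ring
      _ ≤ _ := mul_le_mul_of_nonneg_right h1 (hw y)
  calc ∫ y, (∑ i, F i y) ^ 2 * w y ∂π = ∫ y, ∑ i, F i y * D y * w y ∂π := by
        refine integral_congr_ae (.of_forall fun y => ?_)
        simp only [hD, sq, Finset.sum_mul]
    _ = ∑ i, ∫ y, F i y * D y * w y ∂π := integral_finsetSum _ fun i _ => hI1 i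
    _ ≤ ∑ i, 2 * B i * ∫ y, w y ∂π := Finset.sum_le_sum fun i _ => hterm i
    _ = _ := by rw [← Finset.sum_mul, Finset.mul_sum]

/-! ### Gibbs weights -/

/-- The local field `∑_{j ≠ i} A i j v j + h i` felt by coordinate `i`. -/
noncomputable def localField {n : ℕ} (A : Matrix (Fin n) (Fin n) ℝ) (h v : Fin n → ℝ) (i : Fin n) : ℝ :=
  ∑ j, A i j * Function.update v i 0 j + h i

/-- The Gibbs weight `exp (vᵀ A v / 2 + vᵀ h)`. -/
noncomputable def gibbsWeight {n : ℕ} (A : Matrix (Fin n) (Fin n) ℝ) (h v : Fin n → ℝ) : ℝ :=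
  Real.exp (1 / 2 * (v ⬝ᵥ A *ᵥ v) + v ⬝ᵥ h)

lemma localField_update {n : ℕ} (A : Matrix (Fin n) (Fin n) ℝ) (h v : Fin n → ℝ) (i : Fin n)
    (s : ℝ) : localField A h (Function.update v i s) i = localField A h v i := by
  simp [localField]

/-- The Gibbs weight as a function of a single coordinate. -/
lemma gibbsWeight_update {n : ℕ} {A : Matrix (Fin n) (Fin n) ℝ} (hA : A.IsSymm) (h v : Fin n → ℝ)
    (i : Fin n) (s : ℝ) :
    gibbsWeight A h (Function.update v i s) =
      Real.exp (localField A h v i * s + A i i / 2 * s ^ 2) *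
        gibbsWeight A h (Function.update v i 0) := by
  set u := Function.update v i 0 with hu
  -- In the expansion of the quadratic form the two cross terms agree by symmetry of `A`, which
  -- cancels the factor 1/2.
  have hv : Function.update v i s = u + Pi.single i s := by
    ext j
    by_cases hj : j = i
    · subst hj; simp [hu]
    · simp [hu, hj]
  rw [gibbsWeight, gibbsWeight, ← Real.exp_add, hv]
  congr 1
  have h1 : Pi.single i s ⬝ᵥ A *ᵥ u = s * (A *ᵥ u) i := by simp
  have h2 : u ⬝ᵥ A *ᵥ Pi.single i s = s * (A *ᵥ u) i := by
    rw [Matrix.dotProduct_mulVec, ← Matrix.mulVec_transpose, hA.eq]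
    simp [mul_comm]
  have h3 : Pi.single i s ⬝ᵥ A *ᵥ Pi.single i s = s ^ 2 * A i i := by
    simp [sq]; ring
  have h4 : localField A h v i = (A *ᵥ u) i + h i := rfl
  rw [Matrix.mulVec_add, dotProduct_add, add_dotProduct, add_dotProduct, add_dotProduct, h1, h2, h3,
    h4]
  simp only [single_dotProduct]
  ring

lemma abs_localField_sub_le {n : ℕ} (A : Matrix (Fin n) (Fin n) ℝ) (h v : Fin n → ℝ)
    (i j : Fin n) (s : ℝ) (hij : j ≠ i) :
    |localField A h v j - localField A h (Function.update v i s) j| ≤ |A j i| * |v i - s| := by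
  have : localField A h v j - localField A h (Function.update v i s) j = A j i * (v i - s) := by
    simp only [localField, add_sub_add_right_eq_sub, ← Finset.sum_sub_distrib, ← mul_sub]
    rw [Finset.sum_eq_single i]
    · simp [hij.symm]
    · intro k _ hk
      by_cases hkj : k = j
      · subst hkj; simp
      · simp [hk, hkj]
    · simp
  rw [this, abs_mul]

/-- The conditional mean of coordinate `i` in a Gibbs measure over the base measure `ν`. -/
noncomputable def condMean {n : ℕ} (ν : Measure ℝ) (A : Matrix (Fin n) (Fin n) ℝ)
    (h v : Fin n → ℝ) (i : Fin n) : ℝ :=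
  alpha' ν (localField A h v i) (A i i)

/-- The tilted mean centres the coordinate under its conditional law. This supplies the centring
hypothesis of `integral_sum_sq_mul_le` for Gibbs weights. -/
lemma integral_sub_alpha'_mul_exp {ρ : Measure ℝ} (hρ : UnitCarried ρ) (a b : ℝ) :
    ∫ x, (x - alpha' ρ a b) * Real.exp (a * x + b / 2 * x ^ 2) ∂ρ = 0 := by
  have hpt : ∀ x : ℝ, (x - alpha' ρ a b) * Real.exp (a * x + b / 2 * x ^ 2) =
      x ^ 1 * Real.exp (a * x + b / 2 * x ^ 2) -
        alpha' ρ a b * (x ^ 0 * Real.exp (a * x + b / 2 * x ^ 2)) := fun x => by ring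
  simp_rw [hpt]
  rw [integral_sub (integrable_rawMoment hρ 1 _ _) ((integrable_rawMoment hρ 0 _ _).const_mul _),
    integral_const_mul, alpha'_eq hρ]
  change rawMoment _ 1 _ _ - tiltMoment _ 1 _ _ * rawMoment _ 0 _ _ = 0
  rw [tiltMoment, div_mul_cancel₀ _ (rawMoment_zero_pos hρ _ _).ne', sub_self]

lemma comp_update_eq {S : Type*} {n : ℕ} (φ : S → ℝ) (t : Fin n → S) (i : Fin n) (s : S) :
    (fun k => φ (Function.update t i s k)) = Function.update (fun k => φ (t k)) i (φ s) :=
  Function.comp_update φ t i s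

/-! ### Gibbs measures over an abstract single-site space read through a bounded map, covering spins
and outcomes alike -/

section Gibbs

variable {S : Type*} [MeasurableSpace S] {ν : Measure S} [IsFiniteMeasure ν] {φ : S → ℝ}

lemma measurable_localField {n : ℕ} (A : Matrix (Fin n) (Fin n) ℝ) (h : Fin n → ℝ) (i : Fin n) :
    Measurable fun v => localField A h v i := by
  unfold localField
  refine (Finset.measurable_sum _ fun j _ => Measurable.const_mul ?_ _).add_const _
  exact (measurable_pi_apply j).comp measurable_update_left

lemma measurable_condMean {ρ : Measure ℝ} (hρ : UnitCarried ρ) {n : ℕ}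
    (A : Matrix (Fin n) (Fin n) ℝ) (h : Fin n → ℝ) (i : Fin n) :
    Measurable fun v => condMean ρ A h v i :=
  (continuous_alpha' hρ).measurable.comp
    ((measurable_localField A h i).prodMk measurable_const)

lemma measurable_gibbsWeight {n : ℕ} (A : Matrix (Fin n) (Fin n) ℝ) (h : Fin n → ℝ) :
    Measurable (gibbsWeight A h) := by
  unfold gibbsWeight dotProduct mulVec dotProduct
  fun_prop

lemma integrable_gibbsWeight (hφm : Measurable φ) (hφ : ∀ s, |φ s| ≤ 1) {n : ℕ}
    (A : Matrix (Fin n) (Fin n) ℝ) (h : Fin n → ℝ) :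
    Integrable (fun t : Fin n → S => gibbsWeight A h fun i => φ (t i))
      (Measure.pi fun _ => ν) := by
  refine Integrable.of_bound
    (C := Real.exp (1 / 2 * ∑ i, ∑ j, |A i j| + ∑ i, |h i|)) ?_ (.of_forall fun t => ?_)
  · exact ((measurable_gibbsWeight A h).comp
      (measurable_pi_lambda _ fun i => hφm.comp (measurable_pi_apply i))).aestronglyMeasurable
  · rw [gibbsWeight, Real.norm_eq_abs, Real.abs_exp]
    refine Real.exp_le_exp.2 (add_le_add (mul_le_mul_of_nonneg_left ?_ (by norm_num)) ?_)
    · simp only [dotProduct, mulVec, Finset.mul_sum]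
      refine Finset.sum_le_sum fun i _ => Finset.sum_le_sum fun j _ => (le_abs_self _).trans ?_
      rw [abs_mul, abs_mul]
      have h1 := hφ (t i)
      have h2 := hφ (t j)
      calc |φ (t i)| * (|A i j| * |φ (t j)|) ≤ 1 * (|A i j| * 1) := by gcongr
        _ = _ := by ring
    · simp only [dotProduct]
      refine Finset.sum_le_sum fun i _ => (le_abs_self _).trans ?_
      rw [abs_mul]
      exact mul_le_of_le_one_left (abs_nonneg _) (hφ _)

/-- Second moment bound for the centred coordinates of a Gibbs measure. -/
lemma integral_gibbs_sq_le (hφm : Measurable φ) (hφ : ∀ s, |φ s| ≤ 1) (s₀ : S) (hν : ν ≠ 0) {n : ℕ}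
    {A : Matrix (Fin n) (Fin n) ℝ} (hA : A.IsSymm) (h : Fin n → ℝ) {c : Fin n → ℝ}
    (hc : ∀ i, |c i| ≤ 1) :
    ∫ t, (∑ i, c i * (φ (t i) - condMean (ν.map φ) A h (fun k => φ (t k)) i)) ^ 2 *
        gibbsWeight A h (fun k => φ (t k)) ∂(Measure.pi fun _ : Fin n => ν) ≤
      (4 * n + 8 * ∑ i, ∑ j, |A i j|) *
        ∫ t, gibbsWeight A h (fun k => φ (t k)) ∂(Measure.pi fun _ : Fin n => ν) := by
  have hρ : UnitCarried (ν.map φ) := by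
    refine ⟨inferInstance, (Measure.map_ne_zero_iff hφm.aemeasurable).2 hν, ?_⟩
    refine (ae_map_iff hφm.aemeasurable measurableSet_Icc).2 ?_
    exact .of_forall fun s => abs_le.1 (hφ s)
  have hvm : Measurable fun (t : Fin n → S) k => φ (t k) :=
    measurable_pi_lambda _ fun i => hφm.comp (measurable_pi_apply i)
  -- Changing coordinate `i` moves its own term by at most 2, because the conditional mean of `i`
  -- does not see coordinate `i`. The term of `j ≠ i` changes only through its local field, by `|A j
  -- i|` times at most 2, and `α'` is 2-Lipschitz.
  have hB : ∀ i (t : Fin n → S),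
      |∑ j, c j * (φ (t j) - condMean (ν.map φ) A h (fun k => φ (t k)) j) -
        ∑ j, c j * (φ (Function.update t i s₀ j) -
          condMean (ν.map φ) A h (fun k => φ (Function.update t i s₀ k)) j)| ≤
      2 + 4 * ∑ j, |A j i| := fun i t => by
    rw [← Finset.sum_sub_distrib, comp_update_eq]
    have hterm : ∀ j, |c j * (φ (t j) - condMean (ν.map φ) A h (fun k => φ (t k)) j) -
        c j * (φ (Function.update t i s₀ j) -
          condMean (ν.map φ) A h (Function.update (fun k => φ (t k)) i (φ s₀)) j)| ≤
        (if j = i then 2 else 0) + 4 * |A j i| := fun j => by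
      rw [← mul_sub, abs_mul]
      refine (mul_le_of_le_one_left (abs_nonneg _) (hc j)).trans ?_
      by_cases hj : j = i
      · subst hj
        have h1 : |φ (t j) - φ s₀| ≤ 2 := (abs_sub _ _).trans (by linarith [hφ (t j), hφ s₀])
        have h2 := abs_nonneg (A j j)
        simp only [condMean, localField_update, Function.update_self, if_true,
          sub_sub_sub_cancel_right]
        linarith
      · simp only [Function.update_of_ne hj, hj, if_false, sub_sub_sub_cancel_left, zero_add]
        rw [abs_sub_comm]
        refine (abs_alpha'_sub_le hρ _ _ _ _).trans ?_
        rw [sub_self, abs_zero, add_zero]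
        have h1 := abs_localField_sub_le A h (fun k => φ (t k)) i j (φ s₀) hj
        have h2 : |φ (t i) - φ s₀| ≤ 2 := (abs_sub _ _).trans (by linarith [hφ (t i), hφ s₀])
        have h3 := mul_le_mul_of_nonneg_left h2 (abs_nonneg (A j i))
        linarith
    refine (Finset.abs_sum_le_sum_abs _ _).trans ((Finset.sum_le_sum fun j _ => hterm j).trans ?_)
    rw [Finset.sum_add_distrib, ← Finset.mul_sum]
    simp
  have := integral_sum_sq_mul_le ν (w := fun t => gibbsWeight A h fun k => φ (t k))
    (F := fun i t => c i * (φ (t i) - condMean (ν.map φ) A h (fun k => φ (t k)) i))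
    (fun t => (Real.exp_pos _).le) (integrable_gibbsWeight hφm hφ A h)
    (fun i => ((hφm.comp (measurable_pi_apply i)).sub
      ((measurable_condMean hρ A h i).comp hvm)).const_mul _)
    (fun i t => by
      rw [abs_mul]
      refine (mul_le_of_le_one_left (abs_nonneg _) (hc i)).trans ((abs_sub _ _).trans ?_)
      have := abs_alpha'_le_one hρ (localField A h (fun k => φ (t k)) i) (A i i)
      have := hφ (t i)
      rw [condMean]
      linarith)
    (fun i t => by
      simp only [comp_update_eq, condMean, localField_update, Function.update_self]
      set a := localField A h (fun k => φ (t k)) i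
      set w₀ := gibbsWeight A h (Function.update (fun k => φ (t k)) i 0) with hw₀
      -- As a function of coordinate `i` alone, the Gibbs weight is a constant times an exponential
      -- tilt with the parameters that define `condMean`.
      have h0 := integral_sub_alpha'_mul_exp hρ a (A i i)
      rw [integral_map hφm.aemeasurable (by fun_prop)] at h0
      rw [← mul_zero (c i * w₀), ← h0, ← integral_const_mul]
      refine integral_congr_ae (.of_forall fun s => ?_)
      change c i * (φ s - alpha' (ν.map φ) a (A i i)) *
        gibbsWeight A h (Function.update (fun k => φ (t k)) i (φ s)) = _
      rw [gibbsWeight_update hA]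
      ring)
    s₀ hB
  refine this.trans_eq ?_
  rw [Finset.sum_add_distrib, ← Finset.mul_sum, Finset.sum_comm]
  simp
  ring_nf
  exact Or.inl trivial

end Gibbs

end Interference

/-! ### Operator norm bounds -/

namespace Interference

lemma sum_mulVec_sq_le {n : ℕ} {A : Matrix (Fin n) (Fin n) ℝ} {K : ℝ} (hA : opNorm A ≤ K)
    (v : Fin n → ℝ) : ∑ i, (A *ᵥ v) i ^ 2 ≤ K ^ 2 * ∑ i, v i ^ 2 := by
  have h := (Matrix.toEuclideanCLM (n := Fin n) (𝕜 := ℝ) A).le_of_opNorm_le hA (WithLp.toLp 2 v)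
  have h2 := pow_le_pow_left₀ (norm_nonneg _) h 2
  rw [mul_pow, EuclideanSpace.norm_sq_eq, EuclideanSpace.norm_sq_eq] at h2
  simpa [Real.norm_eq_abs, sq_abs] using h2

lemma opNorm_nonneg {n : ℕ} (A : Matrix (Fin n) (Fin n) ℝ) : 0 ≤ opNorm A := norm_nonneg _

lemma sum_col_sq_le {n : ℕ} {A : Matrix (Fin n) (Fin n) ℝ} {K : ℝ} (hA : opNorm A ≤ K)
    (j : Fin n) : ∑ i, A i j ^ 2 ≤ K ^ 2 := by
  have h := sum_mulVec_sq_le hA (Pi.single j 1)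
  simpa [Pi.single_apply] using h

lemma abs_entry_le {n : ℕ} {A : Matrix (Fin n) (Fin n) ℝ} {K : ℝ} (hA : opNorm A ≤ K)
    (i j : Fin n) : |A i j| ≤ K := by
  refine abs_le_of_sq_le_sq ?_ ((opNorm_nonneg A).trans hA)
  exact (Finset.single_le_sum (f := fun i => A i j ^ 2) (fun i _ => sq_nonneg _)
    (Finset.mem_univ i)).trans (sum_col_sq_le hA j)

/-- Cauchy–Schwarz in each column. The resulting order `n ^ (3/2)` is `o(n²)`, which suffices to
make sums of centred coordinates `o(n)` in probability. -/
lemma sum_abs_entry_le {n : ℕ} {A : Matrix (Fin n) (Fin n) ℝ} {K : ℝ} (hA : opNorm A ≤ K) :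
    ∑ i, ∑ j, |A i j| ≤ n * (√n * K) := by
  have hK := (opNorm_nonneg A).trans hA
  rw [Finset.sum_comm]
  have hcol : ∀ j, ∑ i, |A i j| ≤ √n * K := fun j => by
    refine (pow_le_pow_iff_left₀ (by positivity) (by positivity) two_ne_zero).1 ?_
    calc (∑ i, |A i j|) ^ 2 ≤ n * ∑ i, |A i j| ^ 2 := by
          simpa using sq_sum_le_card_mul_sum_sq (s := Finset.univ) (f := fun i => |A i j|)
      _ ≤ n * K ^ 2 := by
          simp only [sq_abs]
          exact mul_le_mul_of_nonneg_left (sum_col_sq_le hA j) (Nat.cast_nonneg n)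
      _ = (√n * K) ^ 2 := by rw [mul_pow, Real.sq_sqrt (Nat.cast_nonneg n)]
  refine (Finset.sum_le_sum fun j _ => hcol j).trans ?_
  simp

lemma localField_eq {n : ℕ} (A : Matrix (Fin n) (Fin n) ℝ) (h v : Fin n → ℝ) (i : Fin n) :
    localField A h v i = (A *ᵥ v) i - A i i * v i + h i := by
  have : ∀ j, A i j * Function.update v i 0 j =
      A i j * v j - (if j = i then A i i * v i else 0) := fun j => by
    by_cases hj : j = i
    · subst hj; simp
    · simp [hj]
  simp only [localField, this, Finset.sum_sub_distrib]
  simp [mulVec, dotProduct]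

/-- All but a fraction `s⁻²` of the local fields are bounded in terms of `s`. -/
lemma card_large_localField_le {n : ℕ} {A : Matrix (Fin n) (Fin n) ℝ} {K H s : ℝ}
    (hA : opNorm A ≤ K) {h v : Fin n → ℝ} (hv : ∀ i, |v i| ≤ 1) (hh : ∀ i, |h i| ≤ H)
    (hs : 0 < s) (hK : 0 < K) :
    ((Finset.univ.filter fun i => ¬ |localField A h v i| ≤ K * s + K + H).card : ℝ) ≤ n / s ^ 2 := by
  set T := Finset.univ.filter fun i => ¬ |localField A h v i| ≤ K * s + K + H
  -- The diagonal term and the external field contribute at most `K + H`, so an exceptional unit has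
  -- `|(A v) i| ≥ K s`. Since `‖A v‖² ≤ K² n`, there are at most `n / s²` of them.
  have hbad : ∀ i ∈ T, K ^ 2 * s ^ 2 ≤ (A *ᵥ v) i ^ 2 := by
    intro i hi
    have hi' := not_le.1 (Finset.mem_filter.1 hi).2
    rw [localField_eq] at hi'
    have h1 := abs_add_le ((A *ᵥ v) i - A i i * v i) (h i)
    have h2 := abs_sub ((A *ᵥ v) i) (A i i * v i)
    have h3 : |A i i * v i| ≤ K := by
      rw [abs_mul]
      exact (mul_le_mul (abs_entry_le hA i i) (hv i) (abs_nonneg _) hK.le).trans_eq (mul_one K)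
    have h4 : K * s ≤ |(A *ᵥ v) i| := by linarith [hh i]
    rw [← mul_pow, ← sq_abs ((A *ᵥ v) i)]
    exact pow_le_pow_left₀ (by positivity) h4 2
  have h1 : T.card * (K ^ 2 * s ^ 2) ≤ K ^ 2 * n := by
    calc (T.card : ℝ) * (K ^ 2 * s ^ 2) = ∑ _i ∈ T, K ^ 2 * s ^ 2 := by simp
      _ ≤ ∑ i ∈ T, (A *ᵥ v) i ^ 2 := Finset.sum_le_sum hbad
      _ ≤ ∑ i, (A *ᵥ v) i ^ 2 :=
          Finset.sum_le_sum_of_subset_of_nonneg (Finset.subset_univ _) fun i _ _ => sq_nonneg _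
      _ ≤ K ^ 2 * ∑ i, v i ^ 2 := sum_mulVec_sq_le hA v
      _ ≤ K ^ 2 * ∑ _i : Fin n, 1 := by
          gcongr with i
          rw [← sq_abs]
          exact pow_le_one₀ (abs_nonneg _) (hv i)
      _ = K ^ 2 * n := by simp
  rw [le_div_iff₀ (by positivity)]
  have hK2 : 0 < K ^ 2 := by positivity
  refine le_of_mul_le_mul_left ?_ hK2
  linarith

/-! ### The design matrix -/

/-- The law of a spin under the counting measure. -/
noncomputable def spinMeasure : Measure ℝ := (Measure.count : Measure Bool).map spin

lemma abs_spin (b : Bool) : |spin b| = 1 := by cases b <;> simp [spin]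

lemma spin_sq (b : Bool) : spin b ^ 2 = 1 := by cases b <;> simp [spin]

lemma measurable_spin : Measurable spin := measurable_of_finite _

lemma unitCarried_spinMeasure : UnitCarried spinMeasure := by
  refine ⟨by unfold spinMeasure; infer_instance, ?_, ?_⟩
  · exact (Measure.map_ne_zero_iff measurable_spin.aemeasurable).2 (NeZero.ne _)
  · refine (ae_map_iff measurable_spin.aemeasurable measurableSet_Icc).2 (.of_forall fun b => ?_)
    exact abs_le.1 (abs_spin b).le

lemma spinMeasure_not_const (c : ℝ) : ¬ ∀ᵐ x ∂spinMeasure, x = c := by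
  intro h
  have h1 := (ae_map_iff (p := fun x => x = c) measurable_spin.aemeasurable
    (measurableSet_singleton c)).1 h
  have h2 : ∀ b, spin b = c := by simpa using h1
  have h3 := (h2 true).trans (h2 false).symm
  norm_num [spin] at h3

/-- Spins have square one, so their second tilted moment is one. This identifies `1 - ψ²` in the
design bound with a conditional variance of a treatment. -/
lemma alpha''_spinMeasure (a b : ℝ) :
    alpha'' spinMeasure a b = 1 - alpha' spinMeasure a b ^ 2 := by
  rw [alpha''_eq unitCarried_spinMeasure, alpha'_eq unitCarried_spinMeasure, tiltMoment]
  congr 1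
  rw [div_eq_one_iff_eq (rawMoment_zero_pos unitCarried_spinMeasure a b).ne']
  refine integral_congr_ae ?_
  refine (ae_map_iff measurable_spin.aemeasurable
    (measurableSet_eq_fun (by fun_prop) (by fun_prop))).2 (.of_forall fun t => ?_)
  simp [spin_sq]

lemma abs_dotProduct_le {d : ℕ} {x : Fin d → ℝ} (hx : ∀ k, |x k| ≤ 1) (θ : Fin d → ℝ) :
    |x ⬝ᵥ θ| ≤ d * ‖θ‖ := by
  refine (Finset.abs_sum_le_sum_abs _ _).trans ?_
  calc ∑ k, |x k * θ k| ≤ ∑ _k : Fin d, ‖θ‖ := Finset.sum_le_sum fun k _ => by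
        rw [abs_mul]
        exact (mul_le_of_le_one_left (abs_nonneg _) (hx k)).trans (norm_le_pi_norm θ k)
    _ = _ := by simp

lemma abs_field_le {n d : ℕ} (p : Param d) (t : Treatments n) {x : Covariates n d}
    (hx : ∀ i k, |x i k| ≤ 1) (i : Fin n) : |field p t x i| ≤ (1 + d) * ‖p‖ := by
  have h1 := abs_add_le (p.1 * spin (t i)) (x i ⬝ᵥ p.2)
  rw [abs_mul, abs_spin, mul_one] at h1
  have h2 := abs_dotProduct_le (hx i) p.2
  have h3 : |p.1| ≤ ‖p‖ := norm_fst_le p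
  have h4 := mul_le_mul_of_nonneg_left (norm_snd_le p) (Nat.cast_nonneg (α := ℝ) d)
  rw [field]
  linarith

lemma field_sub {n d : ℕ} (p q : Param d) (t : Treatments n) (x : Covariates n d) (i : Fin n) :
    field (p - q) t x i = field p t x i - field q t x i := by
  simp only [field, Prod.fst_sub, Prod.snd_sub, dotProduct_sub]
  ring

/-- Approximate centredness of the treatments and a law of large numbers for the covariates, up to
an error `η`. -/
structure DesignRegular {n d : ℕ} (W : Matrix (Fin n) (Fin n) ℝ) (γ : Fin d → ℝ)
    (S : Fin d → Fin d → ℝ) (η : ℝ) (x : Covariates n d) (t : Treatments n) : Prop where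
  treatment : ∀ k, |∑ i, x i k * (spin (t i) -
    condMean spinMeasure W (fun i => x i ⬝ᵥ γ) (fun i => spin (t i)) i)| ≤ η * n
  covariate : ∀ k l, |∑ i, (x i k * x i l - S k l)| ≤ η * n

lemma abs_sum_mul_le {d : ℕ} {c R : Fin d → ℝ} {B : ℝ} (hR : ∀ k, |R k| ≤ B) :
    |∑ k, c k * R k| ≤ d * ‖c‖ * B := by
  refine (Finset.abs_sum_le_sum_abs _ _).trans ?_
  calc ∑ k, |c k * R k| ≤ ∑ _k : Fin d, ‖c‖ * B := Finset.sum_le_sum fun k _ => by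
        rw [abs_mul]
        exact mul_le_mul (norm_le_pi_norm c k) (hR k) (abs_nonneg _) (norm_nonneg _)
    _ = _ := by simp; ring

/-- Uniform positive definiteness of the design. -/
lemma exists_design_lower_bound {d : ℕ} (γ : Fin d → ℝ) {S : Fin d → Fin d → ℝ} {lam K : ℝ}
    (hlam : 0 < lam) (hS : ∀ θ : Fin d → ℝ, lam * ‖θ‖ ^ 2 ≤ ∑ k, ∑ l, θ k * θ l * S k l)
    (hK : 0 < K) :
    ∃ c > 0, ∃ η > 0, ∀ (n : ℕ) (W : Matrix (Fin n) (Fin n) ℝ) (x : Covariates n d)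
      (t : Treatments n), opNorm W ≤ K → (∀ i k, |x i k| ≤ 1) → DesignRegular W γ S η x t →
      ∀ p : Param d, c * n * ‖p‖ ^ 2 ≤ ∑ i, field p t x i ^ 2 := by
  -- The radius is the threshold of `card_large_localField_le` at `s = 2`, with field bound `d ‖γ‖`.
  obtain ⟨κ, hκ, hκb⟩ := exists_alpha''_lower_bound unitCarried_spinMeasure spinMeasure_not_const
    (K * 2 + K + d * ‖γ‖)
  -- The three conditions keep half of `lam` in the covariate form and let the cross term `2 a b d
  -- η` be absorbed into the `a²` and `b²` terms of the final combination.
  obtain ⟨η, hη, h1, h2, h3⟩ : ∃ η > 0, d ^ 2 * η ≤ lam / 2 ∧ d * η ≤ κ / 8 ∧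
      d * η ≤ κ * lam / 32 := by
    refine ⟨min (lam / 2) (min (κ / 8) (κ * lam / 32)) / (d ^ 2 + d + 1), by positivity, ?_⟩
    set m := min (lam / 2) (min (κ / 8) (κ * lam / 32)) with hm
    have hm0 : 0 ≤ m := by positivity
    have hd : (0 : ℝ) ≤ d := Nat.cast_nonneg d
    have e1 : (d : ℝ) ^ 2 * (m / (d ^ 2 + d + 1)) ≤ m := by
      rw [← mul_div_assoc, div_le_iff₀ (by positivity)]; nlinarith
    have e2 : (d : ℝ) * (m / (d ^ 2 + d + 1)) ≤ m := by
      rw [← mul_div_assoc, div_le_iff₀ (by positivity)]; nlinarith [sq_nonneg (d : ℝ)]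
    exact ⟨e1.trans (min_le_left _ _), e2.trans ((min_le_right _ _).trans (min_le_left _ _)),
      e2.trans ((min_le_right _ _).trans (min_le_right _ _))⟩
  refine ⟨min (κ / 8) (κ * lam / 32) / (1 + κ), by positivity, η, hη,
    fun n W x t hW hx hreg p => ?_⟩
  set a := |p.1| with ha
  set b := ‖p.2‖ with hb
  set ψ : Fin n → ℝ := fun i =>
    condMean spinMeasure W (fun i => x i ⬝ᵥ γ) (fun i => spin (t i)) i with hψ
  have hn : (0 : ℝ) ≤ n := Nat.cast_nonneg n
  have hd : (0 : ℝ) ≤ d := Nat.cast_nonneg d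
  have hb0 : 0 ≤ b := norm_nonneg _
  have ha0 : 0 ≤ a := abs_nonneg _
  -- the conditional variances
  have hvar : κ / 2 * n ≤ ∑ i, (1 - ψ i ^ 2) := by
    -- At most a quarter of the units are exceptional, so the variances sum to at least `3 κ n / 4`.
    have hcard := card_large_localField_le (H := d * ‖γ‖) (h := fun i => x i ⬝ᵥ γ)
      (v := fun i => spin (t i)) (s := 2) hW (fun i => (abs_spin _).le)
      (fun i => abs_dotProduct_le (hx i) γ) two_pos hK
    have hterm : ∀ i, κ - (if ¬ |localField W (fun i => x i ⬝ᵥ γ) (fun i => spin (t i)) i| ≤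
        K * 2 + K + d * ‖γ‖ then κ else 0) ≤ 1 - ψ i ^ 2 := fun i => by
      simp only [hψ, condMean]
      rw [← alpha''_spinMeasure]
      split_ifs with hi
      swap
      · rw [sub_self]; exact alpha''_nonneg unitCarried_spinMeasure _ _
      · rw [sub_zero]
        refine hκb _ _ hi ((abs_entry_le hW i i).trans ?_)
        have : 0 ≤ d * ‖γ‖ := by positivity
        linarith
    refine le_trans ?_ (Finset.sum_le_sum fun i _ => hterm i)
    rw [Finset.sum_sub_distrib, ← Finset.sum_filter, Finset.sum_const, Finset.sum_const]
    simp only [Finset.card_univ, Fintype.card_fin, nsmul_eq_mul]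
    nlinarith
  have hcross : |∑ i, (spin (t i) - ψ i) * (x i ⬝ᵥ p.2)| ≤ d * b * (η * n) := by
    have : ∑ i, (spin (t i) - ψ i) * (x i ⬝ᵥ p.2) =
        ∑ k, p.2 k * ∑ i, x i k * (spin (t i) - ψ i) := by
      simp only [dotProduct, Finset.mul_sum]
      rw [Finset.sum_comm]
      exact Finset.sum_congr rfl fun k _ => Finset.sum_congr rfl fun i _ => by ring
    rw [this]
    exact abs_sum_mul_le hreg.treatment
  have hquad : (lam - d ^ 2 * η) * n * b ^ 2 ≤ ∑ i, (x i ⬝ᵥ p.2) ^ 2 := by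
    have e1 : ∑ i, (x i ⬝ᵥ p.2) ^ 2 = n * (∑ k, ∑ l, p.2 k * p.2 l * S k l) +
        ∑ k, p.2 k * ∑ l, p.2 l * ∑ i, (x i k * x i l - S k l) := by
      have : ∀ k l, ∑ i, (x i k * x i l - S k l) = ∑ i, x i k * x i l - n * S k l := fun k l => by
        rw [Finset.sum_sub_distrib]; simp
      simp only [this, mul_sub, Finset.sum_sub_distrib, Finset.mul_sum]
      have e2 : ∀ i, (x i ⬝ᵥ p.2) ^ 2 = ∑ k, ∑ l, p.2 k * (p.2 l * (x i k * x i l)) := fun i => by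
        rw [sq, dotProduct, Finset.sum_mul_sum]
        exact Finset.sum_congr rfl fun k _ => Finset.sum_congr rfl fun l _ => by ring
      simp only [e2]
      rw [Finset.sum_comm]
      have e3 : ∀ k, ∑ i, ∑ l, p.2 k * (p.2 l * (x i k * x i l)) =
          ∑ l, ∑ i, p.2 k * (p.2 l * (x i k * x i l)) := fun k => Finset.sum_comm
      simp only [e3]
      have e4 : ∀ k l, p.2 k * (p.2 l * (n * S k l)) = n * (p.2 k * p.2 l * S k l) :=
        fun k l => by ring
      simp only [e4]
      ring
    have e5 := abs_sum_mul_le (c := p.2) (R := fun k => ∑ l, p.2 l * ∑ i, (x i k * x i l - S k l))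
      fun k => abs_sum_mul_le (hreg.covariate k)
    have e6 := (abs_le.1 e5).1
    have e7 := mul_le_mul_of_nonneg_left (hS p.2) hn
    rw [e1]
    simp only [← hb] at e6 e7
    nlinarith
  have hQ1 : a ^ 2 * (κ / 2 * n) - 2 * a * (d * b * (η * n)) ≤ ∑ i, field p t x i ^ 2 := by
    -- With `u = x i ⬝ᵥ p.2`, the squared field equals the left side plus `(u + τ ψ)²`. The
    -- treatment is thus split into its conditional mean, which may correlate with the covariates,
    -- and a fluctuation, which hardly does.
    have hpt : ∀ i, p.1 ^ 2 * (1 - ψ i ^ 2) + 2 * p.1 * ((spin (t i) - ψ i) * (x i ⬝ᵥ p.2)) ≤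
        field p t x i ^ 2 := fun i => by
      have := sq_nonneg (x i ⬝ᵥ p.2 + p.1 * ψ i)
      have hs := spin_sq (t i)
      rw [field]
      nlinarith
    refine le_trans ?_ (Finset.sum_le_sum fun i _ => hpt i)
    rw [Finset.sum_add_distrib, ← Finset.mul_sum, ← Finset.mul_sum]
    have e1 := mul_le_mul_of_nonneg_left hvar (sq_nonneg p.1)
    have e2 : |2 * p.1 * ∑ i, (spin (t i) - ψ i) * (x i ⬝ᵥ p.2)| ≤ 2 * a * (d * b * (η * n)) := by
      rw [abs_mul, abs_mul, abs_two]
      exact mul_le_mul_of_nonneg_left hcross (by positivity)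
    have e3 := (abs_le.1 e2).1
    have e4 : a ^ 2 = p.1 ^ 2 := sq_abs _
    rw [e4]
    linarith
  have hQ2 : (lam - d ^ 2 * η) * n * b ^ 2 / 2 - n * a ^ 2 ≤ ∑ i, field p t x i ^ 2 := by
    -- The difference of the two sides is half of `(u + 2 τ s)²`, where `s² = 1`.
    have hpt : ∀ i, (x i ⬝ᵥ p.2) ^ 2 / 2 - a ^ 2 ≤ field p t x i ^ 2 := fun i => by
      have hs := spin_sq (t i)
      have e4 : a ^ 2 = p.1 ^ 2 := sq_abs _
      have := sq_nonneg (x i ⬝ᵥ p.2 + 2 * p.1 * spin (t i))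
      rw [field, e4]
      have e5 : p.1 ^ 2 * spin (t i) ^ 2 = p.1 ^ 2 := by rw [hs, mul_one]
      nlinarith
    refine le_trans ?_ (Finset.sum_le_sum fun i _ => hpt i)
    rw [Finset.sum_sub_distrib, ← Finset.sum_div]
    simp only [Finset.sum_const, Finset.card_univ, Fintype.card_fin, nsmul_eq_mul]
    linarith
  set Q := ∑ i, field p t x i ^ 2
  have hnorm : ‖p‖ ^ 2 ≤ a ^ 2 + b ^ 2 := by
    rw [Prod.norm_def, Real.norm_eq_abs]
    rcases max_choice |p.1| ‖p.2‖ with h | h <;> rw [h] <;> nlinarith [sq_nonneg a, sq_nonneg b]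
  -- `hQ1` controls `τ` and `hQ2` controls `θ` up to `a²`; weighting `hQ2` by `κ / 4` spends only
  -- half of the `κ / 2` available in `hQ1`. After absorption of the cross term `κ / 8` and `κ lam /
  -- 32` remain.
  have hcomb : min (κ / 8) (κ * lam / 32) * n * (a ^ 2 + b ^ 2) ≤ (1 + κ / 4) * Q := by
    have g1 : d * η * (2 * (a * b)) ≤ d * η * (a ^ 2 + b ^ 2) :=
      mul_le_mul_of_nonneg_left (by nlinarith [sq_nonneg (a - b)]) (by positivity)
    have g2 : d * η * a ^ 2 ≤ κ / 8 * a ^ 2 := by gcongr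
    have g3 : d * η * b ^ 2 ≤ κ * lam / 32 * b ^ 2 := by gcongr
    have g4 : lam / 2 * b ^ 2 ≤ (lam - d ^ 2 * η) * b ^ 2 := by gcongr; linarith
    have g5 : min (κ / 8) (κ * lam / 32) * (a ^ 2 + b ^ 2) ≤ κ / 8 * a ^ 2 + κ * lam / 32 * b ^ 2 := by
      rw [mul_add]
      gcongr
      · exact min_le_left _ _
      · exact min_le_right _ _
    have g6 := mul_le_mul_of_nonneg_left hQ2 (show 0 ≤ κ / 4 by positivity)
    have g7 : min (κ / 8) (κ * lam / 32) * (a ^ 2 + b ^ 2) ≤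
        a ^ 2 * (κ / 2) - d * η * (2 * (a * b)) +
          κ / 4 * ((lam - d ^ 2 * η) * b ^ 2 / 2 - a ^ 2) := by
      have := mul_le_mul_of_nonneg_left g4 (show 0 ≤ κ / 8 by positivity)
      linarith
    have g8 := mul_le_mul_of_nonneg_left g7 hn
    linarith
  have hQ0 : 0 ≤ Q := Finset.sum_nonneg fun i _ => sq_nonneg _
  set m := min (κ / 8) (κ * lam / 32) with hm
  have hm0 : 0 ≤ m := by positivity
  have e1 : m * n * ‖p‖ ^ 2 ≤ (1 + κ) * Q := by
    have := mul_le_mul_of_nonneg_left hnorm (mul_nonneg hm0 hn)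
    have : (1 + κ / 4) * Q ≤ (1 + κ) * Q := by gcongr; linarith
    linarith
  rw [div_mul_eq_mul_div, div_mul_eq_mul_div, div_le_iff₀ (by positivity)]
  linarith

end Interference

/-! ### The pseudo-likelihood -/

namespace Interference

variable {μ : Measure ℝ} {n d : ℕ}

/-- Projection of the line onto `[-1, 1]`. -/
noncomputable def clampUnit (x : ℝ) : ℝ := max (-1) (min x 1)

lemma measurable_clampUnit : Measurable clampUnit := by unfold clampUnit; fun_prop

lemma abs_clampUnit_le (x : ℝ) : |clampUnit x| ≤ 1 :=
  abs_le.2 ⟨le_max_left _ _, max_le (by norm_num) (min_le_right _ _)⟩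

lemma clampUnit_of_mem {x : ℝ} (hx : x ∈ Set.Icc (-1 : ℝ) 1) : clampUnit x = x := by
  rw [clampUnit, min_eq_left hx.2, max_eq_right hx.1]

/-- Outcomes lie in `[-1, 1]` only almost surely, whereas the Gibbs lemmas require a bound at every
point. Reading outcomes through `clampUnit` provides it at no cost. -/
lemma UnitCarried.map_clampUnit (hμ : UnitCarried μ) : μ.map clampUnit = μ := by
  refine (Measure.map_congr (g := id) ?_).trans Measure.map_id
  filter_upwards [hμ.ae_mem] with x hx using clampUnit_of_mem hx

lemma UnitCarried.ae_pi_mem [IsFiniteMeasure μ] (hμ : UnitCarried μ) (n : ℕ) :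
    ∀ᵐ y ∂(Measure.pi fun _ : Fin n => μ), ∀ i, y i ∈ Set.Icc (-1 : ℝ) 1 :=
  ae_all_iff.2 fun _ => Measure.tendsto_eval_ae_ae.eventually hμ.ae_mem

lemma outcomeWeight_eq (A : Matrix (Fin n) (Fin n) ℝ) (p : Param d) (x : Covariates n d)
    (t : Treatments n) (y : Outcomes n) :
    outcomeWeight A p x t y = gibbsWeight A (field p t x) y := rfl

lemma UnitCarried.gibbsWeight_clamp [IsFiniteMeasure μ] (hμ : UnitCarried μ)
    (A : Matrix (Fin n) (Fin n) ℝ) (h : Fin n → ℝ) :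
    (fun y => gibbsWeight A h fun i => clampUnit (y i)) =ᵐ[Measure.pi fun _ : Fin n => μ]
      gibbsWeight A h := by
  filter_upwards [hμ.ae_pi_mem n] with y hy
  simp only [fun i => clampUnit_of_mem (hy i)]

lemma UnitCarried.integrable_gibbsWeight [IsFiniteMeasure μ] (hμ : UnitCarried μ)
    (A : Matrix (Fin n) (Fin n) ℝ) (h : Fin n → ℝ) :
    Integrable (gibbsWeight A h) (Measure.pi fun _ : Fin n => μ) :=
  (Interference.integrable_gibbsWeight measurable_clampUnit abs_clampUnit_le A h).congr
    (hμ.gibbsWeight_clamp A h)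

lemma UnitCarried.integral_gibbsWeight_pos [IsFiniteMeasure μ] (hμ : UnitCarried μ)
    (A : Matrix (Fin n) (Fin n) ℝ) (h : Fin n → ℝ) :
    0 < ∫ y, gibbsWeight A h y ∂(Measure.pi fun _ : Fin n => μ) := by
  have : NeZero (Measure.pi fun _ : Fin n => μ) := ⟨fun h => by
    have h1 : (Measure.pi fun _ : Fin n => μ) Set.univ = 0 := by rw [h]; simp
    rw [Measure.pi_univ, Finset.prod_eq_zero_iff] at h1
    obtain ⟨_, _, h2⟩ := h1
    exact hμ.ne_zero (Measure.measure_univ_eq_zero.1 h2)⟩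
  exact integral_exp_pos (hμ.integrable_gibbsWeight A h)

/-! ### Concavity of the log-pseudo-likelihood and location of its maximiser -/

/-- The logarithm of the pseudo-likelihood. -/
noncomputable def logPL (μ : Measure ℝ) (A : Matrix (Fin n) (Fin n) ℝ) (z : Data n d)
    (p : Param d) : ℝ :=
  ∑ i, (localField A (field p z.2.1 z.1) z.2.2 i * z.2.2 i + A i i / 2 * z.2.2 i ^ 2 -
    alpha μ (localField A (field p z.2.1 z.1) z.2.2 i) (A i i))

/-- The global normalising constant and the weight of the remaining coordinates cancel in the
conditional density, leaving a one-dimensional tilt with explicit normalisation `exp α`. -/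
lemma condDensity_eq [IsFiniteMeasure μ] (hμ : UnitCarried μ) {A : Matrix (Fin n) (Fin n) ℝ}
    (hA : A.IsSymm) (p : Param d) (z : Data n d) (i : Fin n) :
    condDensity μ A p z i =
      Real.exp (localField A (field p z.2.1 z.1) z.2.2 i * z.2.2 i + A i i / 2 * z.2.2 i ^ 2 -
        alpha μ (localField A (field p z.2.1 z.1) z.2.2 i) (A i i)) := by
  set h := field p z.2.1 z.1
  set y := z.2.2
  have hZ := (hμ.integral_gibbsWeight_pos A h).ne'
  have h1 : gibbsWeight A h y = Real.exp (localField A h y i * y i + A i i / 2 * y i ^ 2) *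
      gibbsWeight A h (Function.update y i 0) := by
    conv_lhs => rw [← Function.update_eq_self i y]
    exact gibbsWeight_update hA h y i (y i)
  have h2 : ∫ s, gibbsWeight A h (Function.update y i s) ∂μ =
      Real.exp (alpha μ (localField A h y i) (A i i)) *
      gibbsWeight A h (Function.update y i 0) := by
    rw [exp_alpha hμ, ← integral_mul_const]
    exact integral_congr_ae (.of_forall fun s => gibbsWeight_update hA h y i s)
  have h3 : condDensity μ A p z i = gibbsWeight A h y /
      ∫ s, gibbsWeight A h (Function.update y i s) ∂μ := by
    simp only [condDensity, outcomeDensity, outcomeWeight_eq]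
    rw [integral_div, div_div_div_cancel_right₀ hZ]
  have h4 : gibbsWeight A h (Function.update y i 0) ≠ 0 := (Real.exp_pos _).ne'
  rw [h3, h2, h1, mul_div_mul_right _ _ h4, ← Real.exp_sub]

lemma pseudoLikelihood_eq [IsFiniteMeasure μ] (hμ : UnitCarried μ) {A : Matrix (Fin n) (Fin n) ℝ}
    (hA : A.IsSymm) (z : Data n d) (p : Param d) :
    pseudoLikelihood μ A z p = Real.exp (logPL μ A z p) := by
  simp only [pseudoLikelihood, condDensity_eq hμ hA, logPL, Real.exp_sum]

lemma localField_field_add (A : Matrix (Fin n) (Fin n) ℝ) (p q : Param d) (t : Treatments n)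
    (x : Covariates n d) (v : Fin n → ℝ) (i : Fin n) :
    localField A (field p t x) v i =
      localField A (field q t x) v i + field (p - q) t x i := by
  simp only [localField, field_sub]; ring

lemma continuous_field (t : Treatments n) (x : Covariates n d) (i : Fin n) :
    Continuous fun p : Param d => field p t x i := by
  unfold field dotProduct; fun_prop

lemma continuous_logPL (hμ : UnitCarried μ) (A : Matrix (Fin n) (Fin n) ℝ) (z : Data n d) :
    Continuous (logPL μ A z) := by
  have ha : ∀ b, Continuous fun s => alpha μ s b := fun b =>
    continuous_iff_continuousAt.2 fun a => (hasDerivAt_alpha hμ a b).continuousAt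
  have hl : ∀ i, Continuous fun p : Param d => localField A (field p z.2.1 z.1) z.2.2 i :=
    fun i => continuous_const.add (continuous_field _ _ i)
  unfold logPL
  exact continuous_finsetSum _ fun i _ =>
    (((hl i).mul continuous_const).add continuous_const).sub ((ha _).comp (hl i))

/-- Local fields are affine in the parameter and `α` is strictly convex. Injectivity of the design
makes the local fields of two distinct parameters differ at some unit, and one strict inequality is
enough. -/
lemma strictConcaveOn_logPL (hμ : UnitCarried μ) (hc : ∀ c : ℝ, ¬ ∀ᵐ x ∂μ, x = c)
    (A : Matrix (Fin n) (Fin n) ℝ) (z : Data n d)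
    (hinj : ∀ p : Param d, p ≠ 0 → ∃ i, field p z.2.1 z.1 i ≠ 0) :
    StrictConcaveOn ℝ Set.univ (logPL μ A z) := by
  refine ⟨convex_univ, fun p _ q _ hpq a b ha hb hab => ?_⟩
  have hlin : ∀ i, localField A (field (a • p + b • q) z.2.1 z.1) z.2.2 i =
      a * localField A (field p z.2.1 z.1) z.2.2 i +
        b * localField A (field q z.2.1 z.1) z.2.2 i := fun i => by
    have : field (a • p + b • q) z.2.1 z.1 i =
        a * field p z.2.1 z.1 i + b * field q z.2.1 z.1 i := by
      simp only [field, Prod.fst_add, Prod.smul_fst, Prod.snd_add, Prod.smul_snd, smul_eq_mul,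
        dotProduct_add, dotProduct_smul]
      ring
    simp only [localField, this]
    have hb' : b = 1 - a := by linarith
    subst hb'
    ring
  simp only [logPL, smul_eq_mul, Finset.mul_sum, ← Finset.sum_add_distrib]
  have hb' : b = 1 - a := by linarith
  refine Finset.sum_lt_sum (fun i _ => ?_) ?_
  · have h := (strictConvexOn_alpha hμ hc (A i i)).convexOn.2
      (Set.mem_univ (localField A (field p z.2.1 z.1) z.2.2 i))
      (Set.mem_univ (localField A (field q z.2.1 z.1) z.2.2 i)) ha.le hb.le hab
    simp only [smul_eq_mul] at h
    rw [hlin]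
    subst hb'
    linarith
  · obtain ⟨i, hi⟩ := hinj (p - q) (sub_ne_zero.2 hpq)
    have hne : localField A (field p z.2.1 z.1) z.2.2 i ≠
        localField A (field q z.2.1 z.1) z.2.2 i := by
      rw [localField_field_add A p q]
      simpa using hi
    have h := (strictConvexOn_alpha hμ hc (A i i)).2
      (Set.mem_univ (localField A (field p z.2.1 z.1) z.2.2 i))
      (Set.mem_univ (localField A (field q z.2.1 z.1) z.2.2 i)) hne ha hb hab
    simp only [smul_eq_mul] at h
    refine ⟨i, Finset.mem_univ i, ?_⟩
    rw [hlin]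
    subst hb'
    linarith

/-- A strictly concave function which is below its value at `p₀` on a sphere around `p₀` has a
unique maximiser over every closed convex set containing `p₀`, and it lies in the ball. -/
lemma exists_isUniqueMaximizer_of_sphere {Θ : Set (Param d)} {L : Param d → ℝ}
    (hL : StrictConcaveOn ℝ Set.univ L) (hLc : Continuous L) (hΘ : IsClosed Θ) (hΘc : Convex ℝ Θ)
    {p₀ : Param d} (hp₀ : p₀ ∈ Θ) {r : ℝ} (hr : 0 < r)
    (hlt : ∀ p, ‖p - p₀‖ = r → L p < L p₀) :
    ∃ p, IsUniqueMaximizer Θ L p ∧ ‖p - p₀‖ ≤ r := by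
  obtain ⟨p, ⟨hpΘ, hpr⟩, hmax⟩ := ((isCompact_closedBall p₀ r).inter_left hΘ).exists_isMaxOn
    ⟨p₀, hp₀, Metric.mem_closedBall_self hr.le⟩ hLc.continuousOn
  have hle : ∀ q ∈ Θ, L q ≤ L p := fun q hq => by
    by_cases hqr : ‖q - p₀‖ ≤ r
    · exact hmax ⟨hq, by rwa [Metric.mem_closedBall, dist_eq_norm]⟩
    -- The segment from `p₀` to an outer point crosses the sphere, where `L` is below `L p₀`; by
    -- concavity `L` cannot have recovered at the outer endpoint.
    · refine le_trans ?_ (hmax ⟨hp₀, Metric.mem_closedBall_self hr.le⟩)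
      have hqr := not_le.1 hqr
      set ρ := ‖q - p₀‖
      have hρ : 0 < ρ := hr.trans hqr
      have h1 := hL.concaveOn.2 (Set.mem_univ p₀) (Set.mem_univ q)
        (show 0 ≤ 1 - r / ρ by rw [sub_nonneg, div_le_one hρ]; exact hqr.le)
        (show 0 ≤ r / ρ by positivity) (by ring)
      have h2 := hlt ((1 - r / ρ) • p₀ + (r / ρ) • q) (by
        have : (1 - r / ρ) • p₀ + (r / ρ) • q - p₀ = (r / ρ) • (q - p₀) := by module
        rw [this, norm_smul, Real.norm_of_nonneg (by positivity), div_mul_cancel₀ _ hρ.ne'])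
      simp only [smul_eq_mul] at h1
      have h3 : r / ρ * L q ≤ r / ρ * L p₀ := by linarith
      exact le_of_mul_le_mul_left h3 (by positivity)
  refine ⟨p, ⟨hpΘ, fun q hq hqp => lt_of_le_of_ne (hle q hq) fun heq => ?_⟩,
    by rwa [Metric.mem_closedBall, dist_eq_norm] at hpr⟩
  have h0 : (0 : ℝ) < 1 / 2 := by norm_num
  -- Two maximisers would be beaten by their midpoint, which lies in `Θ` by convexity.
  have h1 := hL.2 (Set.mem_univ q) (Set.mem_univ p) hqp h0 h0 (by norm_num)
  have h2 := hle _ (hΘc hq hpΘ h0.le h0.le (by norm_num))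
  simp only [smul_eq_mul] at h1
  linarith

/-- Approximate vanishing of the score at `p`, up to an error `η`. -/
structure ScoreRegular (μ : Measure ℝ) (A : Matrix (Fin n) (Fin n) ℝ) (p : Param d) (η : ℝ)
    (z : Data n d) : Prop where
  treatment : |∑ i, spin (z.2.1 i) *
    (z.2.2 i - condMean μ A (field p z.2.1 z.1) z.2.2 i)| ≤ η * n
  covariate : ∀ k, |∑ i, z.1 i k *
    (z.2.2 i - condMean μ A (field p z.2.1 z.1) z.2.2 i)| ≤ η * n

/-- On regular data the maximum pseudo-likelihood estimator exists, is unique and is close to the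
true parameter. -/
lemma exists_isUniqueMaximizer_pseudoLikelihood [IsFiniteMeasure μ] (hμ : UnitCarried μ)
    (hc : ∀ c : ℝ, ¬ ∀ᵐ x ∂μ, x = c) (p₀ : Param d) (γ : Fin d → ℝ) {S : Fin d → Fin d → ℝ}
    {lam K : ℝ} (hlam : 0 < lam)
    (hS : ∀ θ : Fin d → ℝ, lam * ‖θ‖ ^ 2 ≤ ∑ k, ∑ l, θ k * θ l * S k l)
    (hK : 0 < K) {r : ℝ} (hr : 0 < r) :
    ∃ η > 0, ∀ (n : ℕ) (A W : Matrix (Fin n) (Fin n) ℝ) (z : Data n d) (Θ : Set (Param d)),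
      0 < n → A.IsSymm → opNorm A ≤ K → opNorm W ≤ K →
      (∀ i k, z.1 i k ∈ Set.Icc (-1 : ℝ) 1) → (∀ i, z.2.2 i ∈ Set.Icc (-1 : ℝ) 1) →
      DesignRegular W γ S η z.1 z.2.1 → ScoreRegular μ A p₀ η z →
      IsClosed Θ → Convex ℝ Θ → p₀ ∈ Θ →
      ∃ p, IsUniqueMaximizer Θ (pseudoLikelihood μ A z) p ∧ ‖p - p₀‖ ≤ r := by
  -- A smaller ball proves the claim for a larger one. With `r ≤ 1` the increments `Δ i` are at most
  -- `1 + d`, so moderate local fields stay in one compact range.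
  wlog hr1 : r ≤ 1 generalizing r
  · obtain ⟨η, hη, h⟩ := this one_pos le_rfl
    refine ⟨η, hη, fun n A W z Θ h1 h2 h3 h4 h5 h6 h7 h8 h9 h10 h11 => ?_⟩
    obtain ⟨p, hp, hp'⟩ := h n A W z Θ h1 h2 h3 h4 h5 h6 h7 h8 h9 h10 h11
    exact ⟨p, hp, hp'.trans (not_le.1 hr1).le⟩
  obtain ⟨c, hc0, η₁, hη₁, hdes⟩ := exists_design_lower_bound γ hlam hS hK
  -- Exceptional units make up a fraction `s⁻² = c / (2 (1 + d)²)`; their missing curvature costs at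
  -- most half of the total `κ c n r² / 2`.
  set s : ℝ := √(2 * (1 + d) ^ 2 / c) with hs
  have hs0 : 0 < s := Real.sqrt_pos.2 (by positivity)
  have hs2 : s ^ 2 = 2 * (1 + d) ^ 2 / c := Real.sq_sqrt (by positivity)
  set H : ℝ := (1 + d) * ‖p₀‖ with hH
  have hH0 : 0 ≤ H := by positivity
  obtain ⟨κ, hκ, hκb⟩ := exists_alpha''_lower_bound hμ hc (K * s + K + H + (1 + d))
  -- The second bound makes the score term at most `κ c n r² / 8`, half of the curvature left after
  -- the exceptional units.
  refine ⟨min η₁ (κ * c * r / (8 * (1 + d))), by positivity,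
    fun n A W z Θ hn hA hAK hWK hx hy hD hSc hΘ hΘc hp₀ => ?_⟩
  obtain ⟨x, t, y⟩ := z
  set η := min η₁ (κ * c * r / (8 * (1 + d))) with hη
  simp only at hx hy hD
  have hn' : (0 : ℝ) < n := Nat.cast_pos.2 hn
  have hx' : ∀ i k, |x i k| ≤ 1 := fun i k => abs_le.2 (hx i k)
  have hD' : DesignRegular W γ S η₁ x t :=
    ⟨fun k => (hD.treatment k).trans (by gcongr; exact min_le_left _ _),
      fun k l => (hD.covariate k l).trans (by gcongr; exact min_le_left _ _)⟩
  have hQ := hdes n W x t hWK hx' hD'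
  have hinj : ∀ p : Param d, p ≠ 0 → ∃ i, field p t x i ≠ 0 := fun p hp => by
    by_contra! hcon
    have := hQ p
    simp only [hcon] at this
    have h2 : 0 < c * n * ‖p‖ ^ 2 := by have := norm_pos_iff.2 hp; positivity
    simp at this
    linarith
  have hsphere : ∀ p : Param d, ‖p - p₀‖ = r → logPL μ A (x, t, y) p < logPL μ A (x, t, y) p₀ := by
    intro p hp
    set a : Fin n → ℝ := localField A (field p₀ t x) y with ha
    set Δ : Fin n → ℝ := field (p - p₀) t x with hΔ
    have hΔb : ∀ i, |Δ i| ≤ 1 + d := fun i => by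
      refine (abs_field_le (p - p₀) t hx' i).trans ?_
      rw [hp]
      exact mul_le_of_le_one_right (by positivity) hr1
    have hΔb' : ∀ i, Δ i ^ 2 ≤ (1 + d) ^ 2 * r ^ 2 := fun i => by
      rw [← mul_pow, ← sq_abs]
      refine pow_le_pow_left₀ (abs_nonneg _) ?_ 2
      rw [← hp]
      exact abs_field_le (p - p₀) t hx' i
    -- Units with a moderate local field contribute curvature `κ`. For the others only convexity of
    -- `α` is used, and the indicator term subtracts the curvature that they fail to deliver.
    have hterm : ∀ i, (localField A (field p t x) y i * y i + A i i / 2 * y i ^ 2 -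
        alpha μ (localField A (field p t x) y i) (A i i)) -
        (a i * y i + A i i / 2 * y i ^ 2 - alpha μ (a i) (A i i)) ≤
        Δ i * (y i - condMean μ A (field p₀ t x) y i) - (κ / 2 * Δ i ^ 2 -
          if ¬ |a i| ≤ K * s + K + H then κ / 2 * ((1 + d) ^ 2 * r ^ 2) else 0) := fun i => by
      rw [localField_field_add A p p₀]
      change (a i + Δ i) * y i + _ - _ - _ ≤ Δ i * (y i - alpha' μ (a i) (A i i)) - _
      split_ifs with hi
      · have hAii : |A i i| ≤ K * s + K + H + (1 + d) := (abs_entry_le hAK i i).trans (by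
          have : 0 ≤ K * s := by positivity
          have : (0 : ℝ) ≤ d := Nat.cast_nonneg d
          linarith)
        have := alpha_taylor_lower hμ (κ := κ) (b := A i i) (R := K * s + K + H + (1 + d))
          (fun u hu => hκb u _ hu hAii) (a := a i) (a' := a i + Δ i)
          (hi.trans (by have : (0 : ℝ) ≤ d := Nat.cast_nonneg d
                        linarith))
          ((abs_add_le _ _).trans (add_le_add hi (hΔb i)))
        simp only [add_sub_cancel_left] at this
        linarith
      · have := alpha_taylor_lower hμ (κ := 0) (b := A i i) (R := max |a i| |a i + Δ i|)
          (fun u hu => alpha''_nonneg hμ _ _) (a := a i) (a' := a i + Δ i)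
          (le_max_left _ _) (le_max_right _ _)
        simp only [add_sub_cancel_left] at this
        have h2 := mul_le_mul_of_nonneg_left (hΔb' i) (show 0 ≤ κ / 2 by positivity)
        linarith
    have hsum : logPL μ A (x, t, y) p - logPL μ A (x, t, y) p₀ ≤
        ∑ i, Δ i * (y i - condMean μ A (field p₀ t x) y i) - (κ / 2 * ∑ i, Δ i ^ 2 -
          ((Finset.univ.filter fun i => ¬ |a i| ≤ K * s + K + H).card : ℝ) *
            (κ / 2 * ((1 + d) ^ 2 * r ^ 2))) := by
      have h1 := Finset.sum_le_sum fun i (_ : i ∈ Finset.univ) => hterm i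
      rw [Finset.sum_sub_distrib] at h1
      refine h1.trans_eq ?_
      rw [Finset.sum_sub_distrib, Finset.sum_sub_distrib,
        ← Finset.mul_sum, ← Finset.sum_filter, Finset.sum_const, nsmul_eq_mul]
    have hcard := card_large_localField_le (H := H) (h := field p₀ t x) (v := y) (s := s) hAK
      (fun i => abs_le.2 (hy i)) (fun i => abs_field_le p₀ t hx' i) hs0 hK
    have hscore : |∑ i, Δ i * (y i - condMean μ A (field p₀ t x) y i)| ≤ (1 + d) * r * (η * n) := by
      have e1 : ∑ i, Δ i * (y i - condMean μ A (field p₀ t x) y i) =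
          (p - p₀).1 * ∑ i, spin (t i) * (y i - condMean μ A (field p₀ t x) y i) +
          ∑ k, (p - p₀).2 k * ∑ i, x i k * (y i - condMean μ A (field p₀ t x) y i) := by
        simp only [hΔ, field, dotProduct, Finset.mul_sum]
        rw [Finset.sum_comm, ← Finset.sum_add_distrib]
        refine Finset.sum_congr rfl fun i _ => ?_
        rw [add_mul, Finset.sum_mul]
        congr 1
        · ring
        · exact Finset.sum_congr rfl fun k _ => by ring
      rw [e1]
      refine (abs_add_le _ _).trans ?_
      have e2 := abs_sum_mul_le (c := (p - p₀).2) hSc.covariate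
      have e3 : |(p - p₀).1 * ∑ i, spin (t i) * (y i - condMean μ A (field p₀ t x) y i)| ≤
          r * (η * n) := by
        rw [abs_mul, ← hp]
        exact mul_le_mul (norm_fst_le (p - p₀)) hSc.treatment (abs_nonneg _) (norm_nonneg _)
      have e4 : d * ‖(p - p₀).2‖ * (η * n) ≤ d * r * (η * n) := by
        rw [← hp]
        have := norm_snd_le (p - p₀)
        gcongr
      simp only at e2
      linarith
    have hQp := hQ (p - p₀)
    rw [hp] at hQp
    have hbad : ((Finset.univ.filter fun i => ¬ |a i| ≤ K * s + K + H).card : ℝ) *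
        (κ / 2 * ((1 + d) ^ 2 * r ^ 2)) ≤ κ * c / 4 * n * r ^ 2 := by
      refine (mul_le_mul_of_nonneg_right hcard (by positivity)).trans_eq ?_
      rw [hs2]
      field_simp
      ring
    have hQp' := mul_le_mul_of_nonneg_left hQp (show 0 ≤ κ / 2 by positivity)
    have hη' : (1 + d) * r * (η * n) ≤ κ * c / 8 * n * r ^ 2 := by
      have : η ≤ κ * c * r / (8 * (1 + d)) := min_le_right _ _
      calc (1 + d) * r * (η * n) ≤ (1 + d) * r * (κ * c * r / (8 * (1 + d)) * n) := by gcongr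
        _ = _ := by field_simp
    have hpos : 0 < κ * c / 8 * n * r ^ 2 := by positivity
    have hsc := (abs_le.1 hscore).2
    have hΔQ : ∑ i, field (p - p₀) t x i ^ 2 = ∑ i, Δ i ^ 2 := rfl
    rw [hΔQ] at hQp'
    linarith
  obtain ⟨p, ⟨hpΘ, hpmax⟩, hpr⟩ := exists_isUniqueMaximizer_of_sphere
    (strictConcaveOn_logPL hμ hc A (x, t, y) hinj) (continuous_logPL hμ A (x, t, y)) hΘ hΘc hp₀ hr
    hsphere
  refine ⟨p, ⟨hpΘ, fun q hq hqp => ?_⟩, hpr⟩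
  rw [pseudoLikelihood_eq hμ hA, pseudoLikelihood_eq hμ hA]
  exact Real.exp_lt_exp.2 (hpmax q hq hqp)

end Interference

/-! ### The fixed point system -/

namespace Interference

lemma abs_mul_sub_mul_le {x y x' y' B C : ℝ} (hx : |x'| ≤ 1) (hy : |y| ≤ 1)
    (h1 : |x - x'| ≤ B) (h2 : |y - y'| ≤ C) : |x * y - x' * y'| ≤ B + C := by
  have : x * y - x' * y' = (x - x') * y + x' * (y - y') := by ring
  rw [this]
  refine (abs_add_le _ _).trans ?_
  rw [abs_mul, abs_mul]
  have e1 := mul_le_of_le_one_right (abs_nonneg (x - x')) hy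
  have e2 := mul_le_of_le_one_left (abs_nonneg (y - y')) hx
  linarith

/-- Functions of the two tilt parameters with the regularity used for the fixed point system. -/
structure TiltRegular (g : ℝ → ℝ → ℝ) : Prop where
  continuous : Continuous fun s : ℝ × ℝ => g s.1 s.2
  abs_le : ∀ a b, |g a b| ≤ 2
  abs_sub_le : ∀ a b a' b', |g a b - g a' b'| ≤ 6 * |a - a'| + 3 * |b - b'|
  deriv_lipschitz : ∃ g' : ℝ → ℝ → ℝ, (∀ a b, HasDerivAt (fun s => g s b) (g' a b) a) ∧
    ∀ a a' b, |g' a b - g' a' b| ≤ 26 * |a - a'|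

variable {μ : Measure ℝ}

lemma tiltRegular_alpha'_sq (hμ : UnitCarried μ) : TiltRegular fun a b => alpha' μ a b ^ 2 where
  continuous := (continuous_alpha' hμ).pow 2
  abs_le a b := by
    rw [abs_pow]
    exact (pow_le_one₀ (abs_nonneg _) (abs_alpha'_le_one hμ a b)).trans one_le_two
  abs_sub_le a b a' b' := by
    have := abs_sq_sub_sq_le (abs_alpha'_le_one hμ a b) (abs_alpha'_le_one hμ a' b')
      (abs_alpha'_sub_le hμ a b a' b')
    have := abs_nonneg (a - a')
    have := abs_nonneg (b - b')
    linarith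
  deriv_lipschitz := by
    refine ⟨fun a b => 2 * (tiltMoment μ 1 a b * tiltMoment μ 2 a b) -
      2 * (tiltMoment μ 1 a b * (tiltMoment μ 1 a b * tiltMoment μ 1 a b)),
      fun a b => ?_, fun a a' b => ?_⟩
    · rw [alpha'_eq hμ]
      refine ((hasDerivAt_tiltMoment_left hμ 1 a b).fun_pow 2).congr_deriv ?_
      norm_num
      ring
    · have hT := fun k => abs_tiltMoment_sub_le hμ k a b a' b
      simp only [sub_self, abs_zero, add_zero] at hT
      have hb := fun k a => abs_tiltMoment_le_one hμ k a b
      have e1 := abs_mul_sub_mul_le (hb 1 a') (hb 2 a) (hT 1) (hT 2)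
      have e2 := abs_mul_sub_mul_le (hb 1 a') (hb 1 a) (hT 1) (hT 1)
      have e3 := abs_mul_sub_mul_le (hb 1 a')
        (by rw [abs_mul]; exact mul_le_one₀ (hb 1 a) (abs_nonneg _) (hb 1 a)) (hT 1) e2
      rw [abs_le] at *
      constructor <;> linarith [abs_nonneg (a - a')]

/-- The derivative is the third cumulant of the tilt. Tilted moments are bounded by one and
2-Lipschitz in `a`, so its Lipschitz constant is at most `2 + 3 · 4 + 2 · 6 = 26`. -/
lemma tiltRegular_alpha'' (hμ : UnitCarried μ) : TiltRegular (alpha'' μ) where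
  continuous := continuous_alpha'' hμ
  abs_le := abs_alpha''_le_two hμ
  abs_sub_le := abs_alpha''_sub_le hμ
  deriv_lipschitz := by
    refine ⟨fun a b => tiltMoment μ 3 a b - 3 * (tiltMoment μ 1 a b * tiltMoment μ 2 a b) +
      2 * (tiltMoment μ 1 a b * (tiltMoment μ 1 a b * tiltMoment μ 1 a b)),
      fun a b => ?_, fun a a' b => ?_⟩
    · simp_rw [alpha''_eq hμ]
      refine ((hasDerivAt_tiltMoment_left hμ 2 a b).fun_sub
        ((hasDerivAt_tiltMoment_left hμ 1 a b).fun_pow 2)).congr_deriv ?_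
      norm_num
      ring
    · have hT := fun k => abs_tiltMoment_sub_le hμ k a b a' b
      simp only [sub_self, abs_zero, add_zero] at hT
      have hb := fun k a => abs_tiltMoment_le_one hμ k a b
      have e0 := hT 3
      have e1 := abs_mul_sub_mul_le (hb 1 a') (hb 2 a) (hT 1) (hT 2)
      have e2 := abs_mul_sub_mul_le (hb 1 a') (hb 1 a) (hT 1) (hT 1)
      have e3 := abs_mul_sub_mul_le (hb 1 a')
        (by rw [abs_mul]; exact mul_le_one₀ (hb 1 a) (abs_nonneg _) (hb 1 a)) (hT 1) e2
      rw [abs_le] at *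
      constructor <;> linarith [abs_nonneg (a - a')]

/-- Odd contributions cancel, so the derivative of the symmetrised function at `u` is of order `u`,
and the function is Lipschitz in `u²`. With `u = β √q` this gives Lipschitz dependence on `q`
itself, despite the singularity of the square root at zero. -/
lemma abs_symmetrized_sub_le_of_le {f f' : ℝ → ℝ} {L : ℝ} (hf : ∀ x, HasDerivAt f (f' x) x)
    (hL : ∀ x y, |f' x - f' y| ≤ L * |x - y|) (hL0 : 0 ≤ L) (x z : ℝ) {s s' : ℝ} (hs' : 0 ≤ s')
    (hss : s' ≤ s) :
    |(f (x + s * z) + f (x - s * z)) - (f (x + s' * z) + f (x - s' * z))| ≤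
      2 * L * z ^ 2 * (s ^ 2 - s' ^ 2) := by
  have hd : ∀ u, HasDerivAt (fun u => f (x + u * z) + f (x - u * z))
      (f' (x + u * z) * z + f' (x - u * z) * (-z)) u := fun u => by
    have h1 : HasDerivAt (fun u => x + u * z) z u := by
      simpa using ((hasDerivAt_id' u).mul_const z).const_add x
    have h2 : HasDerivAt (fun u => x - u * z) (-z) u := by
      simpa using ((hasDerivAt_id' u).mul_const z).const_sub x
    exact ((hf _).comp u h1).add ((hf _).comp u h2)
  have hbound : ∀ u ∈ Set.Icc s' s, ‖f' (x + u * z) * z + f' (x - u * z) * (-z)‖ ≤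
      2 * L * z ^ 2 * s := fun u hu => by
    have h1 := hL (x + u * z) (x - u * z)
    have h2 : x + u * z - (x - u * z) = 2 * u * z := by ring
    rw [h2, abs_mul, abs_mul, abs_two, abs_of_nonneg (hs'.trans hu.1)] at h1
    have h3 : f' (x + u * z) * z + f' (x - u * z) * (-z) =
        (f' (x + u * z) - f' (x - u * z)) * z := by ring
    rw [h3, Real.norm_eq_abs, abs_mul, ← sq_abs z]
    calc |f' (x + u * z) - f' (x - u * z)| * |z| ≤ L * (2 * u * |z|) * |z| := by gcongr
      _ = 2 * L * |z| ^ 2 * u := by ring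
      _ ≤ 2 * L * |z| ^ 2 * s := by gcongr; exact hu.2
  have := (convex_Icc s' s).norm_image_sub_le_of_norm_hasDerivWithin_le
    (fun u _ => (hd u).hasDerivWithinAt) hbound (Set.left_mem_Icc.2 hss) (Set.right_mem_Icc.2 hss)
  rw [Real.norm_eq_abs, Real.norm_of_nonneg (sub_nonneg.2 hss)] at this
  refine this.trans ?_
  have : 0 ≤ 2 * L * z ^ 2 := by positivity
  rw [mul_assoc]
  refine mul_le_mul_of_nonneg_left ?_ this
  nlinarith

lemma abs_symmetrized_sub_le {f f' : ℝ → ℝ} {L : ℝ} (hf : ∀ x, HasDerivAt f (f' x) x)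
    (hL : ∀ x y, |f' x - f' y| ≤ L * |x - y|) (hL0 : 0 ≤ L) (x z : ℝ) {s s' : ℝ} (hs : 0 ≤ s)
    (hs' : 0 ≤ s') :
    |(f (x + s * z) + f (x - s * z)) - (f (x + s' * z) + f (x - s' * z))| ≤
      2 * L * z ^ 2 * |s ^ 2 - s' ^ 2| := by
  rcases le_total s' s with h | h
  · rw [abs_of_nonneg (sub_nonneg.2 (pow_le_pow_left₀ hs' h 2))]
    exact abs_symmetrized_sub_le_of_le hf hL hL0 x z hs' h
  · rw [abs_sub_comm, abs_sub_comm (s ^ 2), abs_of_nonneg (sub_nonneg.2 (pow_le_pow_left₀ hs h 2))]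
    exact abs_symmetrized_sub_le_of_le hf hL hL0 x z hs h

/-! ### The state evolution map as a contraction -/

/-- The average of `g (H + β √q Z, β² σ²)` with `H ∼ ν`. -/
noncomputable def stateAverage (g : ℝ → ℝ → ℝ) (ν : Measure ℝ) (β : ℝ) (w : ℝ × ℝ) : ℝ :=
  ∫ s, g (s.1 + β * √w.1 * s.2) (β ^ 2 * w.2) ∂(ν.prod (gaussianReal 0 1))

lemma TiltRegular.integrable {g : ℝ → ℝ → ℝ} (hg : TiltRegular g) {X : Type*} [MeasurableSpace X]
    (κ : Measure X) [IsFiniteMeasure κ] {u : X → ℝ} (hu : Measurable u) (b : ℝ) :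
    Integrable (fun x => g (u x) b) κ :=
  .of_bound (C := 2) (hg.continuous.measurable.comp
    (hu.prodMk measurable_const)).aestronglyMeasurable (.of_forall fun _ => hg.abs_le _ _)

lemma abs_integral_sub_le {X : Type*} [MeasurableSpace X] {κ : Measure X} [IsProbabilityMeasure κ]
    {f g : X → ℝ} (hf : Integrable f κ) (hg : Integrable g κ) {C : ℝ}
    (h : ∀ᵐ x ∂κ, |f x - g x| ≤ C) : |∫ x, f x ∂κ - ∫ x, g x ∂κ| ≤ C := by
  rw [← integral_sub hf hg]
  simpa using norm_integral_le_of_norm_le_const (f := fun x => f x - g x) h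

lemma integral_sq_gaussian : ∫ z, z ^ 2 ∂(gaussianReal 0 1) = 1 := by
  have h := variance_of_integral_eq_zero (X := id) (μ := gaussianReal 0 1) (by fun_prop) (by simp)
  rw [variance_id_gaussianReal] at h
  simpa using h.symm

lemma TiltRegular.abs_stateAverage_sub_le_snd {g : ℝ → ℝ → ℝ} (hg : TiltRegular g) (ν : Measure ℝ)
    [IsProbabilityMeasure ν] (β q v v' : ℝ) :
    |stateAverage g ν β (q, v) - stateAverage g ν β (q, v')| ≤ 3 * β ^ 2 * |v - v'| := by
  refine abs_integral_sub_le (hg.integrable _ (by fun_prop) _) (hg.integrable _ (by fun_prop) _)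
    (.of_forall fun s => (hg.abs_sub_le _ _ _ _).trans_eq ?_)
  simp only [sub_self, abs_zero, ← mul_sub, abs_mul, abs_pow, sq_abs]
  ring

/-- The Gaussian law is invariant under `z ↦ -z`, so the integrand may be symmetrised; the pointwise
bound then carries a factor `Z²`, whose mean is one. -/
lemma TiltRegular.abs_stateAverage_sub_le_fst {g : ℝ → ℝ → ℝ} (hg : TiltRegular g) (ν : Measure ℝ)
    [IsProbabilityMeasure ν] {β : ℝ} (hβ : 0 ≤ β) (q q' v : ℝ) :
    |stateAverage g ν β (q, v) - stateAverage g ν β (q', v)| ≤ 26 * β ^ 2 * |q - q'| := by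
  obtain ⟨g', hg', hL⟩ := hg.deriv_lipschitz
  have hsym : ∀ c : ℝ, ∫ s, g (s.1 + c * s.2) (β ^ 2 * v) ∂(ν.prod (gaussianReal 0 1)) =
      ∫ s, g (s.1 - c * s.2) (β ^ 2 * v) ∂(ν.prod (gaussianReal 0 1)) := fun c => by
    have hmap : (ν.prod (gaussianReal 0 1)).map (Prod.map id (fun z => -z)) =
        ν.prod (gaussianReal 0 1) := by
      rw [← Measure.map_prod_map _ _ measurable_id measurable_neg, Measure.map_id,
        gaussianReal_map_neg, neg_zero]
    conv_lhs => rw [← hmap]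
    rw [integral_map (by fun_prop) (hg.integrable _ (by fun_prop) _).aestronglyMeasurable]
    simp [sub_eq_add_neg]
  set π := ν.prod (gaussianReal 0 1) with hπ
  have hI : ∀ c : ℝ, ∫ s, g (s.1 + c * s.2) (β ^ 2 * v) ∂π =
      ∫ s, (g (s.1 + c * s.2) (β ^ 2 * v) + g (s.1 - c * s.2) (β ^ 2 * v)) / 2 ∂π := fun c => by
    rw [integral_div, integral_add (hg.integrable _ (by fun_prop) _)
      (hg.integrable _ (by fun_prop) _), ← hsym c]
    ring
  have hint : ∀ c : ℝ, Integrable (fun s : ℝ × ℝ =>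
      (g (s.1 + c * s.2) (β ^ 2 * v) + g (s.1 - c * s.2) (β ^ 2 * v)) / 2) π := fun c =>
    ((hg.integrable _ (by fun_prop) _).add (hg.integrable _ (by fun_prop) _)).div_const 2
  have hz2 : Integrable (fun s : ℝ × ℝ => s.2 ^ 2) π := by
    have : Integrable (fun z : ℝ => z ^ 2) (gaussianReal 0 1) :=
      (memLp_id_gaussianReal 2).integrable_sq
    exact this.comp_snd ν
  have hz1 : ∫ s : ℝ × ℝ, s.2 ^ 2 ∂π = 1 := by
    rw [hπ, integral_fun_snd (fun z : ℝ => z ^ 2), integral_sq_gaussian]; simp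
  simp only [stateAverage]
  rw [hI, hI, ← integral_sub (hint _) (hint _)]
  have hpt : ∀ s : ℝ × ℝ, |(g (s.1 + β * √q * s.2) (β ^ 2 * v) +
      g (s.1 - β * √q * s.2) (β ^ 2 * v)) / 2 - (g (s.1 + β * √q' * s.2) (β ^ 2 * v) +
      g (s.1 - β * √q' * s.2) (β ^ 2 * v)) / 2| ≤ 26 * β ^ 2 * |q - q'| * s.2 ^ 2 := fun s => by
    have h1 := abs_symmetrized_sub_le (fun a => hg' a (β ^ 2 * v)) (fun a a' => hL a a' _)
      (by norm_num) s.1 s.2 (s := β * √q) (s' := β * √q') (by positivity) (by positivity)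
    rw [← sub_div, abs_div, abs_two, div_le_iff₀ two_pos]
    refine h1.trans ?_
    have h2 : |(β * √q) ^ 2 - (β * √q') ^ 2| ≤ β ^ 2 * |q - q'| := by
      rw [mul_pow, mul_pow, ← mul_sub, abs_mul, abs_of_nonneg (sq_nonneg β)]
      refine mul_le_mul_of_nonneg_left ?_ (sq_nonneg β)
      -- `√q` is zero for negative `q`, so the bound holds on the whole line and the contraction
      -- argument needs no sign constraint on `q`.
      have e : ∀ q : ℝ, √q ^ 2 = max q 0 := fun q => by
        rcases le_total 0 q with h | h
        · rw [Real.sq_sqrt h, max_eq_left h]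
        · rw [Real.sqrt_eq_zero_of_nonpos h, max_eq_right h]; norm_num
      rw [e, e]
      exact abs_max_sub_max_le_abs q q' 0
    have := mul_le_mul_of_nonneg_left h2 (show 0 ≤ 2 * 26 * s.2 ^ 2 by positivity)
    linarith
  refine (abs_integral_le_integral_abs).trans ((integral_mono ((hint _).sub (hint _)).abs
    (hz2.const_mul _) hpt).trans_eq ?_)
  rw [integral_const_mul, hz1, mul_one]

/-- The constants `26 β²` and `3 β²` add up to at most `29 / 100`; this is the origin of the
threshold `1 / 10`. -/
lemma TiltRegular.abs_stateAverage_sub_le {g : ℝ → ℝ → ℝ} (hg : TiltRegular g) (ν : Measure ℝ)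
    [IsProbabilityMeasure ν] {β : ℝ} (hβ : 0 ≤ β) (hβ' : β ≤ 1 / 10) (w w' : ℝ × ℝ) :
    |stateAverage g ν β w - stateAverage g ν β w'| ≤ 1 / 2 * dist w w' := by
  obtain ⟨q, v⟩ := w
  obtain ⟨q', v'⟩ := w'
  have h1 := hg.abs_stateAverage_sub_le_fst ν hβ q q' v
  have h2 := hg.abs_stateAverage_sub_le_snd ν β q' v v'
  have h3 := _root_.abs_sub_le (stateAverage g ν β (q, v)) (stateAverage g ν β (q', v))
    (stateAverage g ν β (q', v'))
  have h4 : |q - q'| ≤ dist (q, v) (q', v') := le_max_left (dist q q') (dist v v')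
  have h5 : |v - v'| ≤ dist (q, v) (q', v') := le_max_right (dist q q') (dist v v')
  have h6 : β ^ 2 ≤ 1 / 100 := by nlinarith
  have h7 : β ^ 2 * |q - q'| ≤ 1 / 100 * dist (q, v) (q', v') := by gcongr
  have h8 : β ^ 2 * |v - v'| ≤ 1 / 100 * dist (q, v) (q', v') := by gcongr
  have h9 : 0 ≤ dist (q, v) (q', v') := dist_nonneg
  linarith

/-- The right-hand side of the fixed point system. -/
noncomputable def stateMap (μ ν : Measure ℝ) (β : ℝ) (w : ℝ × ℝ) : ℝ × ℝ :=
  (stateAverage (fun a b => alpha' μ a b ^ 2) ν β w, stateAverage (alpha'' μ) ν β w)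

lemma isFixedPoint_iff {ν : Measure ℝ} {β : ℝ} {w : ℝ × ℝ} :
    IsFixedPoint μ ν β w ↔ stateMap μ ν β w = w := by
  rw [Prod.ext_iff]
  exact ⟨fun h => ⟨h.1.symm, h.2.symm⟩, fun h => ⟨h.1.symm, h.2.symm⟩⟩

lemma dist_stateMap_le (hμ : UnitCarried μ) (ν : Measure ℝ) [IsProbabilityMeasure ν] {β : ℝ}
    (hβ : 0 ≤ β) (hβ' : β ≤ 1 / 10) (w w' : ℝ × ℝ) :
    dist (stateMap μ ν β w) (stateMap μ ν β w') ≤ 1 / 2 * dist w w' :=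
  max_le ((tiltRegular_alpha'_sq hμ).abs_stateAverage_sub_le ν hβ hβ' w w')
    ((tiltRegular_alpha'' hμ).abs_stateAverage_sub_le ν hβ hβ' w w')

lemma existsUnique_isFixedPoint (hμ : UnitCarried μ) (ν : Measure ℝ) [IsProbabilityMeasure ν]
    {β : ℝ} (hβ : 0 ≤ β) (hβ' : β ≤ 1 / 10) : ∃! w, IsFixedPoint μ ν β w := by
  have hc : ContractingWith (1 / 2) (stateMap μ ν β) := by
    refine ⟨by rw [div_lt_one two_pos]; exact one_lt_two, LipschitzWith.of_dist_le_mul fun w w' => ?_⟩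
    simpa using dist_stateMap_le hμ ν hβ hβ' w w'
  refine ⟨hc.fixedPoint, isFixedPoint_iff.2 hc.fixedPoint_isFixedPt, fun w hw => ?_⟩
  exact hc.fixedPoint_unique (isFixedPoint_iff.1 hw)

lemma isFixedPoint_fixedPoint (hμ : UnitCarried μ) (ν : Measure ℝ) [IsProbabilityMeasure ν]
    {β : ℝ} (hβ : 0 ≤ β) (hβ' : β ≤ 1 / 10) : IsFixedPoint μ ν β (fixedPoint μ ν β) := by
  have h : ∃ w, IsFixedPoint μ ν β w := (existsUnique_isFixedPoint hμ ν hβ hβ').exists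
  rw [fixedPoint, dif_pos h]
  exact h.choose_spec

lemma TiltRegular.stateAverage_map_sub_le {g : ℝ → ℝ → ℝ} (hg : TiltRegular g) {X : Type*}
    [MeasurableSpace X] (ρ : Measure X) [IsProbabilityMeasure ρ] {H H' : X → ℝ} (hH : Measurable H)
    (hH' : Measurable H') {δ : ℝ} (hδ : ∀ᵐ x ∂ρ, |H x - H' x| ≤ δ) (β : ℝ) (w : ℝ × ℝ) :
    |stateAverage g (ρ.map H) β w - stateAverage g (ρ.map H') β w| ≤ 6 * δ := by
  have hmap : ∀ H : X → ℝ, Measurable H → stateAverage g (ρ.map H) β w =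
      ∫ s, g (H s.1 + β * √w.1 * s.2) (β ^ 2 * w.2) ∂(ρ.prod (gaussianReal 0 1)) := fun H hH => by
    have e : (ρ.map H).prod (gaussianReal 0 1) =
        (ρ.prod (gaussianReal 0 1)).map (Prod.map H id) := by
      rw [← Measure.map_prod_map _ _ hH measurable_id, Measure.map_id]
    rw [stateAverage, e, integral_map (by fun_prop)
      (hg.integrable _ (by fun_prop) _).aestronglyMeasurable]
    rfl
  rw [hmap H hH, hmap H' hH']
  refine abs_integral_sub_le (hg.integrable _ (by fun_prop) _) (hg.integrable _ (by fun_prop) _) ?_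
  filter_upwards [Measure.quasiMeasurePreserving_fst.ae hδ] with s hs
  refine (hg.abs_sub_le _ _ _ _).trans ?_
  simp only [sub_self, abs_zero, add_sub_add_right_eq_sub]
  linarith

/-- The solution of the fixed point system is Lipschitz in the external field. -/
lemma dist_fixedPoint_map_le (hμ : UnitCarried μ) {X : Type*} [MeasurableSpace X] (ρ : Measure X)
    [IsProbabilityMeasure ρ] {H H' : X → ℝ} (hH : Measurable H) (hH' : Measurable H') {δ : ℝ}
    (hδ : ∀ᵐ x ∂ρ, |H x - H' x| ≤ δ) {β : ℝ} (hβ : 0 ≤ β) (hβ' : β ≤ 1 / 10) :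
    dist (fixedPoint μ (ρ.map H) β) (fixedPoint μ (ρ.map H') β) ≤ 12 * δ := by
  have i1 : IsProbabilityMeasure (ρ.map H) := Measure.isProbabilityMeasure_map hH.aemeasurable
  have i2 : IsProbabilityMeasure (ρ.map H') := Measure.isProbabilityMeasure_map hH'.aemeasurable
  have e1 := isFixedPoint_iff.1 (isFixedPoint_fixedPoint hμ (ρ.map H) hβ hβ')
  have e2 := isFixedPoint_iff.1 (isFixedPoint_fixedPoint hμ (ρ.map H') hβ hβ')
  set w := fixedPoint μ (ρ.map H) β
  set w' := fixedPoint μ (ρ.map H') β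
  have h1 := dist_stateMap_le hμ (ρ.map H) hβ hβ' w w'
  have h2 : dist (stateMap μ (ρ.map H) β w') (stateMap μ (ρ.map H') β w') ≤ 6 * δ :=
    max_le ((tiltRegular_alpha'_sq hμ).stateAverage_map_sub_le ρ hH hH' hδ β w')
      ((tiltRegular_alpha'' hμ).stateAverage_map_sub_le ρ hH hH' hδ β w')
  -- The change of field costs `6 δ` and the contraction half of the unknown distance, whence `12
  -- δ`.
  have h3 := dist_triangle (stateMap μ (ρ.map H) β w) (stateMap μ (ρ.map H) β w')
    (stateMap μ (ρ.map H') β w')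
  rw [e2] at h2 h3
  rw [e1] at h1 h3
  linarith

end Interference

/-! ### Stability of the algorithms in the parameter -/

namespace Interference

variable {μ : Measure ℝ} {d : ℕ}

lemma sum_sq_le_of_abs_le {n : ℕ} {f u : Fin n → ℝ} {a b C δ : ℝ}
    (hf : ∀ i, |f i| ≤ a * |u i| + b * δ) (hu : ∑ i, u i ^ 2 ≤ C * n * δ ^ 2) :
    ∑ i, f i ^ 2 ≤ (2 * a ^ 2 * C + 2 * b ^ 2) * n * δ ^ 2 := by
  have hpt : ∀ i, f i ^ 2 ≤ 2 * a ^ 2 * u i ^ 2 + 2 * b ^ 2 * δ ^ 2 := fun i => by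
    have h1 := pow_le_pow_left₀ (abs_nonneg _) (hf i) 2
    rw [sq_abs] at h1
    have h2 := sq_nonneg (a * |u i| - b * δ)
    have h3 := sq_abs (u i)
    nlinarith
  refine (Finset.sum_le_sum fun i _ => hpt i).trans ?_
  rw [Finset.sum_add_distrib, ← Finset.mul_sum]
  simp only [Finset.sum_const, Finset.card_univ, Fintype.card_fin, nsmul_eq_mul]
  have := mul_le_mul_of_nonneg_left hu (show 0 ≤ 2 * a ^ 2 by positivity)
  linarith

/-- Errors are measured in mean square: a matrix of norm at most `K` and a 2-Lipschitz function
enlarge them by a factor independent of `n`. -/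
lemma exists_meanField_stable (hμ : UnitCarried μ) (K : ℝ) (l : ℕ) :
    ∃ C, 0 ≤ C ∧ ∀ (n : ℕ) (A : Matrix (Fin n) (Fin n) ℝ) (h h' : Fin n → ℝ) (δ : ℝ),
      opNorm A ≤ K → (∀ i, |h i - h' i| ≤ δ) →
      ∑ i, (meanField μ A h l i - meanField μ A h' l i) ^ 2 ≤ C * n * δ ^ 2 := by
  induction l with
  | zero => exact ⟨0, le_rfl, fun n A h h' δ _ _ => by simp [meanField]⟩
  | succ l ih =>
    obtain ⟨C, hC, ih⟩ := ih
    refine ⟨2 * 2 ^ 2 * (K ^ 2 * C) + 2 * 2 ^ 2, by positivity, fun n A h h' δ hA hh => ?_⟩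
    refine sum_sq_le_of_abs_le
      (u := A *ᵥ (meanField μ A h l - meanField μ A h' l)) (fun i => ?_) ?_
    · refine (abs_alpha'_sub_le hμ _ _ _ _).trans ?_
      rw [sub_self, abs_zero, add_zero, mulVec_sub, Pi.sub_apply, add_sub_add_comm]
      have := abs_add_le ((A *ᵥ meanField μ A h l) i - (A *ᵥ meanField μ A h' l) i) (h i - h' i)
      linarith [hh i]
    · refine (sum_mulVec_sq_le hA _).trans ?_
      have := mul_le_mul_of_nonneg_left (ih n A h h' δ hA hh) (sq_nonneg K)
      simp only [Pi.sub_apply]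
      linarith

lemma sum_sq_tilt_sub_le {f : ℝ → ℝ → ℝ}
    (hf : ∀ a b a' b', |f a b - f a' b'| ≤ 6 * |a - a'| + 3 * |b - b'|) {β : ℝ} (hβ : 0 ≤ β)
    {n : ℕ} {u u' h h' : Fin n → ℝ} {v v' C δ : ℝ} (hh : ∀ i, |h i - h' i| ≤ δ)
    (hv : |v - v'| ≤ δ) (hu : ∑ i, (u i - u' i) ^ 2 ≤ C * n * δ ^ 2) :
    ∑ i, (f (β * u i + h i) (β ^ 2 * v) - f (β * u' i + h' i) (β ^ 2 * v')) ^ 2 ≤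
      (2 * (6 * β) ^ 2 * C + 2 * (6 + 3 * β ^ 2) ^ 2) * n * δ ^ 2 := by
  refine sum_sq_le_of_abs_le (fun i => (hf _ _ _ _).trans ?_) hu
  have h1 : |β * u i + h i - (β * u' i + h' i)| ≤ β * |u i - u' i| + δ := by
    rw [add_sub_add_comm, ← mul_sub]
    refine (abs_add_le _ _).trans ?_
    rw [abs_mul, abs_of_nonneg hβ]
    linarith [hh i]
  have h2 : |β ^ 2 * v - β ^ 2 * v'| ≤ β ^ 2 * δ := by
    rw [← mul_sub, abs_mul, abs_of_nonneg (sq_nonneg β)]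
    exact mul_le_mul_of_nonneg_left hv (sq_nonneg β)
  linarith

lemma abs_alpha'_sub_le' (hμ : UnitCarried μ) (a b a' b' : ℝ) :
    |alpha' μ a b - alpha' μ a' b'| ≤ 6 * |a - a'| + 3 * |b - b'| := by
  have := abs_alpha'_sub_le hμ a b a' b'
  linarith [abs_nonneg (a - a'), abs_nonneg (b - b')]

/-- The AMP iterates depend continuously on the external field and the state evolution constants,
uniformly in the dimension. -/
theorem exists_amp_stable (hμ : UnitCarried μ) {β : ℝ} (hβ : 0 ≤ β) (K : ℝ) : ∀ k : ℕ,
    ∃ C, 0 ≤ C ∧ ∀ (n : ℕ) (G : Matrix (Fin n) (Fin n) ℝ) (h h' : Fin n → ℝ) (w w' : ℝ × ℝ)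
      (δ : ℝ), opNorm G ≤ K → (∀ i, |h i - h' i| ≤ δ) → |√w.1 - √w'.1| ≤ δ → |w.2 - w'.2| ≤ δ →
      ∑ i, (amp μ β G h w k i - amp μ β G h' w' k i) ^ 2 ≤ C * n * δ ^ 2
  | 0 => ⟨0, le_rfl, fun n G h h' w w' δ _ _ _ _ => by simp [amp]⟩
  | 1 => ⟨0, le_rfl, fun n G h h' w w' δ _ _ _ _ => by simp [amp]⟩
  | 2 => by
    refine ⟨K ^ 2, sq_nonneg K, fun n G h h' w w' δ hG _ hq _ => ?_⟩
    have e : ∀ i, amp μ β G h w 2 i - amp μ β G h' w' 2 i =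
        (G *ᵥ fun _ => √w.1 - √w'.1) i := fun i => by
      simp only [amp, mulVec, dotProduct, mul_sub, Finset.sum_sub_distrib]
    simp only [e]
    refine (sum_mulVec_sq_le hG _).trans ?_
    have h1 : (√w.1 - √w'.1) ^ 2 ≤ δ ^ 2 := by
      rw [← sq_abs]; exact pow_le_pow_left₀ (abs_nonneg _) hq 2
    simp only [Finset.sum_const, Finset.card_univ, Fintype.card_fin, nsmul_eq_mul]
    rw [mul_assoc]
    gcongr
  | k + 3 => by
    obtain ⟨C₂, hC₂, h₂⟩ := exists_amp_stable hμ hβ K (k + 2)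
    obtain ⟨C₁, hC₁, h₁⟩ := exists_amp_stable hμ hβ K (k + 1)
    set E₂ := 2 * (6 * β) ^ 2 * C₂ + 2 * (6 + 3 * β ^ 2) ^ 2 with hE₂
    set E₁ := 2 * (6 * β) ^ 2 * C₁ + 2 * (6 + 3 * β ^ 2) ^ 2 with hE₁
    refine ⟨3 * K ^ 2 * E₂ + 12 * β ^ 2 * E₁ + 3 * β ^ 2 * E₂, by positivity,
      fun n G h h' w w' δ hG hh hq hv => ?_⟩
    rcases Nat.eq_zero_or_pos n with rfl | hn
    · simp
    have hn' : (0 : ℝ) < n := Nat.cast_pos.2 hn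
    set v : Fin n → ℝ := fun i => alpha' μ (β * amp μ β G h w (k + 2) i + h i) (β ^ 2 * w.2)
    set v' : Fin n → ℝ := fun i => alpha' μ (β * amp μ β G h' w' (k + 2) i + h' i) (β ^ 2 * w'.2)
    set s : Fin n → ℝ := fun i => alpha' μ (β * amp μ β G h w (k + 1) i + h i) (β ^ 2 * w.2)
    set s' : Fin n → ℝ := fun i => alpha' μ (β * amp μ β G h' w' (k + 1) i + h' i) (β ^ 2 * w'.2)
    set a : Fin n → ℝ := fun i => alpha'' μ (β * amp μ β G h w (k + 2) i + h i) (β ^ 2 * w.2)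
    set a' : Fin n → ℝ := fun i => alpha'' μ (β * amp μ β G h' w' (k + 2) i + h' i) (β ^ 2 * w'.2)
    have hv1 : ∑ i, (v i - v' i) ^ 2 ≤ E₂ * n * δ ^ 2 :=
      sum_sq_tilt_sub_le (abs_alpha'_sub_le' hμ) hβ hh hv (h₂ n G h h' w w' δ hG hh hq hv)
    have hs1 : ∑ i, (s i - s' i) ^ 2 ≤ E₁ * n * δ ^ 2 :=
      sum_sq_tilt_sub_le (abs_alpha'_sub_le' hμ) hβ hh hv (h₁ n G h h' w w' δ hG hh hq hv)
    have ha1 : ∑ i, (a i - a' i) ^ 2 ≤ E₂ * n * δ ^ 2 :=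
      sum_sq_tilt_sub_le (abs_alpha''_sub_le hμ) hβ hh hv (h₂ n G h h' w w' δ hG hh hq hv)
    set D := β / n * ∑ j, a j
    set D' := β / n * ∑ j, a' j
    -- The Onsager coefficient is an average of values of `α''`, hence bounded, and by
    -- Cauchy–Schwarz it varies no more than the mean square error of the iterates.
    have hD : D ^ 2 ≤ 4 * β ^ 2 := by
      have h1 : |∑ j, a j| ≤ n * 2 := (Finset.abs_sum_le_sum_abs _ _).trans
        ((Finset.sum_le_sum fun j _ => abs_alpha''_le_two hμ _ _).trans (by simp))
      have h2 : |D| ≤ β * 2 := by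
        rw [abs_mul, abs_of_nonneg (by positivity)]
        calc β / n * |∑ j, a j| ≤ β / n * (n * 2) := by gcongr
          _ = β * 2 := by field_simp
      rw [← sq_abs]
      calc |D| ^ 2 ≤ (β * 2) ^ 2 := pow_le_pow_left₀ (abs_nonneg _) h2 2
        _ = _ := by ring
    have hDD : (D - D') ^ 2 ≤ β ^ 2 * E₂ * δ ^ 2 := by
      have h1 : (∑ j, (a j - a' j)) ^ 2 ≤ n * ∑ j, (a j - a' j) ^ 2 := by
        simpa using sq_sum_le_card_mul_sum_sq (s := Finset.univ) (f := fun j => a j - a' j)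
      have h2 : D - D' = β / n * ∑ j, (a j - a' j) := by
        rw [Finset.sum_sub_distrib, mul_sub]
      rw [h2, mul_pow]
      calc (β / n) ^ 2 * (∑ j, (a j - a' j)) ^ 2 ≤ (β / n) ^ 2 * (n * (E₂ * n * δ ^ 2)) :=
          mul_le_mul_of_nonneg_left (h1.trans (mul_le_mul_of_nonneg_left ha1 hn'.le)) (sq_nonneg _)
        _ = _ := by field_simp
    have hpt : ∀ i, (amp μ β G h w (k + 3) i - amp μ β G h' w' (k + 3) i) ^ 2 ≤
        3 * (G *ᵥ (v - v')) i ^ 2 + 3 * (4 * β ^ 2) * (s i - s' i) ^ 2 +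
          3 * (β ^ 2 * E₂ * δ ^ 2) := fun i => by
      -- The Onsager product is split so that each piece has one bounded factor and one small
      -- factor. The constants 3 come from the square of a sum of three terms.
      have e : amp μ β G h w (k + 3) i - amp μ β G h' w' (k + 3) i =
          (G *ᵥ (v - v')) i - D * (s i - s' i) - (D - D') * s' i := by
        have e1 : amp μ β G h w (k + 3) i = (G *ᵥ v) i - D * s i := rfl
        have e2 : amp μ β G h' w' (k + 3) i = (G *ᵥ v') i - D' * s' i := rfl
        rw [e1, e2, mulVec_sub, Pi.sub_apply]; ring
      have hs' : s' i ^ 2 ≤ 1 := by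
        rw [← sq_abs]; exact pow_le_one₀ (abs_nonneg _) (abs_alpha'_le_one hμ _ _)
      have e3 : ((D - D') * s' i) ^ 2 ≤ β ^ 2 * E₂ * δ ^ 2 := by
        rw [mul_pow]
        exact (mul_le_of_le_one_right (sq_nonneg _) hs').trans hDD
      have e4 : (D * (s i - s' i)) ^ 2 ≤ 4 * β ^ 2 * (s i - s' i) ^ 2 := by
        rw [mul_pow]; gcongr
      rw [e]
      generalize (G *ᵥ (v - v')) i = x at *
      generalize D * (s i - s' i) = y at *
      generalize (D - D') * s' i = z at *
      nlinarith [sq_nonneg (x + y), sq_nonneg (x + z), sq_nonneg (y - z)]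
    refine (Finset.sum_le_sum fun i _ => hpt i).trans ?_
    rw [Finset.sum_add_distrib, Finset.sum_add_distrib, ← Finset.mul_sum, ← Finset.mul_sum]
    simp only [Finset.sum_const, Finset.card_univ, Fintype.card_fin, nsmul_eq_mul]
    have g1 := sum_mulVec_sq_le hG (v - v')
    simp only [Pi.sub_apply] at g1
    have g2 := mul_le_mul_of_nonneg_left hv1 (sq_nonneg K)
    have g3 := mul_le_mul_of_nonneg_left hs1 (show 0 ≤ 3 * (4 * β ^ 2) by positivity)
    linarith

/-! ### Stability of the effect estimates -/

lemma abs_sum_mul_sub_le {n : ℕ} {e m m' : Fin n → ℝ} {C δ : ℝ} (hC : 0 ≤ C) (hδ : 0 ≤ δ)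
    (he : ∀ i, |e i| ≤ 1) (hm : ∑ i, (m i - m' i) ^ 2 ≤ C * n * δ ^ 2) :
    |1 / (n : ℝ) * (∑ i, e i * m i - ∑ i, e i * m' i)| ≤ √C * δ := by
  rcases Nat.eq_zero_or_pos n with rfl | hn
  · simp; positivity
  have hn' : (0 : ℝ) < n := Nat.cast_pos.2 hn
  have h1 : (∑ i, e i * (m i - m' i)) ^ 2 ≤ (n * (√C * δ)) ^ 2 := by
    calc (∑ i, e i * (m i - m' i)) ^ 2 ≤ (∑ i, e i ^ 2) * ∑ i, (m i - m' i) ^ 2 :=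
          Finset.sum_mul_sq_le_sq_mul_sq _ _ _
      _ ≤ (∑ _i : Fin n, 1) * (C * n * δ ^ 2) := by
          gcongr with i
          rw [← sq_abs]; exact pow_le_one₀ (abs_nonneg _) (he i)
      _ = (n * (√C * δ)) ^ 2 := by
          rw [mul_pow, mul_pow, Real.sq_sqrt hC]; simp; ring
  have h2 := abs_le_of_sq_le_sq h1 (by positivity)
  rw [← Finset.sum_sub_distrib, abs_mul, abs_of_nonneg (by positivity), one_div,
    inv_mul_le_iff₀ hn']
  simpa only [mul_sub] using h2

lemma abs_directEffect_sub_le {n : ℕ} (t : Treatments n) {m m' : Fin n → ℝ} {C δ : ℝ} (hC : 0 ≤ C)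
    (hδ : 0 ≤ δ) (hm : ∑ i, (m i - m' i) ^ 2 ≤ C * n * δ ^ 2) :
    |directEffect t m - directEffect t m'| ≤ 2 * √C * δ := by
  have h := abs_sum_mul_sub_le hC hδ (fun i => (abs_spin (t i)).le) hm
  have e : directEffect t m - directEffect t m' =
      2 * (1 / (n : ℝ) * (∑ i, spin (t i) * m i - ∑ i, spin (t i) * m' i)) := by
    simp only [directEffect]; ring
  rw [e, abs_mul, abs_two]
  linarith

lemma abs_indirectEffect_sub_le {n : ℕ} (t : Treatments n) {m m' c c' : Fin n → ℝ} {C δ : ℝ}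
    (hC : 0 ≤ C) (hδ : 0 ≤ δ) (hm : ∑ i, (m i - m' i) ^ 2 ≤ C * n * δ ^ 2)
    (hc : ∑ i, (c i - c' i) ^ 2 ≤ C * n * δ ^ 2) :
    |indirectEffect t m c - indirectEffect t m' c'| ≤ 3 * √C * δ := by
  have h0 := abs_directEffect_sub_le t hC hδ hm
  have h1 := abs_sum_mul_sub_le (e := fun _ => 1) hC hδ (by simp) hm
  have h2 := abs_sum_mul_sub_le (e := fun _ => 1) hC hδ (by simp) hc
  simp only [one_mul] at h1 h2
  have e : indirectEffect t m c - indirectEffect t m' c' =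
      1 / (n : ℝ) * (∑ i, m i - ∑ i, m' i) - 1 / (n : ℝ) * (∑ i, c i - ∑ i, c' i) -
        1 / 2 * (directEffect t m - directEffect t m') := by
    simp only [indirectEffect]; ring
  rw [e]
  rw [abs_le] at *
  constructor <;> linarith

/-- An estimate depends continuously on the parameter at `p₀`, uniformly over bounded interactions
and bounded covariates. -/
def UniformlyStable (p₀ : Param d)
    (effect : ∀ n : ℕ, Matrix (Fin n) (Fin n) ℝ → Auxiliary n d → Param d → ℝ) : Prop :=
  ∀ K ε : ℝ, 0 < ε → ∃ r > 0, ∀ (n : ℕ) (A : Matrix (Fin n) (Fin n) ℝ) (a : Auxiliary n d)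
    (p : Param d), opNorm A ≤ K → (∀ i k, a.2 i k ∈ Set.Icc (-1 : ℝ) 1) → ‖p - p₀‖ ≤ r →
    |effect n A a p₀ - effect n A a p| ≤ ε

/-- The modulus is linear for the mean-field algorithm but of square root type for AMP, where `√q`
enters. -/
lemma uniformlyStable_of_modulus {p₀ : Param d}
    {effect : ∀ n : ℕ, Matrix (Fin n) (Fin n) ℝ → Auxiliary n d → Param d → ℝ} {ω : ℝ → ℝ}
    (hω : Tendsto ω (𝓝 0) (𝓝 0))
    (h : ∀ K : ℝ, ∃ C, 0 ≤ C ∧ ∀ (n : ℕ) (A : Matrix (Fin n) (Fin n) ℝ) (a : Auxiliary n d)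
      (p : Param d), opNorm A ≤ K → (∀ i k, a.2 i k ∈ Set.Icc (-1 : ℝ) 1) →
      |effect n A a p₀ - effect n A a p| ≤ C * ω ‖p - p₀‖) : UniformlyStable p₀ effect := by
  intro K ε hε
  obtain ⟨C, hC, hb⟩ := h K
  have h1 : Tendsto (fun s => C * ω s) (𝓝 0) (𝓝 0) := by simpa using hω.const_mul C
  obtain ⟨r, hr, hr'⟩ := Metric.eventually_nhds_iff.1 (h1.eventually_lt_const hε)
  refine ⟨r / 2, by positivity, fun n A a p hA ha hp => (hb n A a p hA ha).trans (hr' ?_).le⟩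
  rw [dist_zero_right, norm_norm]
  linarith

lemma abs_field_sub_le {n : ℕ} (p p₀ : Param d) (t : Treatments n) {x : Covariates n d}
    (hx : ∀ i k, x i k ∈ Set.Icc (-1 : ℝ) 1) (i : Fin n) :
    |field p₀ t x i - field p t x i| ≤ (1 + d) * ‖p - p₀‖ := by
  rw [abs_sub_comm, ← field_sub]
  exact abs_field_le _ t (fun i k => abs_le.2 (hx i k)) i

lemma abs_control_sub_le (p p₀ : Param d) {x : Fin d → ℝ}
    (hx : ∀ k, x k ∈ Set.Icc (-1 : ℝ) 1) :
    |(-p₀.1 + x ⬝ᵥ p₀.2) - (-p.1 + x ⬝ᵥ p.2)| ≤ (1 + d) * ‖p - p₀‖ := by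
  -- The control field is the field of a single untreated unit.
  have h := abs_field_sub_le (n := 1) p p₀ (fun _ => false) (x := fun _ => x) (fun _ => hx) 0
  simpa [field, spin] using h

lemma abs_fieldLaw_sub_le (p p₀ : Param d) (b : Bool) {x : Fin d → ℝ}
    (hx : ∀ k, x k ∈ Set.Icc (-1 : ℝ) 1) :
    |(p₀.1 * spin b + x ⬝ᵥ p₀.2) - (p.1 * spin b + x ⬝ᵥ p.2)| ≤ (1 + d) * ‖p - p₀‖ :=
  abs_field_sub_le (n := 1) p p₀ (fun _ => b) (x := fun _ => x) (fun _ => hx) 0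

lemma uniformlyStable_meanFieldDE (hμ : UnitCarried μ) (p₀ : Param d) (M : ℕ) :
    UniformlyStable p₀ fun _ B a p => meanFieldDE μ B M a p := by
  refine uniformlyStable_of_modulus tendsto_id fun K => ?_
  obtain ⟨C, hC, h⟩ := exists_meanField_stable hμ K M
  refine ⟨2 * √C * (1 + d), by positivity, fun n A a p hA ha => ?_⟩
  refine (abs_directEffect_sub_le a.1 hC (δ := (1 + d) * ‖p - p₀‖) (by positivity)
    (h n A _ _ _ hA (abs_field_sub_le p p₀ a.1 ha))).trans_eq ?_
  simp only [id]; ring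

lemma uniformlyStable_meanFieldIE (hμ : UnitCarried μ) (p₀ : Param d) (M : ℕ) :
    UniformlyStable p₀ fun _ B a p => meanFieldIE μ B M a p := by
  refine uniformlyStable_of_modulus tendsto_id fun K => ?_
  obtain ⟨C, hC, h⟩ := exists_meanField_stable hμ K M
  refine ⟨3 * √C * (1 + d), by positivity, fun n A a p hA ha => ?_⟩
  refine (abs_indirectEffect_sub_le a.1 hC (δ := (1 + d) * ‖p - p₀‖) (by positivity)
    (h n A _ _ _ hA (abs_field_sub_le p p₀ a.1 ha))
    (h n A _ _ _ hA fun i => abs_control_sub_le p p₀ (ha i))).trans_eq ?_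
  simp only [id]; ring

lemma opNorm_smul {n : ℕ} (c : ℝ) (A : Matrix (Fin n) (Fin n) ℝ) :
    opNorm (c • A) = |c| * opNorm A := by
  rw [opNorm, map_smul, norm_smul, Real.norm_eq_abs, opNorm]

lemma sqrt_le_sqrt_add_sqrt_abs_sub (x y : ℝ) : √x ≤ √y + √|x - y| := by
  refine Real.sqrt_le_iff.2 ⟨by positivity, ?_⟩
  have h1 : y ≤ √y ^ 2 := by
    rcases le_total 0 y with h | h
    · rw [Real.sq_sqrt h]
    · exact h.trans (sq_nonneg _)
  have h2 := Real.sq_sqrt (abs_nonneg (x - y))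
  have h3 := le_abs_self (x - y)
  have h4 : 0 ≤ √y * √|x - y| := by positivity
  nlinarith

lemma abs_sqrt_sub_sqrt_le (x y : ℝ) : |√x - √y| ≤ √|x - y| := by
  have h1 := sqrt_le_sqrt_add_sqrt_abs_sub x y
  have h2 := sqrt_le_sqrt_add_sqrt_abs_sub y x
  rw [abs_sub_comm y x] at h2
  exact abs_le.2 ⟨by linarith, by linarith⟩

/-- The solution moves by at most `12 ρ`, but `√q` possibly by `√(12 ρ)`, as `q` may be close to
zero. The sum of the two dominates every perturbation in `exists_amp_stable`. -/
lemma exists_ampMean_stable (hμ : UnitCarried μ) {β : ℝ} (hβ : 0 ≤ β) (K : ℝ) (M : ℕ) :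
    ∃ C, 0 ≤ C ∧ ∀ (n : ℕ) (A : Matrix (Fin n) (Fin n) ℝ) (h h' : Fin n → ℝ) (w w' : ℝ × ℝ)
      (ρ : ℝ), opNorm A ≤ K → (∀ i, |h i - h' i| ≤ ρ) → dist w w' ≤ 12 * ρ →
      ∑ i, (ampMean μ β (β⁻¹ • A) h w M i - ampMean μ β (β⁻¹ • A) h' w' M i) ^ 2 ≤
        C * n * (12 * ρ + √(12 * ρ)) ^ 2 := by
  obtain ⟨C, hC, h⟩ := exists_amp_stable hμ hβ (|β⁻¹| * K) M
  refine ⟨2 * (6 * β) ^ 2 * C + 2 * (6 + 3 * β ^ 2) ^ 2, by positivity,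
    fun n A u u' w w' ρ hA hu hw => ?_⟩
  have hρ : 0 ≤ 12 * ρ := dist_nonneg.trans hw
  have hs := Real.sqrt_nonneg (12 * ρ)
  have h1 : |w.1 - w'.1| ≤ 12 * ρ := (le_max_left _ _).trans hw
  have h2 : |w.2 - w'.2| ≤ 12 * ρ := (le_max_right _ _).trans hw
  have h3 : |√w.1 - √w'.1| ≤ √(12 * ρ) :=
    (abs_sqrt_sub_sqrt_le _ _).trans (Real.sqrt_le_sqrt h1)
  have hu' : ∀ i, |u i - u' i| ≤ 12 * ρ + √(12 * ρ) := fun i => by linarith [hu i]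
  refine sum_sq_tilt_sub_le (abs_alpha'_sub_le' hμ) hβ hu' (by linarith)
    (h n _ u u' w w' _ ?_ hu' (by linarith) (by linarith))
  rw [opNorm_smul]
  exact mul_le_mul_of_nonneg_left hA (abs_nonneg _)

lemma measurable_fieldLaw (p : Param d) :
    Measurable fun w : Bool × (Fin d → ℝ) => p.1 * spin w.1 + w.2 ⬝ᵥ p.2 := by
  have := measurable_spin
  unfold dotProduct
  fun_prop

lemma measurable_controlFieldLaw (p : Param d) :
    Measurable fun x : Fin d → ℝ => -p.1 + x ⬝ᵥ p.2 := by
  unfold dotProduct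
  fun_prop

lemma dist_fixedPoint_fieldLaw_le (hμ : UnitCarried μ) (PX : Measure (Fin d → ℝ))
    [IsProbabilityMeasure PX] (hPX : ∀ᵐ x ∂PX, ∀ k, x k ∈ Set.Icc (-1 : ℝ) 1) {β : ℝ} (hβ : 0 ≤ β)
    (hβ' : β ≤ 1 / 10) (p₀ p : Param d) :
    dist (fixedPoint μ (fieldLaw PX p₀) β) (fixedPoint μ (fieldLaw PX p) β) ≤
      12 * ((1 + d) * ‖p - p₀‖) := by
  have : IsProbabilityMeasure (uniformOn (Set.univ : Set Bool)) :=
    isProbabilityMeasure_uniformOn Set.finite_univ Set.univ_nonempty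
  refine dist_fixedPoint_map_le hμ _ (measurable_fieldLaw p₀) (measurable_fieldLaw p) ?_ hβ hβ'
  filter_upwards [Measure.quasiMeasurePreserving_snd.ae hPX] with w hw
  exact abs_fieldLaw_sub_le p p₀ w.1 hw

lemma dist_fixedPoint_controlFieldLaw_le (hμ : UnitCarried μ) (PX : Measure (Fin d → ℝ))
    [IsProbabilityMeasure PX] (hPX : ∀ᵐ x ∂PX, ∀ k, x k ∈ Set.Icc (-1 : ℝ) 1) {β : ℝ} (hβ : 0 ≤ β)
    (hβ' : β ≤ 1 / 10) (p₀ p : Param d) :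
    dist (fixedPoint μ (controlFieldLaw PX p₀) β) (fixedPoint μ (controlFieldLaw PX p) β) ≤
      12 * ((1 + d) * ‖p - p₀‖) := by
  refine dist_fixedPoint_map_le hμ _ (measurable_controlFieldLaw p₀)
    (measurable_controlFieldLaw p) ?_ hβ hβ'
  filter_upwards [hPX] with x hx
  exact abs_control_sub_le p p₀ hx

lemma tendsto_amp_modulus (c : ℝ) :
    Tendsto (fun s : ℝ => 12 * (c * s) + √(12 * (c * s))) (𝓝 0) (𝓝 0) := by
  have : Continuous fun s : ℝ => 12 * (c * s) + √(12 * (c * s)) := by fun_prop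
  simpa using this.tendsto 0

lemma uniformlyStable_ampDE (hμ : UnitCarried μ) (PX : Measure (Fin d → ℝ))
    [IsProbabilityMeasure PX] (hPX : ∀ᵐ x ∂PX, ∀ k, x k ∈ Set.Icc (-1 : ℝ) 1) {β : ℝ} (hβ : 0 ≤ β)
    (hβ' : β ≤ 1 / 10) (p₀ : Param d) (M : ℕ) :
    UniformlyStable p₀ fun _ B a p => ampDE μ PX β B M a p := by
  refine uniformlyStable_of_modulus (tendsto_amp_modulus (1 + d)) fun K => ?_
  obtain ⟨C, hC, h⟩ := exists_ampMean_stable hμ hβ K M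
  refine ⟨2 * √C, by positivity, fun n A a p hA ha => ?_⟩
  exact abs_directEffect_sub_le a.1 hC (by positivity)
    (h n A _ _ _ _ _ hA (abs_field_sub_le p p₀ a.1 ha)
      (dist_fixedPoint_fieldLaw_le hμ PX hPX hβ hβ' p₀ p))

lemma uniformlyStable_ampIE (hμ : UnitCarried μ) (PX : Measure (Fin d → ℝ))
    [IsProbabilityMeasure PX] (hPX : ∀ᵐ x ∂PX, ∀ k, x k ∈ Set.Icc (-1 : ℝ) 1) {β : ℝ} (hβ : 0 ≤ β)
    (hβ' : β ≤ 1 / 10) (p₀ : Param d) (M : ℕ) :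
    UniformlyStable p₀ fun _ B a p => ampIE μ PX β B M a p := by
  refine uniformlyStable_of_modulus (tendsto_amp_modulus (1 + d)) fun K => ?_
  obtain ⟨C, hC, h⟩ := exists_ampMean_stable hμ hβ K M
  refine ⟨3 * √C, by positivity, fun n A a p hA ha => ?_⟩
  exact abs_indirectEffect_sub_le a.1 hC (by positivity)
    (h n A _ _ _ _ _ hA (abs_field_sub_le p p₀ a.1 ha)
      (dist_fixedPoint_fieldLaw_le hμ PX hPX hβ hβ' p₀ p))
    (h n A _ _ _ _ _ hA (fun i => abs_control_sub_le p p₀ (ha i))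
      (dist_fixedPoint_controlFieldLaw_le hμ PX hPX hβ hβ' p₀ p))

end Interference

/-! ### Deviation bounds -/

namespace Interference

open scoped ENNReal

/-- Chebyshev's inequality as a pointwise comparison, so measurability of the deviation event plays
no role. -/
lemma lintegral_mul_indicator_le {X : Type*} [MeasurableSpace X] {κ : Measure X} {f D : X → ℝ}
    (hf : ∀ x, 0 ≤ f x) {b : ℝ} (hb : 0 < b) (hi : Integrable (fun x => D x ^ 2 * f x) κ) :
    ∫⁻ x, ENNReal.ofReal (f x) * {x | b < |D x|}.indicator 1 x ∂κ ≤
      ENNReal.ofReal ((∫ x, D x ^ 2 * f x ∂κ) / b ^ 2) := by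
  rw [← integral_div, ofReal_integral_eq_lintegral_ofReal (hi.div_const _)
    (.of_forall fun x => by have := hf x; positivity)]
  refine lintegral_mono fun x => ?_
  by_cases hx : x ∈ {x | b < |D x|}
  · rw [Set.indicator_of_mem hx, Pi.one_apply, mul_one]
    refine ENNReal.ofReal_le_ofReal ?_
    rw [le_div_iff₀ (by positivity), mul_comm]
    refine mul_le_mul_of_nonneg_right ?_ (hf x)
    rw [← sq_abs (D x)]
    exact pow_le_pow_left₀ hb.le (le_of_lt hx) 2
  · rw [Set.indicator_of_notMem hx, mul_zero]; exact zero_le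

lemma lintegral_normalized_mul_indicator_le {X : Type*} [MeasurableSpace X] {κ : Measure X}
    {w D : X → ℝ} (hw : ∀ x, 0 ≤ w x) {b B : ℝ} (hb : 0 < b) (hB : 0 ≤ B)
    (hi : Integrable (fun x => D x ^ 2 * w x) κ)
    (h : ∫ x, D x ^ 2 * w x ∂κ ≤ B * ∫ x, w x ∂κ) :
    ∫⁻ x, ENNReal.ofReal (w x / ∫ x', w x' ∂κ) * {x | b < |D x|}.indicator 1 x ∂κ ≤
      ENNReal.ofReal (B / b ^ 2) := by
  have hZ0 : 0 ≤ ∫ x, w x ∂κ := integral_nonneg hw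
  set Z := ∫ x, w x ∂κ
  have hpt : ∀ x, D x ^ 2 * (w x / Z) = D x ^ 2 * w x / Z := fun x => by ring
  refine (lintegral_mul_indicator_le (f := fun x => w x / Z) (fun x => div_nonneg (hw x) hZ0) hb
    ((hi.div_const Z).congr (.of_forall fun x => (hpt x).symm))).trans
    (ENNReal.ofReal_le_ofReal ?_)
  rw [integral_congr_ae (.of_forall hpt), integral_div]
  exact div_le_div_of_nonneg_right (div_le_of_le_mul₀ hZ0 hB h) (by positivity)

/-- The bound on the probability of a deviation of size `η n`. -/
noncomputable def deviationBound (K η : ℝ) (n : ℕ) : ℝ := (4 * n + 8 * (n * (√n * K))) / (η * n) ^ 2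

/-- A second moment of order `n ^ (3/2)` against `n²` leaves a bound of order `n ^ (-1/2)`. -/
lemma tendsto_deviationBound (K : ℝ) {η : ℝ} (hη : 0 < η) :
    Tendsto (deviationBound K η) atTop (𝓝 0) := by
  have h1 : Tendsto (fun n : ℕ => (4 / η ^ 2) * (1 / (n : ℝ)) + (8 * K / η ^ 2) * √(1 / (n : ℝ)))
      atTop (𝓝 ((4 / η ^ 2) * 0 + (8 * K / η ^ 2) * √0)) := by
    have := tendsto_one_div_atTop_nhds_zero_nat (𝕜 := ℝ)
    exact (this.const_mul _).add (((Real.continuous_sqrt.tendsto 0).comp this).const_mul _)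
  simp only [mul_zero, Real.sqrt_zero, add_zero] at h1
  refine h1.congr' ?_
  filter_upwards [eventually_gt_atTop 0] with n hn
  have hn' : (0 : ℝ) < n := Nat.cast_pos.2 hn
  have hs : √(n : ℝ) ^ 2 = n := Real.sq_sqrt hn'.le
  have hs0 : 0 < √(n : ℝ) := Real.sqrt_pos.2 hn'
  rw [deviationBound, Real.sqrt_div zero_le_one, Real.sqrt_one]
  generalize √(n : ℝ) = s at *
  rw [← hs]
  field_simp

lemma lintegral_gibbs_deviation_le {S : Type*} [MeasurableSpace S] {ν : Measure S}
    [IsFiniteMeasure ν] {φ : S → ℝ} (hφm : Measurable φ) (hφ : ∀ s, |φ s| ≤ 1) (s₀ : S)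
    (hν : ν ≠ 0) {n : ℕ} (hn : 0 < n) {A : Matrix (Fin n) (Fin n) ℝ} (hA : A.IsSymm) {K : ℝ}
    (hK : opNorm A ≤ K) (h : Fin n → ℝ) {c : Fin n → ℝ} (hc : ∀ i, |c i| ≤ 1) {η : ℝ} (hη : 0 < η) :
    ∫⁻ t, ENNReal.ofReal (gibbsWeight A h (fun k => φ (t k)) /
        ∫ t', gibbsWeight A h (fun k => φ (t' k)) ∂(Measure.pi fun _ : Fin n => ν)) *
      {t : Fin n → S | η * n < |∑ i, c i * (φ (t i) -
        condMean (ν.map φ) A h (fun k => φ (t k)) i)|}.indicator 1 t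
        ∂(Measure.pi fun _ : Fin n => ν) ≤ ENNReal.ofReal (deviationBound K η n) := by
  have hn' : (0 : ℝ) < n := Nat.cast_pos.2 hn
  have hρ : UnitCarried (ν.map φ) := by
    refine ⟨inferInstance, (Measure.map_ne_zero_iff hφm.aemeasurable).2 hν, ?_⟩
    refine (ae_map_iff hφm.aemeasurable measurableSet_Icc).2 (.of_forall fun s => ?_)
    exact abs_le.1 (hφ s)
  have hvm : Measurable fun (t : Fin n → S) k => φ (t k) :=
    measurable_pi_lambda _ fun i => hφm.comp (measurable_pi_apply i)
  have hwi := integrable_gibbsWeight (ν := ν) hφm hφ A h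
  have h1 := integral_gibbs_sq_le hφm hφ s₀ hν hA h hc
  have h2 : 4 * n + 8 * ∑ i, ∑ j, |A i j| ≤ 4 * n + 8 * (n * (√n * K)) := by
    have := sum_abs_entry_le hK
    linarith
  have hZ0 : 0 ≤ ∫ t, gibbsWeight A h (fun k => φ (t k)) ∂(Measure.pi fun _ : Fin n => ν) :=
    integral_nonneg fun t => (Real.exp_pos _).le
  have h3 : 0 ≤ 4 * n + 8 * (n * (√n * K)) := le_trans (by positivity) h2
  have hb : 0 < η * n := by positivity
  have hw0 : ∀ t : Fin n → S, 0 ≤ gibbsWeight A h fun k => φ (t k) := fun t => (Real.exp_pos _).le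
  rw [deviationBound]
  refine lintegral_normalized_mul_indicator_le (κ := Measure.pi fun _ : Fin n => ν)
    (w := fun t => gibbsWeight A h fun k => φ (t k))
    (D := fun t => ∑ i, c i * (φ (t i) - condMean (ν.map φ) A h (fun k => φ (t k)) i))
    (b := η * n) (B := 4 * n + 8 * (n * (√n * K))) hw0 hb h3 ?_
    (h1.trans (mul_le_mul_of_nonneg_right h2 hZ0))
  refine hwi.bdd_mul (c := (n * 2) ^ 2) (Measurable.aestronglyMeasurable ?_)
    (.of_forall fun t => ?_)
  · exact (Finset.measurable_sum _ fun i _ => ((hφm.comp (measurable_pi_apply i)).sub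
      ((measurable_condMean hρ A h i).comp hvm)).const_mul _).pow_const 2
  · rw [norm_pow, Real.norm_eq_abs]
    refine pow_le_pow_left₀ (abs_nonneg _) ((Finset.abs_sum_le_sum_abs _ _).trans
      ((Finset.sum_le_sum (g := fun _ => 2) fun i _ => ?_).trans (by simp))) 2
    rw [abs_mul]
    refine (mul_le_of_le_one_left (abs_nonneg _) (hc i)).trans ((abs_sub _ _).trans ?_)
    have := abs_alpha'_le_one hρ (localField A h (fun k => φ (t k)) i) (A i i)
    have := hφ (t i)
    rw [condMean]
    linarith

/-! ### The conditional laws of treatments and outcomes -/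

variable {μ : Measure ℝ} {n d : ℕ}

lemma lintegral_outcomeDensity_deviation_le [IsFiniteMeasure μ] (hμ : UnitCarried μ) (hn : 0 < n)
    {A : Matrix (Fin n) (Fin n) ℝ} (hA : A.IsSymm) {K : ℝ} (hK : opNorm A ≤ K) (p : Param d)
    (x : Covariates n d) (t : Treatments n) {c : Fin n → ℝ} (hc : ∀ i, |c i| ≤ 1) {η : ℝ}
    (hη : 0 < η) :
    ∫⁻ y, ENNReal.ofReal (outcomeDensity μ A p x t y) *
      {y : Fin n → ℝ | η * n < |∑ i, c i * (y i -
        condMean μ A (field p t x) y i)|}.indicator 1 y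
        ∂(Measure.pi fun _ : Fin n => μ) ≤ ENNReal.ofReal (deviationBound K η n) := by
  have h := lintegral_gibbs_deviation_le measurable_clampUnit abs_clampUnit_le 0 hμ.ne_zero hn hA hK
    (field p t x) hc hη
  rw [hμ.map_clampUnit, integral_congr_ae (hμ.gibbsWeight_clamp A (field p t x))] at h
  refine le_trans (le_of_eq (lintegral_congr_ae ?_)) h
  filter_upwards [hμ.ae_pi_mem n] with y hy
  simp only [outcomeDensity, outcomeWeight_eq, Set.indicator, Set.mem_ofPred_eq,
    fun i => clampUnit_of_mem (hy i)]

lemma lintegral_outcomeDensity [IsFiniteMeasure μ] (hμ : UnitCarried μ)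
    (A : Matrix (Fin n) (Fin n) ℝ) (p : Param d) (x : Covariates n d) (t : Treatments n) :
    ∫⁻ y, ENNReal.ofReal (outcomeDensity μ A p x t y) ∂(Measure.pi fun _ : Fin n => μ) = 1 := by
  have hZ := hμ.integral_gibbsWeight_pos A (field p t x)
  simp only [outcomeDensity, outcomeWeight_eq]
  rw [← ofReal_integral_eq_lintegral_ofReal
    ((hμ.integrable_gibbsWeight A (field p t x)).div_const _)
    (.of_forall fun y => div_nonneg (Real.exp_pos _).le hZ.le), integral_div, div_self hZ.ne',
    ENNReal.ofReal_one]

lemma propensity_nonneg (W : Matrix (Fin n) (Fin n) ℝ) (γ : Fin d → ℝ) (x : Covariates n d)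
    (t : Treatments n) : 0 ≤ propensity W γ x t :=
  div_nonneg (Real.exp_pos _).le (Finset.sum_nonneg fun _ _ => (Real.exp_pos _).le)

lemma sum_propensity (W : Matrix (Fin n) (Fin n) ℝ) (γ : Fin d → ℝ) (x : Covariates n d) :
    ∑ t, ENNReal.ofReal (propensity W γ x t) = 1 := by
  rw [← ENNReal.ofReal_sum_of_nonneg fun t _ => propensity_nonneg W γ x t]
  have : 0 < ∑ t, propensityWeight W γ x t :=
    Finset.sum_pos (fun _ _ => Real.exp_pos _) Finset.univ_nonempty
  simp only [propensity]
  rw [← Finset.sum_div, div_self this.ne', ENNReal.ofReal_one]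

lemma pi_count_bool (n : ℕ) :
    (Measure.pi fun _ : Fin n => (Measure.count : Measure Bool)) = Measure.count := by
  refine Measure.ext_of_singleton fun t => ?_
  rw [Measure.pi_singleton, Measure.count_singleton]
  simp

lemma sum_propensity_deviation_le (hn : 0 < n) {W : Matrix (Fin n) (Fin n) ℝ} (hW : W.IsSymm)
    {K : ℝ} (hK : opNorm W ≤ K) (γ : Fin d → ℝ) (x : Covariates n d) {c : Fin n → ℝ}
    (hc : ∀ i, |c i| ≤ 1) {η : ℝ} (hη : 0 < η) :
    ∑ t, ENNReal.ofReal (propensity W γ x t) *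
      {t : Fin n → Bool | η * n < |∑ i, c i * (spin (t i) - condMean spinMeasure W
        (fun i => x i ⬝ᵥ γ) (fun i => spin (t i)) i)|}.indicator 1 t ≤
      ENNReal.ofReal (deviationBound K η n) := by
  have h := lintegral_gibbs_deviation_le (ν := (Measure.count : Measure Bool)) measurable_spin
    (fun b => (abs_spin b).le) true (NeZero.ne _) hn hW hK (fun i => x i ⬝ᵥ γ) hc hη
  rw [pi_count_bool, lintegral_count, tsum_fintype, integral_count] at h
  exact h

/-- Chebyshev bound for empirical second moments. -/
lemma covariate_deviation_le (PX : Measure (Fin d → ℝ)) [IsProbabilityMeasure PX]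
    (hPX : ∀ᵐ x ∂PX, ∀ k, x k ∈ Set.Icc (-1 : ℝ) 1) (hn : 0 < n) (k l : Fin d) {η : ℝ}
    (hη : 0 < η) :
    (Measure.pi fun _ : Fin n => PX) {x | η * n < |∑ i, (x i k * x i l - ∫ u, u k * u l ∂PX)|} ≤
      ENNReal.ofReal (deviationBound 0 η n) := by
  have hn' : (0 : ℝ) < n := Nat.cast_pos.2 hn
  set π := Measure.pi fun _ : Fin n => PX
  set f : (Fin d → ℝ) → ℝ := fun u => clampUnit (u k) * clampUnit (u l) with hf
  have hfm : Measurable f := (measurable_clampUnit.comp (measurable_pi_apply k)).mul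
    (measurable_clampUnit.comp (measurable_pi_apply l))
  have hfb : ∀ u, |f u| ≤ 1 := fun u => by
    rw [hf, abs_mul]
    exact mul_le_one₀ (abs_clampUnit_le _) (abs_nonneg _) (abs_clampUnit_le _)
  have hfi : Integrable f PX :=
    .of_bound (C := 1) hfm.aestronglyMeasurable (.of_forall fun u => hfb u)
  have hfe : ∀ᵐ u ∂PX, f u = u k * u l := by
    filter_upwards [hPX] with u hu
    simp only [hf, clampUnit_of_mem (hu k), clampUnit_of_mem (hu l)]
  set e := ∫ u, f u ∂PX with he
  have heb : |e| ≤ 1 := by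
    simpa using norm_integral_le_of_norm_le_const (μ := PX) (f := f) (C := 1) (.of_forall hfb)
  have hee : e = ∫ u, u k * u l ∂PX := integral_congr_ae hfe
  have hFm : ∀ i : Fin n, Measurable fun x : Fin n → Fin d → ℝ => f (x i) - e := fun i =>
    (hfm.comp (measurable_pi_apply i)).sub_const e
  have hFb : ∀ (i : Fin n) (x : Fin n → Fin d → ℝ), |f (x i) - e| ≤ 2 := fun i x =>
    (abs_sub _ _).trans (by linarith [hfb (x i)])
  -- For i.i.d. rows the weight is constant and a coordinate influences only its own term, so each
  -- `B i` is 2. This is the bound `deviationBound` with `K = 0`.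
  have hsq := integral_sum_sq_mul_le PX (n := n) (w := fun _ => 1) (fun _ => zero_le_one)
    (integrable_const _) (F := fun i x => f (x i) - e) hFm hFb
    (fun i x => by
      simp only [Function.update_self, mul_one]
      rw [integral_sub hfi (integrable_const _)]
      simp [he]) 0 (B := fun _ => 2)
    (fun i x => by
      rw [← Finset.sum_sub_distrib, Finset.sum_eq_single i]
      · simp only [Function.update_self, sub_sub_sub_cancel_right]
        exact (abs_sub _ _).trans (by linarith [hfb (x i), hfb 0])
      · intro j _ hj; simp [Function.update_of_ne hj]
      · simp)
  have hDm : Measurable fun x : Fin n → Fin d → ℝ => ∑ i, (f (x i) - e) :=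
    Finset.measurable_sum _ fun i _ => hFm i
  have hDi : Integrable (fun x : Fin n → Fin d → ℝ => (∑ i, (f (x i) - e)) ^ 2 * 1) π := by
    refine .of_bound (C := (n * 2) ^ 2) ((hDm.pow_const 2).mul_const 1).aestronglyMeasurable
      (.of_forall fun x => ?_)
    rw [mul_one, norm_pow, Real.norm_eq_abs]
    refine pow_le_pow_left₀ (abs_nonneg _) ((Finset.abs_sum_le_sum_abs _ _).trans
      ((Finset.sum_le_sum fun i _ => hFb i x).trans (by simp))) 2
  have h1 := lintegral_mul_indicator_le (κ := π) (f := fun _ => 1) (fun _ => zero_le_one)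
    (b := η * n) (by positivity) hDi
  have hms : MeasurableSet {x : Fin n → Fin d → ℝ | η * n < |∑ i, (f (x i) - e)|} :=
    measurableSet_lt measurable_const (by fun_prop)
  simp only [ENNReal.ofReal_one, one_mul] at h1
  rw [lintegral_indicator_one hms] at h1
  have h2 : π {x | η * n < |∑ i, (x i k * x i l - ∫ u, u k * u l ∂PX)|} ≤
      π {x : Fin n → Fin d → ℝ | η * n < |∑ i, (f (x i) - e)|} := by
    refine measure_mono_ae ?_
    have : ∀ᵐ x ∂π, ∀ i, f (x i) = x i k * x i l :=
      ae_all_iff.2 fun i =>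
      (Measure.tendsto_eval_ae_ae (μ := fun _ : Fin n => PX) (i := i)).eventually hfe
    filter_upwards [this] with x hx hx'
    change η * n < |∑ i, (f (x i) - e)|
    simp only [hx, hee]
    exact hx'
  refine h2.trans (h1.trans (ENNReal.ofReal_le_ofReal ?_))
  rw [deviationBound]
  refine div_le_div_of_nonneg_right ?_ (by positivity)
  refine hsq.trans_eq ?_
  simp
  ring

end Interference

/-! ### Probabilities under the joint law -/

namespace Interference

open scoped ENNReal

variable {Ω : Type*} [MeasurableSpace Ω] {P : Measure Ω} {n d : ℕ} {μ : Measure ℝ}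
  {PX : Measure (Fin d → ℝ)} {A W : Ω → Matrix (Fin n) (Fin n) ℝ} {p : Param d} {γ : Fin d → ℝ}

/-- Disintegration bound for events that do not involve the auxiliary variables. -/
lemma experimentLaw_le [IsProbabilityMeasure PX] {E : Set (Ω × Data n d)} (hE : MeasurableSet E) :
    experimentLaw P μ PX A W p γ {s | (s.1, s.2.1) ∈ E} ≤
      ∫⁻ ω, ∫⁻ x, ∑ t, ENNReal.ofReal (propensity (W ω) γ x t) *
        ∫⁻ y, ENNReal.ofReal (outcomeDensity μ (A ω) p x t y) * E.indicator 1 (ω, x, t, y)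
          ∂(Measure.pi fun _ : Fin n => μ) ∂(Measure.pi fun _ : Fin n => PX) ∂P := by
  have hT : IsProbabilityMeasure (uniformOn (Set.univ : Set (Treatments n))) :=
    isProbabilityMeasure_uniformOn Set.finite_univ Set.univ_nonempty
  have hms : MeasurableSet {s : Ω × Data n d × Auxiliary n d | (s.1, s.2.1) ∈ E} :=
    (measurable_fst.prodMk (measurable_fst.comp measurable_snd)) hE
  rw [experimentLaw, withDensity_apply _ hms, ← lintegral_indicator hms]
  -- Only the inequality half of Tonelli's theorem is used, which needs no measurability of the
  -- density.
  refine (lintegral_prod_le _).trans (lintegral_mono fun ω => ?_)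
  refine (lintegral_prod_le _).trans ?_
  have haux : ∀ z : Data n d, ∫⁻ a : Auxiliary n d,
      {s : Ω × Data n d × Auxiliary n d | (s.1, s.2.1) ∈ E}.indicator
        (fun s => ENNReal.ofReal (dataDensity μ (A s.1) (W s.1) p γ s.2.1)) (ω, z, a)
        ∂((uniformOn (Set.univ : Set (Treatments n))).prod (Measure.pi fun _ : Fin n => PX)) =
      ENNReal.ofReal (propensity (W ω) γ z.1 z.2.1) *
        (ENNReal.ofReal (outcomeDensity μ (A ω) p z.1 z.2.1 z.2.2) * E.indicator 1 (ω, z)) := by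
    intro z
    have : ∀ a : Auxiliary n d, {s : Ω × Data n d × Auxiliary n d | (s.1, s.2.1) ∈ E}.indicator
        (fun s => ENNReal.ofReal (dataDensity μ (A s.1) (W s.1) p γ s.2.1)) (ω, z, a) =
        ENNReal.ofReal (propensity (W ω) γ z.1 z.2.1) *
        (ENNReal.ofReal (outcomeDensity μ (A ω) p z.1 z.2.1 z.2.2) * E.indicator 1 (ω, z)) := by
      intro a
      by_cases h : (ω, z) ∈ E
      · rw [Set.indicator_of_mem (by exact h), Set.indicator_of_mem h, Pi.one_apply, mul_one,
          dataDensity, ENNReal.ofReal_mul (propensity_nonneg _ _ _ _)]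
      · rw [Set.indicator_of_notMem (by exact h), Set.indicator_of_notMem h, mul_zero, mul_zero]
    simp only [this, lintegral_const, measure_univ, mul_one]
  simp only [haux]
  refine (lintegral_prod_le _).trans (lintegral_mono fun x => ?_)
  refine (lintegral_prod_le _).trans ?_
  rw [lintegral_count, tsum_fintype]
  refine Finset.sum_le_sum fun t _ => ?_
  exact (lintegral_const_mul' _ _ ENNReal.ofReal_ne_top).le

lemma indicator_le_of_mem_imp {X Y : Type*} {E : Set X} {F : Set Y} {u : X} {v : Y}
    (h : u ∈ E → v ∈ F) : E.indicator (1 : X → ℝ≥0∞) u ≤ F.indicator 1 v := by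
  by_cases hu : u ∈ E
  · rw [Set.indicator_of_mem hu, Set.indicator_of_mem (h hu)]; rfl
  · rw [Set.indicator_of_notMem hu]; exact zero_le

/-- Events determined by the interaction matrices. -/
lemma experimentLaw_matrix_le [IsProbabilityMeasure PX] [IsFiniteMeasure μ] (hμ : UnitCarried μ)
    {S : Set Ω} (hS : MeasurableSet S) :
    experimentLaw P μ PX A W p γ {s | s.1 ∈ S} ≤ P S := by
  refine (experimentLaw_le (E := Prod.fst ⁻¹' S) (measurable_fst hS)).trans ?_
  rw [← lintegral_indicator_one hS]
  refine lintegral_mono fun ω => ?_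
  have h1 : ∀ x : Covariates n d, ∀ t : Treatments n,
      ∫⁻ y, ENNReal.ofReal (outcomeDensity μ (A ω) p x t y) *
        (Prod.fst ⁻¹' S : Set (Ω × Data n d)).indicator 1 (ω, x, t, y)
          ∂(Measure.pi fun _ : Fin n => μ) ≤ S.indicator 1 ω := fun x t => by
    refine (lintegral_mono fun y => mul_le_mul_right (indicator_le_of_mem_imp (F := S) (v := ω)
      fun h => h) _).trans ?_
    rw [lintegral_mul_const' _ _ (by by_cases h : ω ∈ S <;> simp [h]),
      lintegral_outcomeDensity hμ, one_mul]
  calc _ ≤ ∫⁻ _x : Covariates n d, S.indicator 1 ω ∂(Measure.pi fun _ : Fin n => PX) := by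
        refine lintegral_mono fun x => ?_
        refine (Finset.sum_le_sum fun t _ => mul_le_mul_right (h1 x t) _).trans ?_
        rw [← Finset.sum_mul, sum_propensity, one_mul]
    _ = S.indicator 1 ω := by simp

/-- Events whose conditional probability given matrices, covariates and treatments is small. -/
lemma experimentLaw_outcome_le [IsProbabilityMeasure P] [IsProbabilityMeasure PX]
    {E : Set (Ω × Data n d)} (hE : MeasurableSet E) {b : ℝ≥0∞}
    (h : ∀ ω x t, ∫⁻ y, ENNReal.ofReal (outcomeDensity μ (A ω) p x t y) *
      E.indicator 1 (ω, x, t, y) ∂(Measure.pi fun _ : Fin n => μ) ≤ b) :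
    experimentLaw P μ PX A W p γ {s | (s.1, s.2.1) ∈ E} ≤ b := by
  refine (experimentLaw_le hE).trans ?_
  calc _ ≤ ∫⁻ _ω, ∫⁻ _x : Covariates n d, b ∂(Measure.pi fun _ : Fin n => PX) ∂P := by
        refine lintegral_mono fun ω => lintegral_mono fun x => ?_
        refine (Finset.sum_le_sum fun t _ => mul_le_mul_right (h ω x t) _).trans ?_
        rw [← Finset.sum_mul, sum_propensity, one_mul]
    _ = b := by simp

/-- Events whose conditional probability given matrices and covariates is small. -/
lemma experimentLaw_treatment_le [IsProbabilityMeasure P] [IsProbabilityMeasure PX]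
    [IsFiniteMeasure μ] (hμ : UnitCarried μ)
    {E : Set (Ω × Covariates n d × Treatments n)}
    (hE : MeasurableSet {s : Ω × Data n d | (s.1, s.2.1, s.2.2.1) ∈ E}) {b : ℝ≥0∞}
    (h : ∀ ω x, ∑ t, ENNReal.ofReal (propensity (W ω) γ x t) *
      E.indicator 1 (ω, x, t) ≤ b) :
    experimentLaw P μ PX A W p γ {s | (s.1, s.2.1.1, s.2.1.2.1) ∈ E} ≤ b := by
  refine (experimentLaw_le hE).trans ?_
  calc _ ≤ ∫⁻ _ω, ∫⁻ _x : Covariates n d, b ∂(Measure.pi fun _ : Fin n => PX) ∂P := by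
        refine lintegral_mono fun ω => lintegral_mono fun x => ?_
        refine (Finset.sum_le_sum fun t _ => mul_le_mul_right ?_ _).trans (h ω x)
        refine (lintegral_mono fun y => mul_le_mul_right (indicator_le_of_mem_imp (F := E)
          (v := (ω, x, t)) fun h => h) _).trans ?_
        rw [lintegral_mul_const' _ _ (by by_cases h : (ω, x, t) ∈ E <;> simp [h]),
          lintegral_outcomeDensity hμ, one_mul]
    _ = b := by simp

/-- Events determined by the covariates. -/
lemma experimentLaw_covariate_le [IsProbabilityMeasure P] [IsProbabilityMeasure PX]
    [IsFiniteMeasure μ] (hμ : UnitCarried μ) {E : Set (Covariates n d)} (hE : MeasurableSet E) :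
    experimentLaw P μ PX A W p γ {s | s.2.1.1 ∈ E} ≤ (Measure.pi fun _ : Fin n => PX) E := by
  refine (experimentLaw_le (E := {s : Ω × Data n d | s.2.1 ∈ E})
    ((measurable_fst.comp measurable_snd) hE)).trans ?_
  calc _ ≤ ∫⁻ _ω, ∫⁻ x : Covariates n d, E.indicator 1 x ∂(Measure.pi fun _ : Fin n => PX) ∂P := by
        refine lintegral_mono fun ω => lintegral_mono fun x => ?_
        have h1 : ∀ t : Treatments n, ∫⁻ y, ENNReal.ofReal (outcomeDensity μ (A ω) p x t y) *
            {s : Ω × Data n d | s.2.1 ∈ E}.indicator 1 (ω, x, t, y)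
            ∂(Measure.pi fun _ : Fin n => μ) ≤ E.indicator 1 x := fun t => by
          refine (lintegral_mono fun y => mul_le_mul_right (indicator_le_of_mem_imp (F := E)
            (v := x) fun h => h) _).trans ?_
          rw [lintegral_mul_const' _ _ (by by_cases h : x ∈ E <;> simp [h]),
            lintegral_outcomeDensity hμ, one_mul]
        refine (Finset.sum_le_sum fun t _ => mul_le_mul_right (h1 t) _).trans ?_
        rw [← Finset.sum_mul, sum_propensity, one_mul]
    _ = _ := by rw [lintegral_const, measure_univ, mul_one, lintegral_indicator_one hE]

/-- The data and the auxiliary covariates are almost surely bounded. -/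
lemma experimentLaw_ae_mem [SFinite P] [IsProbabilityMeasure PX] [IsFiniteMeasure μ]
    (hμ : UnitCarried μ) (hPX : ∀ᵐ x ∂PX, ∀ k, x k ∈ Set.Icc (-1 : ℝ) 1) :
    ∀ᵐ s ∂(experimentLaw P μ PX A W p γ),
      (∀ i k, s.2.1.1 i k ∈ Set.Icc (-1 : ℝ) 1) ∧ (∀ i, s.2.1.2.2 i ∈ Set.Icc (-1 : ℝ) 1) ∧
      ∀ i k, s.2.2.2 i k ∈ Set.Icc (-1 : ℝ) 1 := by
  have hX : ∀ᵐ x ∂(Measure.pi fun _ : Fin n => PX), ∀ i k, x i k ∈ Set.Icc (-1 : ℝ) 1 :=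
    ae_all_iff.2 fun i => (Measure.tendsto_eval_ae_ae (μ := fun _ : Fin n => PX)
      (i := i)).eventually hPX
  refine (withDensity_absolutelyContinuous _ _).ae_le ?_
  have h1 := Measure.quasiMeasurePreserving_fst (ν := (Measure.count :
    Measure (Treatments n)).prod (Measure.pi fun _ : Fin n => μ)) |>.ae hX
  have h2 := Measure.quasiMeasurePreserving_snd (μ := Measure.pi fun _ : Fin n => PX)
    (ν := (Measure.count : Measure (Treatments n)).prod (Measure.pi fun _ : Fin n => μ)) |>.ae
    (Measure.quasiMeasurePreserving_snd (μ := (Measure.count : Measure (Treatments n)))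
      (ν := Measure.pi fun _ : Fin n => μ) |>.ae (hμ.ae_pi_mem n))
  have h3 := Measure.quasiMeasurePreserving_snd
    (μ := uniformOn (Set.univ : Set (Treatments n))) |>.ae hX
  have h12 := Measure.quasiMeasurePreserving_fst (ν := (uniformOn (Set.univ :
    Set (Treatments n))).prod (Measure.pi fun _ : Fin n => PX)) |>.ae (h1.and h2)
  have h33 := Measure.quasiMeasurePreserving_snd (μ := (Measure.pi fun _ : Fin n => PX).prod
    ((Measure.count : Measure (Treatments n)).prod (Measure.pi fun _ : Fin n => μ))) |>.ae h3
  filter_upwards [Measure.quasiMeasurePreserving_snd (μ := P) |>.ae (h12.and h33)] with s hs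
  exact ⟨hs.1.1, hs.1.2, hs.2⟩

/-! ### Measurability of the regularity events -/

/-- The operator norm is a norm after a linear map on a finite-dimensional space, hence continuous
in the entries. -/
lemma measurable_opNorm (hA : ∀ i j, Measurable fun ω => A ω i j) :
    Measurable fun ω => opNorm (A ω) := by
  let L : (Fin n → Fin n → ℝ) →ₗ[ℝ]
      (EuclideanSpace ℝ (Fin n) →L[ℝ] EuclideanSpace ℝ (Fin n)) :=
    { toFun := fun a => Matrix.toEuclideanCLM (n := Fin n) (𝕜 := ℝ) (Matrix.of a)
      map_add' := fun a b => map_add (Matrix.toEuclideanCLM (n := Fin n) (𝕜 := ℝ)) (Matrix.of a)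
        (Matrix.of b)
      map_smul' := fun c a => map_smul (Matrix.toEuclideanCLM (n := Fin n) (𝕜 := ℝ)) c
        (Matrix.of a) }
  have hc : Continuous fun a => ‖L a‖ := L.continuous_of_finiteDimensional.norm
  exact hc.measurable.comp (measurable_pi_lambda _ fun i => measurable_pi_lambda _ fun j => hA i j)

lemma measurable_condMean_comp {X : Type*} [MeasurableSpace X] {ρ : Measure ℝ} (hρ : UnitCarried ρ)
    {B : X → Matrix (Fin n) (Fin n) ℝ} {h v : X → Fin n → ℝ}
    (hB : ∀ i j, Measurable fun x => B x i j) (hh : ∀ i, Measurable fun x => h x i)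
    (hv : ∀ i, Measurable fun x => v x i) (i : Fin n) :
    Measurable fun x => condMean ρ (B x) (h x) (v x) i := by
  refine (continuous_alpha' hρ).measurable.comp (Measurable.prodMk ?_ (hB i i))
  refine (Finset.measurable_sum _ fun j _ => (hB i j).mul ?_).add (hh i)
  by_cases hj : j = i
  · subst hj; simp
  · simpa [hj] using hv j

lemma measurable_spin_comp {X : Type*} [MeasurableSpace X] {f : X → Bool} (hf : Measurable f) :
    Measurable fun x => spin (f x) := measurable_spin.comp hf

end Interference

/-! ### Consistency of the estimator and stability under plug-in -/

namespace Interference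

open scoped ENNReal

variable {Ω : Type*} [MeasurableSpace Ω] {P : Measure Ω} {n d : ℕ} {μ : Measure ℝ}
  {PX : Measure (Fin d → ℝ)} {A W : Ω → Matrix (Fin n) (Fin n) ℝ} {p : Param d} {γ : Fin d → ℝ}

/-- The score statistics concentrate. -/
lemma experimentLaw_score_le [IsProbabilityMeasure P] [IsProbabilityMeasure PX]
    [IsFiniteMeasure μ] (hμ : UnitCarried μ) (hn : 0 < n)
    (hAm : ∀ i j, Measurable fun ω => A ω i j) (hA : ∀ ω, (A ω).IsSymm) (K : ℝ) {η : ℝ}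
    (hη : 0 < η) {c : Covariates n d → Treatments n → Fin n → ℝ}
    (hcm : ∀ i, Measurable fun q : Covariates n d × Treatments n => c q.1 q.2 i)
    (hc : ∀ x t i, (∀ i k, x i k ∈ Set.Icc (-1 : ℝ) 1) → |c x t i| ≤ 1) :
    experimentLaw P μ PX A W p γ {s | (opNorm (A s.1) ≤ K ∧
        ∀ i k, s.2.1.1 i k ∈ Set.Icc (-1 : ℝ) 1) ∧
      η * n < |∑ i, c s.2.1.1 s.2.1.2.1 i * (s.2.1.2.2 i -
        condMean μ (A s.1) (field p s.2.1.2.1 s.2.1.1) s.2.1.2.2 i)|} ≤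
      ENNReal.ofReal (deviationBound K η n) := by
  refine experimentLaw_outcome_le (E := {s : Ω × Data n d | (opNorm (A s.1) ≤ K ∧
        ∀ i k, s.2.1 i k ∈ Set.Icc (-1 : ℝ) 1) ∧
      η * n < |∑ i, c s.2.1 s.2.2.1 i * (s.2.2.2 i -
        condMean μ (A s.1) (field p s.2.2.1 s.2.1) s.2.2.2 i)|}) ?_ fun ω x t => ?_
  · have m1 : Measurable fun s : Ω × Data n d => opNorm (A s.1) :=
      (measurable_opNorm hAm).comp measurable_fst
    have m2 : ∀ i k, Measurable fun s : Ω × Data n d => s.2.1 i k := fun i k => by fun_prop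
    have m3 : ∀ i, Measurable fun s : Ω × Data n d => field p s.2.2.1 s.2.1 i := fun i => by
      have := measurable_spin_comp (show Measurable fun s : Ω × Data n d => s.2.2.1 i by fun_prop)
      unfold field dotProduct
      fun_prop
    simp only [Set.ofPred_and]
    refine ((measurableSet_le m1 measurable_const).inter ?_).inter
      (measurableSet_lt measurable_const (Measurable.abs ?_))
    · simp only [Set.ofPred_forall]
      exact .iInter fun i => .iInter fun k => (m2 i k) measurableSet_Icc
    · refine Finset.measurable_sum _ fun i _ => Measurable.mul ?_ (Measurable.sub (by fun_prop) ?_)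
      · exact (hcm i).comp (by fun_prop : Measurable fun s : Ω × Data n d => (s.2.1, s.2.2.1))
      · exact measurable_condMean_comp hμ (fun i j => (hAm i j).comp measurable_fst) m3
          (fun i => by fun_prop) i
  -- The bounds on matrix and covariates are part of the event, so that the conditional estimate
  -- holds for every `ω` and `x`; where they fail the event is empty.
  · by_cases hg : opNorm (A ω) ≤ K ∧ ∀ i k, x i k ∈ Set.Icc (-1 : ℝ) 1
    · refine le_trans (lintegral_mono fun y => mul_le_mul_right
        (indicator_le_of_mem_imp (v := y) fun h => h.2) _)
        (lintegral_outcomeDensity_deviation_le hμ hn (hA ω) hg.1 p x t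
          (fun i => hc x t i hg.2) hη)
    · refine le_trans (le_of_eq ?_) zero_le
      rw [← lintegral_zero]
      refine lintegral_congr fun y => ?_
      rw [Set.indicator_of_notMem (fun h => hg h.1), mul_zero]

/-- The treatments are approximately centred. -/
lemma experimentLaw_centring_le [IsProbabilityMeasure P] [IsProbabilityMeasure PX]
    [IsFiniteMeasure μ] (hμ : UnitCarried μ) (hn : 0 < n)
    (hWm : ∀ i j, Measurable fun ω => W ω i j) (hW : ∀ ω, (W ω).IsSymm) (K : ℝ) {η : ℝ}
    (hη : 0 < η) (k : Fin d) :
    experimentLaw P μ PX A W p γ {s | (opNorm (W s.1) ≤ K ∧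
        ∀ i k, s.2.1.1 i k ∈ Set.Icc (-1 : ℝ) 1) ∧
      η * n < |∑ i, s.2.1.1 i k * (spin (s.2.1.2.1 i) - condMean spinMeasure (W s.1)
        (fun i => s.2.1.1 i ⬝ᵥ γ) (fun i => spin (s.2.1.2.1 i)) i)|} ≤
      ENNReal.ofReal (deviationBound K η n) := by
  refine experimentLaw_treatment_le hμ (E := {s : Ω × Covariates n d × Treatments n |
      (opNorm (W s.1) ≤ K ∧ ∀ i k, s.2.1 i k ∈ Set.Icc (-1 : ℝ) 1) ∧
      η * n < |∑ i, s.2.1 i k * (spin (s.2.2 i) - condMean spinMeasure (W s.1)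
        (fun i => s.2.1 i ⬝ᵥ γ) (fun i => spin (s.2.2 i)) i)|}) ?_ fun ω x => ?_
  · have m1 : Measurable fun s : Ω × Data n d => opNorm (W s.1) :=
      (measurable_opNorm hWm).comp measurable_fst
    have m2 : ∀ i k, Measurable fun s : Ω × Data n d => s.2.1 i k := fun i k => by fun_prop
    have m3 : ∀ i, Measurable fun s : Ω × Data n d => s.2.1 i ⬝ᵥ γ := fun i => by
      unfold dotProduct
      fun_prop
    have m4 : ∀ i, Measurable fun s : Ω × Data n d => spin (s.2.2.1 i) := fun i =>
      measurable_spin_comp (by fun_prop)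
    change MeasurableSet {s : Ω × Data n d | (opNorm (W s.1) ≤ K ∧
      ∀ i k, s.2.1 i k ∈ Set.Icc (-1 : ℝ) 1) ∧
      η * n < |∑ i, s.2.1 i k * (spin (s.2.2.1 i) - condMean spinMeasure (W s.1)
        (fun i => s.2.1 i ⬝ᵥ γ) (fun i => spin (s.2.2.1 i)) i)|}
    simp only [Set.ofPred_and]
    refine ((measurableSet_le m1 measurable_const).inter ?_).inter
      (measurableSet_lt measurable_const (Measurable.abs ?_))
    · simp only [Set.ofPred_forall]
      exact .iInter fun i => .iInter fun k => (m2 i k) measurableSet_Icc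
    · exact Finset.measurable_sum _ fun i _ => (m2 i k).mul ((m4 i).sub
        (measurable_condMean_comp unitCarried_spinMeasure
          (fun i j => (hWm i j).comp measurable_fst) m3 m4 i))
  · by_cases hg : opNorm (W ω) ≤ K ∧ ∀ i k, x i k ∈ Set.Icc (-1 : ℝ) 1
    · refine le_trans (Finset.sum_le_sum fun t _ => mul_le_mul_right
        (indicator_le_of_mem_imp (v := t) fun h => h.2) _)
        (sum_propensity_deviation_le hn (hW ω) hg.1 γ x
          (c := fun i => x i k) (fun i => abs_le.2 (hg.2 i k)) hη)
    · refine le_trans (le_of_eq ?_) zero_le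
      refine Finset.sum_eq_zero fun t _ => ?_
      rw [Set.indicator_of_notMem (fun h => hg h.1), mul_zero]

/-! ### Nondegenerate covariates and tightness of the operator norms -/

/-- A positive definite matrix dominates a multiple of the square of the supremum norm. -/
lemma exists_posDef_lower_bound {C : Matrix (Fin d) (Fin d) ℝ} (hC : C.PosDef) :
    ∃ lam > 0, ∀ θ : Fin d → ℝ, lam * ‖θ‖ ^ 2 ≤ θ ⬝ᵥ C *ᵥ θ := by
  have hpos : ∀ θ : Fin d → ℝ, θ ≠ 0 → 0 < θ ⬝ᵥ C *ᵥ θ := fun θ hθ => by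
    simpa using hC.dotProduct_mulVec_pos hθ
  have hcont : Continuous fun θ : Fin d → ℝ => θ ⬝ᵥ C *ᵥ θ := by
    unfold dotProduct mulVec dotProduct
    fun_prop
  have hhom : ∀ (s : ℝ) (θ : Fin d → ℝ), (s • θ) ⬝ᵥ C *ᵥ (s • θ) = s ^ 2 * (θ ⬝ᵥ C *ᵥ θ) :=
    fun s θ => by
      rw [mulVec_smul, smul_dotProduct, dotProduct_smul, smul_eq_mul, smul_eq_mul]; ring
  obtain ⟨lam, hlam, hb⟩ : ∃ lam > 0, ∀ θ ∈ Metric.sphere (0 : Fin d → ℝ) 1,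
      lam ≤ θ ⬝ᵥ C *ᵥ θ := by
    -- For `d = 0` the sphere is empty; otherwise compactness gives a positive minimum, and
    -- homogeneity extends it to all vectors.
    rcases (Metric.sphere (0 : Fin d → ℝ) 1).eq_empty_or_nonempty with h | h
    · exact ⟨1, one_pos, fun θ hθ => by simp [h] at hθ⟩
    · obtain ⟨u, hu, hmin⟩ := (isCompact_sphere (0 : Fin d → ℝ) 1).exists_isMinOn h
        hcont.continuousOn
      refine ⟨_, hpos u ?_, fun θ hθ => hmin hθ⟩
      rintro rfl
      simp at hu
  refine ⟨lam, hlam, fun θ => ?_⟩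
  by_cases hθ : θ = 0
  · simp [hθ]
  have hn : 0 < ‖θ‖ := norm_pos_iff.2 hθ
  have h1 := hb (‖θ‖⁻¹ • θ) (by
    rw [mem_sphere_zero_iff_norm, norm_smul, norm_inv, norm_norm, inv_mul_cancel₀ hn.ne'])
  rw [hhom, inv_pow, inv_mul_eq_div, le_div_iff₀ (by positivity)] at h1
  exact h1

/-- The second moment matrix is the covariance matrix plus the rank-one nonnegative form of the
mean. The design bound is stated with uncentred moments. -/
lemma exists_second_moment_lower_bound [IsProbabilityMeasure PX]
    (hPX : ∀ᵐ x ∂PX, ∀ k, x k ∈ Set.Icc (-1 : ℝ) 1) (hC : (covMatrix PX).PosDef) :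
    ∃ lam > 0, ∀ θ : Fin d → ℝ,
      lam * ‖θ‖ ^ 2 ≤ ∑ k, ∑ l, θ k * θ l * ∫ u, u k * u l ∂PX := by
  obtain ⟨lam, hlam, h⟩ := exists_posDef_lower_bound hC
  refine ⟨lam, hlam, fun θ => (h θ).trans ?_⟩
  have hmem : ∀ k, MemLp (fun x : Fin d → ℝ => x k) 2 PX := fun k => by
    refine MemLp.of_bound (measurable_pi_apply k).aestronglyMeasurable 1 ?_
    filter_upwards [hPX] with x hx
    exact abs_le.2 (hx k)
  have hcov : ∀ k l, ∫ u, u k * u l ∂PX =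
      covMatrix PX k l + (∫ u, u k ∂PX) * ∫ u, u l ∂PX := fun k l => by
    rw [covMatrix, Matrix.of_apply, covariance_eq_sub (hmem k) (hmem l)]
    simp
  have e1 : θ ⬝ᵥ covMatrix PX *ᵥ θ = ∑ k, ∑ l, θ k * θ l * covMatrix PX k l := by
    simp only [dotProduct, mulVec, Finset.mul_sum]
    exact Finset.sum_congr rfl fun k _ => Finset.sum_congr rfl fun l _ => by ring
  have e2 : ∑ k, ∑ l, θ k * θ l * ((∫ u, u k ∂PX) * ∫ u, u l ∂PX) =
      (∑ k, θ k * ∫ u, u k ∂PX) ^ 2 := by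
    rw [sq, Finset.sum_mul_sum]
    exact Finset.sum_congr rfl fun k _ => Finset.sum_congr rfl fun l _ => by ring
  simp only [hcov, mul_add, Finset.sum_add_distrib, e1, e2]
  have := sq_nonneg (∑ k, θ k * ∫ u, u k ∂PX)
  linarith

/-- Almost surely bounded random sequences are uniformly bounded with large probability. -/
lemma exists_uniform_bound [IsProbabilityMeasure P] {f g : ℕ → Ω → ℝ}
    (hf : ∀ n, Measurable (f n)) (hg : ∀ n, Measurable (g n))
    (hfb : ∀ᵐ ω ∂P, BddAbove (Set.range fun n => f n ω))
    (hgb : ∀ᵐ ω ∂P, BddAbove (Set.range fun n => g n ω)) {ε : ℝ≥0∞} (hε : 0 < ε) :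
    ∃ K : ℝ, 0 < K ∧ MeasurableSet {ω | ∃ n, K < f n ω ∨ K < g n ω} ∧
      P {ω | ∃ n, K < f n ω ∨ K < g n ω} < ε := by
  have hm : ∀ K : ℝ, MeasurableSet {ω | ∃ n, K < f n ω ∨ K < g n ω} := fun K => by
    simp only [Set.ofPred_exists]
    exact .iUnion fun n => (measurableSet_lt measurable_const (hf n)).union
      (measurableSet_lt measurable_const (hg n))
  have hanti : Antitone fun N : ℕ => {ω | ∃ n, (N : ℝ) + 1 < f n ω ∨ (N : ℝ) + 1 < g n ω} := by
    intro N N' hN ω ⟨n, hω⟩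
    have : (N : ℝ) ≤ N' := Nat.cast_le.2 hN
    exact ⟨n, hω.imp (fun h => by linarith) (fun h => by linarith)⟩
  -- The exceptional sets decrease in the threshold and their intersection is null by almost sure
  -- boundedness, so one deterministic `K` works outside a set of small probability, for all `n` at
  -- once.
  have ht := tendsto_measure_iInter_atTop (μ := P)
    (fun N : ℕ => (hm ((N : ℝ) + 1)).nullMeasurableSet) hanti ⟨0, measure_ne_top _ _⟩
  have h0 : P (⋂ N : ℕ, {ω | ∃ n, (N : ℝ) + 1 < f n ω ∨ (N : ℝ) + 1 < g n ω}) = 0 := by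
    rw [measure_eq_zero_iff_ae_notMem]
    filter_upwards [hfb, hgb] with ω ⟨a, ha⟩ ⟨b, hb⟩ hω
    obtain ⟨N, hN⟩ := exists_nat_gt (max a b)
    obtain ⟨n, hn⟩ := Set.mem_iInter.1 hω N
    have h1 : f n ω ≤ a := ha ⟨n, rfl⟩
    have h2 : g n ω ≤ b := hb ⟨n, rfl⟩
    have h3 := le_max_left a b
    have h4 := le_max_right a b
    rcases hn with hn | hn <;> linarith
  rw [h0] at ht
  obtain ⟨N, hN⟩ := (ht.eventually_lt_const hε).exists
  exact ⟨N + 1, by positivity, hm _, hN⟩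

/-! ### Reduction of plug-in stability to finitely many rare events -/

/-- Uniformly stable estimates are stable under plug-in of the maximum pseudo-likelihood
estimator. -/
theorem plugInStable_of_uniformlyStable [IsProbabilityMeasure P] [IsProbabilityMeasure PX]
    [IsFiniteMeasure μ] (hμ : UnitCarried μ) (hc : ∀ c : ℝ, ¬ ∀ᵐ x ∂μ, x = c)
    (hPX : ∀ᵐ x ∂PX, ∀ k, x k ∈ Set.Icc (-1 : ℝ) 1) (hC : (covMatrix PX).PosDef)
    {A W : ∀ n : ℕ, Ω → Matrix (Fin n) (Fin n) ℝ} {Θ : Set (Param d)} {p₀ : Param d}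
    {est : ∀ n : ℕ, Matrix (Fin n) (Fin n) ℝ → Data n d → Param d}
    (hAm : ∀ n i j, Measurable fun ω => A n ω i j) (hWm : ∀ n i j, Measurable fun ω => W n ω i j)
    (hA : ∀ n ω, (A n ω).IsSymm) (hW : ∀ n ω, (W n ω).IsSymm)
    (hAb : ∀ᵐ ω ∂P, BddAbove (Set.range fun n => opNorm (A n ω)))
    (hWb : ∀ᵐ ω ∂P, BddAbove (Set.range fun n => opNorm (W n ω)))
    (hΘ : IsClosed Θ) (hΘc : Convex ℝ Θ) (hp₀ : p₀ ∈ Θ) (hest : IsMPLE μ Θ est)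
    {effect : ∀ n : ℕ, Matrix (Fin n) (Fin n) ℝ → Auxiliary n d → Param d → ℝ}
    (heff : UniformlyStable p₀ effect) :
    PlugInStable P μ PX A W p₀ γ est effect := by
  intro ε hε
  rw [ENNReal.tendsto_atTop_zero]
  intro δ hδ
  obtain ⟨K, hK, hNm, hN⟩ := exists_uniform_bound (fun n => measurable_opNorm (hAm n))
    (fun n => measurable_opNorm (hWm n)) hAb hWb (ENNReal.half_pos hδ.ne')
  set N : Set Ω := {ω | ∃ n, K < opNorm (A n ω) ∨ K < opNorm (W n ω)} with hNdef
  obtain ⟨r, hr, hstab⟩ := heff K ε hε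
  obtain ⟨lam, hlam, hS⟩ := exists_second_moment_lower_bound hPX hC
  obtain ⟨η, hη, hcons⟩ := exists_isUniqueMaximizer_pseudoLikelihood hμ hc p₀ γ hlam hS hK hr
  -- The factor counts the deviation events: one score for the treatment, `d` scores for the
  -- covariates, `d` centring statistics and `d²` empirical second moments.
  have hb : Tendsto (fun n => (1 + d + d + d * d) * ENNReal.ofReal (deviationBound K η n)) atTop
      (𝓝 0) := by
    have h1 := ENNReal.tendsto_ofReal (tendsto_deviationBound K hη)
    rw [ENNReal.ofReal_zero] at h1
    have h2 : (1 + d + d + d * d : ℝ≥0∞) ≠ ∞ := by exact_mod_cast ENNReal.natCast_ne_top (1 + d + d + d * d)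
    simpa using ENNReal.Tendsto.const_mul h1 (Or.inr h2)
  obtain ⟨n₀, hn₀⟩ := eventually_atTop.1
    ((hb.eventually_lt_const (ENNReal.half_pos hδ.ne')).and (eventually_gt_atTop 0))
  refine ⟨n₀, fun n hn => ?_⟩
  obtain ⟨hbn, hnpos⟩ := hn₀ n hn
  set b := ENNReal.ofReal (deviationBound K η n) with hbdef
  set law := experimentLaw P μ PX (A n) (W n) p₀ γ with hlaw
  let E₁ : Set (Ω × Data n d × Auxiliary n d) := {s | (opNorm (A n s.1) ≤ K ∧
        ∀ i k, s.2.1.1 i k ∈ Set.Icc (-1 : ℝ) 1) ∧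
      η * n < |∑ i, spin (s.2.1.2.1 i) * (s.2.1.2.2 i -
        condMean μ (A n s.1) (field p₀ s.2.1.2.1 s.2.1.1) s.2.1.2.2 i)|}
  let E₂ : Fin d → Set (Ω × Data n d × Auxiliary n d) := fun k => {s | (opNorm (A n s.1) ≤ K ∧
        ∀ i k, s.2.1.1 i k ∈ Set.Icc (-1 : ℝ) 1) ∧
      η * n < |∑ i, s.2.1.1 i k * (s.2.1.2.2 i -
        condMean μ (A n s.1) (field p₀ s.2.1.2.1 s.2.1.1) s.2.1.2.2 i)|}
  let E₃ : Fin d → Set (Ω × Data n d × Auxiliary n d) := fun k => {s | (opNorm (W n s.1) ≤ K ∧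
        ∀ i k, s.2.1.1 i k ∈ Set.Icc (-1 : ℝ) 1) ∧
      η * n < |∑ i, s.2.1.1 i k * (spin (s.2.1.2.1 i) - condMean spinMeasure (W n s.1)
        (fun i => s.2.1.1 i ⬝ᵥ γ) (fun i => spin (s.2.1.2.1 i)) i)|}
  let E₄ : Fin d × Fin d → Set (Ω × Data n d × Auxiliary n d) := fun q =>
    {s | s.2.1.1 ∈ {x : Covariates n d |
      η * n < |∑ i, (x i q.1 * x i q.2 - ∫ u, u q.1 * u q.2 ∂PX)|}}
  have b₀ : law {s | s.1 ∈ N} ≤ P N := experimentLaw_matrix_le hμ hNm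
  have b₁ : law E₁ ≤ b := experimentLaw_score_le hμ hnpos (hAm n) (hA n) K hη
    (c := fun _ t i => spin (t i)) (fun i => measurable_spin_comp (by fun_prop))
    (fun x t i _ => (abs_spin _).le)
  have b₂ : ∀ k, law (E₂ k) ≤ b := fun k => experimentLaw_score_le hμ hnpos (hAm n) (hA n) K hη
    (c := fun x _ i => x i k) (fun i => by fun_prop) (fun x t i hx => abs_le.2 (hx i k))
  have b₃ : ∀ k, law (E₃ k) ≤ b := fun k =>
    experimentLaw_centring_le hμ hnpos (hWm n) (hW n) K hη k
  have b₄ : ∀ q, law (E₄ q) ≤ b := fun q => by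
    refine (experimentLaw_covariate_le hμ (measurableSet_lt measurable_const ?_)).trans
      ((covariate_deviation_le PX hPX hnpos q.1 q.2 hη).trans (ENNReal.ofReal_le_ofReal ?_))
    · fun_prop
    · rw [deviationBound, deviationBound]
      gcongr
  have hsub : law {s | ε < |effect n (A n s.1) s.2.2 p₀ -
      effect n (A n s.1) s.2.2 (est n (A n s.1) s.2.1)|} ≤
      law ({s | s.1 ∈ N} ∪ (E₁ ∪ (⋃ k, E₂ k) ∪ (⋃ k, E₃ k) ∪ (⋃ q, E₄ q))) := by
    -- Monotonicity holds for arbitrary sets: the event involves `est`, which may be non-measurable.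
    -- Off the rare events `est` equals the unique maximiser, within `r` of `p₀`, and stability of
    -- the estimate finishes.
    refine measure_mono_ae ?_
    filter_upwards [experimentLaw_ae_mem (P := P) (A := A n) (W := W n) (p := p₀) (γ := γ) hμ hPX]
      with s ⟨hsx, hsy, hsa⟩ hs
    by_contra hcon
    obtain ⟨hsN, hcon⟩ := not_or.1 hcon
    obtain ⟨hcon, h4⟩ := not_or.1 hcon
    obtain ⟨hcon, h3⟩ := not_or.1 hcon
    obtain ⟨h1, h2⟩ := not_or.1 hcon
    have h2' : ∀ k, s ∉ E₂ k := fun k hk => h2 (Set.mem_iUnion.2 ⟨k, hk⟩)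
    have h3' : ∀ k, s ∉ E₃ k := fun k hk => h3 (Set.mem_iUnion.2 ⟨k, hk⟩)
    have h4' : ∀ q, s ∉ E₄ q := fun q hq => h4 (Set.mem_iUnion.2 ⟨q, hq⟩)
    have hAK : opNorm (A n s.1) ≤ K := by
      by_contra h
      exact hsN ⟨n, Or.inl (not_le.1 h)⟩
    have hWK : opNorm (W n s.1) ≤ K := by
      by_contra h
      exact hsN ⟨n, Or.inr (not_le.1 h)⟩
    obtain ⟨p, hp, hpr⟩ := hcons n (A n s.1) (W n s.1) s.2.1 Θ hnpos (hA n s.1) hAK hWK hsx hsy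
      ⟨fun k => not_lt.1 fun h => h3' k ⟨⟨hWK, hsx⟩, h⟩, fun k l => not_lt.1 fun h => h4' (k, l) h⟩
      ⟨not_lt.1 fun h => h1 ⟨⟨hAK, hsx⟩, h⟩, fun k => not_lt.1 fun h => h2' k ⟨⟨hAK, hsx⟩, h⟩⟩
      hΘ hΘc hp₀
    have hs' : ε < |effect n (A n s.1) s.2.2 p₀ -
      effect n (A n s.1) s.2.2 (est n (A n s.1) s.2.1)| := hs
    rw [hest n (A n s.1) s.2.1 p hp] at hs'
    exact absurd (hstab n (A n s.1) s.2.2 p hAK hsa hpr) (not_le.2 hs')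
  have hU : ∀ {ι : Type} [Fintype ι] (E : ι → Set (Ω × Data n d × Auxiliary n d)),
      (∀ k, law (E k) ≤ b) → law (⋃ k, E k) ≤ Fintype.card ι * b := fun E hE => by
    refine (measure_iUnion_fintype_le law E).trans ((Finset.sum_le_sum fun k _ => hE k).trans ?_)
    simp
  calc _ ≤ _ := hsub
    _ ≤ P N + (b + d * b + d * b + (d * d : ℕ) * b) := by
        have u2 := hU E₂ b₂
        have u3 := hU E₃ b₃
        have u4 := hU E₄ b₄
        simp only [Fintype.card_fin, Fintype.card_prod] at u2 u3 u4
        exact (measure_union_le _ _).trans (add_le_add b₀ ((measure_union_le _ _).trans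
          (add_le_add ((measure_union_le _ _).trans (add_le_add ((measure_union_le _ _).trans
            (add_le_add b₁ u2)) u3)) u4)))
    _ = P N + (1 + d + d + d * d) * b := by push_cast; ring
    _ ≤ δ / 2 + δ / 2 := add_le_add hN.le hbn.le
    _ = δ := ENNReal.add_halves δ

end Interference

/-! ### Gaussian interactions -/

namespace Interference

/-- The Laplace transform of the square of a standard Gaussian variable at `1`. -/
noncomputable def gaussianSqLaplace : ℝ := ∫ z, Real.exp (-z ^ 2) ∂(gaussianReal 0 1)

lemma integrable_exp_neg_sq {X : Type*} [MeasurableSpace X] (κ : Measure X) [IsFiniteMeasure κ]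
    {f : X → ℝ} (hf : Measurable f) (hf0 : ∀ x, 0 ≤ f x) :
    Integrable (fun x => Real.exp (-f x)) κ :=
  .of_bound (C := 1) (by fun_prop) (.of_forall fun x => by
    rw [Real.norm_eq_abs, Real.abs_exp, Real.exp_le_one_iff]
    linarith [hf0 x])

lemma gaussianSqLaplace_pos : 0 < gaussianSqLaplace :=
  integral_exp_pos (integrable_exp_neg_sq _ (by fun_prop) fun z => sq_nonneg z)

/-- Equality would make the Gaussian variable almost surely zero, against its variance one.
Strictness is what gives exponential decay below. -/
lemma gaussianSqLaplace_lt_one : gaussianSqLaplace < 1 := by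
  have hi := integrable_exp_neg_sq (gaussianReal 0 1) (f := fun z => z ^ 2) (by fun_prop)
    fun z => sq_nonneg z
  have hle : gaussianSqLaplace ≤ 1 := by
    have := integral_mono hi (integrable_const (1 : ℝ)) fun z =>
      Real.exp_le_one_iff.2 (neg_nonpos.2 (sq_nonneg z))
    rw [gaussianSqLaplace]
    simpa using this
  refine lt_of_le_of_ne hle fun h => ?_
  have h1 : ∫ z, (1 - Real.exp (-z ^ 2)) ∂(gaussianReal 0 1) = 0 := by
    rw [integral_sub (integrable_const _) hi]
    change _ - gaussianSqLaplace = 0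
    simp [h]
  have h2 := (integral_eq_zero_iff_of_nonneg (fun z => sub_nonneg.2
    (Real.exp_le_one_iff.2 (neg_nonpos.2 (sq_nonneg z)))) ((integrable_const _).sub hi)).1 h1
  have h3 : ∀ᵐ z ∂(gaussianReal 0 1), z ^ 2 = (0 : ℝ) := by
    filter_upwards [h2] with z hz
    have hz' : 1 - Real.exp (-z ^ 2) = 0 := hz
    have : Real.exp (-z ^ 2) = 1 := by linarith
    linarith [(Real.exp_eq_one_iff _).1 this]
  have h4 := integral_sq_gaussian
  rw [integral_congr_ae h3] at h4
  simp at h4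

lemma integral_exp_neg_gaussian {β : ℝ} (hβ : 0 < β) {N : ℕ} (hN : 0 < N) :
    ∫ x, Real.exp (-(N / β ^ 2 * x ^ 2)) ∂(gaussianReal 0 (Real.toNNReal (β ^ 2 / N))) =
      gaussianSqLaplace := by
  have hN' : (0 : ℝ) < N := Nat.cast_pos.2 hN
  have hmap : gaussianReal 0 (Real.toNNReal (β ^ 2 / N)) =
      (gaussianReal 0 1).map fun z => β / √N * z := by
    rw [gaussianReal_map_const_mul, mul_zero, mul_one]
    congr 1
    ext
    simp only [Real.coe_toNNReal', NNReal.coe_mk]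
    rw [max_eq_left (by positivity), div_pow, Real.sq_sqrt hN'.le]
  rw [hmap, integral_map (by fun_prop) (by fun_prop), gaussianSqLaplace]
  refine integral_congr_ae (.of_forall fun z => ?_)
  simp only
  rw [mul_pow, div_pow, Real.sq_sqrt hN'.le]
  field_simp

variable {Ω : Type*} [MeasurableSpace Ω] {P : Measure Ω}

/-- The operator norm of a Gaussian interaction matrix is rarely small. -/
lemma gaussian_opNorm_small_le [IsProbabilityMeasure P] {β : ℝ} (hβ : 0 < β) {m : ℕ}
    {A : Ω → Matrix (Fin (m + 1)) (Fin (m + 1)) ℝ} (hAm : ∀ i j, Measurable fun ω => A ω i j)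
    (hA : IsGaussianInteraction P β A) {κ c : ℝ} (hc : c ^ 2 ≤ κ * β ^ 2) :
    P.real {ω | opNorm (A ω) ≤ c} ≤ Real.exp (κ * (m + 1)) * gaussianSqLaplace ^ m := by
  obtain ⟨hsymm, -, hlaw, hind⟩ := hA
  -- The first row of a matrix of size `m + 1` supplies `m` independent entries above the diagonal.
  let g : Fin m → {e : Fin (m + 1) × Fin (m + 1) // e.1 < e.2} :=
    fun j => ⟨(0, j.succ), Fin.succ_pos j⟩
  have hg : Function.Injective g := fun j j' h => by
    have : (0, j.succ) = ((0 : Fin (m + 1)), j'.succ) := congrArg Subtype.val h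
    exact Fin.succ_injective _ (Prod.ext_iff.1 this).2
  set s : ℝ := ((m + 1 : ℕ) : ℝ) / β ^ 2 with hs
  have hs0 : 0 < s := by positivity
  have hprod := (hind.precomp hg).integral_fun_prod_comp (f := fun _ x => Real.exp (-(s * x ^ 2)))
    (fun j => (hAm 0 j.succ).aemeasurable) (fun j => by fun_prop)
  have hfac : ∀ j : Fin m, ∫ ω, Real.exp (-(s * A ω 0 j.succ ^ 2)) ∂P = gaussianSqLaplace := by
    intro j
    rw [← integral_exp_neg_gaussian hβ (Nat.succ_pos m), ← hlaw 0 j.succ (Fin.succ_pos j),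
      integral_map (hAm 0 j.succ).aemeasurable (by fun_prop)]
  have hval : ∫ ω, Real.exp (-∑ j : Fin m, s * A ω 0 j.succ ^ 2) ∂P = gaussianSqLaplace ^ m := by
    simp only [← Finset.sum_neg_distrib, Real.exp_sum]
    refine hprod.trans ?_
    refine (Finset.prod_congr rfl fun j _ => hfac j).trans ?_
    simp
  have hfm : Measurable fun ω => ∑ j : Fin m, s * A ω 0 j.succ ^ 2 :=
    Finset.measurable_sum _ fun j _ => ((hAm 0 j.succ).pow_const 2).const_mul s
  have hmarkov := mul_meas_ge_le_integral_of_nonneg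
    (.of_forall fun ω => (Real.exp_pos (-∑ j : Fin m, s * A ω 0 j.succ ^ 2)).le)
    (integrable_exp_neg_sq P hfm fun ω => Finset.sum_nonneg fun j _ => by positivity)
    (Real.exp (-(κ * (m + 1))))
  rw [hval] at hmarkov
  -- A small operator norm bounds the squared length of the first column, equal to the first row by
  -- symmetry. Markov's inequality for the exponential of its negative multiple then gives a
  -- Chernoff bound.
  have hsub : {ω | opNorm (A ω) ≤ c} ⊆
      {ω | Real.exp (-(κ * (m + 1))) ≤ Real.exp (-∑ j : Fin m, s * A ω 0 j.succ ^ 2)} := by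
    intro ω hω
    refine Real.exp_le_exp.2 (neg_le_neg ?_)
    have h1 := sum_col_sq_le (show opNorm (A ω) ≤ c from hω) 0
    rw [Fin.sum_univ_succ] at h1
    have h2 : ∀ j : Fin m, A ω j.succ 0 = A ω 0 j.succ := fun j => (hsymm ω).apply _ _
    simp only [h2] at h1
    rw [← Finset.mul_sum]
    have h3 : ∑ j : Fin m, A ω 0 j.succ ^ 2 ≤ κ * β ^ 2 := by
      linarith [sq_nonneg (A ω 0 0)]
    calc s * ∑ j : Fin m, A ω 0 j.succ ^ 2 ≤ s * (κ * β ^ 2) := by gcongr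
      _ = κ * (m + 1) := by rw [hs]; push_cast; field_simp
  have hmono := measureReal_mono (μ := P) hsub
  have hE := Real.exp_pos (-(κ * (m + 1)))
  have h5 := mul_le_mul_of_nonneg_left hmono hE.le
  have h6 := mul_le_mul_of_nonneg_left (h5.trans hmarkov) (Real.exp_pos (κ * (m + 1))).le
  rwa [← mul_assoc, ← Real.exp_add, add_neg_cancel, Real.exp_zero, one_mul] at h6

/-- Half of the exponential rate of decay of the probability of small operator norms. -/
noncomputable def gaussianRate : ℝ := -Real.log gaussianSqLaplace / 2

lemma gaussianRate_pos : 0 < gaussianRate :=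
  div_pos (neg_pos.2 (Real.log_neg gaussianSqLaplace_pos gaussianSqLaplace_lt_one)) two_pos

/-- Gaussian interactions with small operator norm have small variance. -/
lemma lt_of_isGaussianInteraction [IsProbabilityMeasure P] {β β₀ : ℝ} (hβ : 0 < β) (hβ₀ : 0 < β₀)
    {A : ∀ n : ℕ, Ω → Matrix (Fin n) (Fin n) ℝ} (hAm : ∀ n i j, Measurable fun ω => A n ω i j)
    (hA : ∀ n, IsGaussianInteraction P β (A n))
    (hAb : ∀ᵐ ω ∂P, BddAbove (Set.range fun n => opNorm (A n ω)))
    (hlim : ∀ᵐ ω ∂P, limsup (fun n => opNorm (A n ω)) atTop ≤ β₀ * √gaussianRate / 2) :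
    β < β₀ := by
  by_contra! hcon
  have hrate := gaussianRate_pos
  set κ := gaussianRate with hκ
  -- `c` is twice the bound on the limsup, so eventually the norm is below `c` almost surely. If `β
  -- ≥ β₀`, then `c² ≤ κ β²`, and the same event has exponentially small probability.
  set c := β₀ * √κ with hc
  have hc0 : 0 < c := mul_pos hβ₀ (Real.sqrt_pos.2 hrate)
  have hc2 : c ^ 2 ≤ κ * β ^ 2 := by
    rw [hc, mul_pow, Real.sq_sqrt hrate.le, mul_comm]
    gcongr
  have hev : ∀ᵐ ω ∂P, ∀ᶠ n in atTop, ω ∈ {ω | opNorm (A n ω) ≤ c} ↔ ω ∈ (Set.univ : Set Ω) := by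
    filter_upwards [hAb, hlim] with ω h1 h2
    have h3 : limsup (fun n => opNorm (A n ω)) atTop < c := h2.trans_lt (by linarith)
    filter_upwards [eventually_lt_of_limsup_lt h3 h1.isBoundedUnder_of_range] with n hn
    exact ⟨fun _ => Set.mem_univ _, fun _ => hn.le⟩
  have ht := tendsto_measure_of_ae_tendsto_indicator_of_isFiniteMeasure (μ := P) atTop
    MeasurableSet.univ
    (fun n => measurableSet_le (measurable_opNorm (hAm n)) measurable_const) hev
  rw [measure_univ] at ht
  have ht' := (ENNReal.tendsto_toReal ENNReal.one_ne_top).comp ((tendsto_add_atTop_iff_nat 1).2 ht)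
  -- Half of the logarithmic rate is spent against the factor `exp (κ (m + 1))`; the other half
  -- leaves the decaying power of `√gaussianSqLaplace`.
  have hexp : Real.exp κ * √gaussianSqLaplace = 1 := by
    rw [Real.sqrt_eq_rpow, Real.rpow_def_of_pos gaussianSqLaplace_pos, ← Real.exp_add, hκ,
      gaussianRate]
    rw [Real.exp_eq_one_iff]
    ring
  have hbound : ∀ m : ℕ, (P {ω | opNorm (A (m + 1) ω) ≤ c}).toReal ≤
      Real.exp κ * √gaussianSqLaplace ^ m := fun m => by
    refine (gaussian_opNorm_small_le hβ (hAm (m + 1)) (hA (m + 1)) hc2).trans_eq ?_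
    have h1 : Real.exp (κ * (m + 1)) = Real.exp κ ^ m * Real.exp κ := by
      rw [← Real.exp_nat_mul, ← Real.exp_add]; ring_nf
    have h2 : gaussianSqLaplace ^ m = √gaussianSqLaplace ^ m * √gaussianSqLaplace ^ m := by
      rw [← mul_pow, Real.mul_self_sqrt gaussianSqLaplace_pos.le]
    rw [h1, h2]
    calc _ = (Real.exp κ * √gaussianSqLaplace) ^ m * (Real.exp κ * √gaussianSqLaplace ^ m) := by
          rw [mul_pow]; ring
      _ = _ := by rw [hexp, one_pow, one_mul]
  have hsq : √gaussianSqLaplace < 1 := by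
    rw [Real.sqrt_lt' one_pos, one_pow]; exact gaussianSqLaplace_lt_one
  have h0 := (tendsto_pow_atTop_nhds_zero_of_lt_one (Real.sqrt_nonneg _) hsq).const_mul
    (Real.exp κ)
  rw [mul_zero] at h0
  have := le_of_tendsto_of_tendsto' ht' h0 hbound
  norm_num at this

end Interference

/-! ### Assembly of the theorem -/

theorem mainTheorem5 :
    ∃ C₀ : ℝ, 0 < C₀ ∧ ∃ β₀ : ℝ, 0 < β₀ ∧
      ∀ (d : ℕ) (μ : Measure ℝ) [IsProbabilityMeasure μ]
        (PX : Measure (Fin d → ℝ)) [IsProbabilityMeasure PX],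
        (∀ᵐ y ∂μ, y ∈ Set.Icc (-1 : ℝ) 1) → μ.support.Nontrivial →
        (∀ᵐ x ∂PX, ∀ k, x k ∈ Set.Icc (-1 : ℝ) 1) → (covMatrix PX).PosDef →
        -- below `β₀` both fixed point systems are uniquely solvable
        (∀ β : ℝ, 0 < β → β < β₀ → ∀ p : Param d,
          (∃! w, IsFixedPoint μ (fieldLaw PX p) β w) ∧
          (∃! w, IsFixedPoint μ (controlFieldLaw PX p) β w)) ∧
        ∀ (Ω : Type*) [MeasurableSpace Ω] (P : Measure Ω) [IsProbabilityMeasure P]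
          (A W : ∀ n : ℕ, Ω → Matrix (Fin n) (Fin n) ℝ)
          (Θ : Set (Param d)) (p₀ : Param d) (γ₀ : Fin d → ℝ)
          (est : ∀ n : ℕ, Matrix (Fin n) (Fin n) ℝ → Data n d → Param d),
          (∀ n i j, Measurable fun ω => A n ω i j) →
          (∀ n i j, Measurable fun ω => W n ω i j) →
          (∀ n ω, (A n ω).IsSymm) → (∀ n ω, (W n ω).IsSymm) →
          (∀ᵐ ω ∂P, BddAbove (Set.range fun n => opNorm (A n ω))) →
          (∀ᵐ ω ∂P, BddAbove (Set.range fun n => opNorm (W n ω))) →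
          (∀ᵐ ω ∂P, limsup (fun n => opNorm (A n ω)) atTop ≤ C₀) →
          IsClosed Θ → Convex ℝ Θ → p₀ ∈ Θ → IsMPLE μ Θ est →
          ∀ M : ℕ, 1 ≤ M →
            -- the mean-field algorithm
            (PlugInStable P μ PX A W p₀ γ₀ est (fun _ B a p => meanFieldDE μ B M a p) ∧
              PlugInStable P μ PX A W p₀ γ₀ est (fun _ B a p => meanFieldIE μ B M a p)) ∧
            -- the AMP algorithm
            (∀ β : ℝ, 0 < β → (β < β₀ ∨ ∀ n, IsGaussianInteraction P β (A n)) →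
              PlugInStable P μ PX A W p₀ γ₀ est (fun _ B a p => ampDE μ PX β B M a p) ∧
              PlugInStable P μ PX A W p₀ γ₀ est (fun _ B a p => ampIE μ PX β B M a p)) := by
  have hβ₀ : (0 : ℝ) < 1 / 10 := by norm_num
  -- `C₀` is the largest limsup bound accepted by `lt_of_isGaussianInteraction` with `β₀ = 1 / 10`.
  refine ⟨1 / 10 * √gaussianRate / 2, by have := Real.sqrt_pos.2 gaussianRate_pos; positivity,
    1 / 10, hβ₀, ?_⟩
  intro d μ _ PX _ hμI hsupp hPX hC
  have hμ : UnitCarried μ := ⟨inferInstance, IsProbabilityMeasure.ne_zero μ, hμI⟩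
  -- A measure carried by the closed set `{c}` has its support inside it.
  have hconst : ∀ c : ℝ, ¬ ∀ᵐ x ∂μ, x = c := fun c h =>
    hsupp.not_subset_singleton (Measure.support_subset_of_isClosed isClosed_singleton h)
  refine ⟨fun β hβ hβ' p => ?_, ?_⟩
  · have : IsProbabilityMeasure (uniformOn (Set.univ : Set Bool)) :=
      isProbabilityMeasure_uniformOn Set.finite_univ Set.univ_nonempty
    have i1 : IsProbabilityMeasure (fieldLaw PX p) :=
      Measure.isProbabilityMeasure_map (measurable_fieldLaw p).aemeasurable
    have i2 : IsProbabilityMeasure (controlFieldLaw PX p) :=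
      Measure.isProbabilityMeasure_map (measurable_controlFieldLaw p).aemeasurable
    exact ⟨existsUnique_isFixedPoint hμ _ hβ.le hβ'.le,
      existsUnique_isFixedPoint hμ _ hβ.le hβ'.le⟩
  · intro Ω _ P _ A W Θ p₀ γ₀ est hAm hWm hA hW hAb hWb hlim hΘ hΘc hp₀ hest M _
    have key : ∀ {effect : ∀ n : ℕ, Matrix (Fin n) (Fin n) ℝ → Auxiliary n d → Param d → ℝ},
        UniformlyStable p₀ effect → PlugInStable P μ PX A W p₀ γ₀ est effect := fun h =>
      plugInStable_of_uniformlyStable hμ hconst hPX hC hAm hWm hA hW hAb hWb hΘ hΘc hp₀ hest h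
    refine ⟨⟨key (uniformlyStable_meanFieldDE hμ p₀ M), key (uniformlyStable_meanFieldIE hμ p₀ M)⟩,
      fun β hβ hβ' => ?_⟩
    have hlt : β < 1 / 10 := hβ'.elim id fun hG =>
      lt_of_isGaussianInteraction hβ hβ₀ hAm hG hAb hlim
    exact ⟨key (uniformlyStable_ampDE hμ PX hPX hβ.le hlt.le p₀ M),
      key (uniformlyStable_ampIE hμ PX hPX hβ.le hlt.le p₀ M)⟩
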